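/- Let $M$ be a smooth compact connected manifold without boundary, of dimension $n$, equipped with a smooth Riemannian metric $\langle\cdot,\cdot\rangle$ with norm $|\cdot|_q$ on $T_qM$, and let $Q\subset M\times M$ be a smooth closed submanifold. Let $L\in C^2([0,1]\times TM,\mathbb{R})$ satisfy: (L1') there is a constant $\ell_0>0$ such that $\partial_{vv}L(t,q,v)[w,w]\ge \ell_0|w|_q^2$ for all $t\in[0,1]$, $q\in M$, $v,w\in T_qM$; (L2') in local coordinates, near each point of $M$ there is a constant $\ell_1>0$ such that $$\|\partial_{vv}L(t,q,v)\|\le \ell_1,\qquad \|\partial_{qv}L(t,q,v)\|\le \ell_1(1+|v|_q),\qquad \|\partial_{qq}L(t,q,v)\|\le \ell_1(1+|v|_q^2)$$ for all $t\in[0,1]$ and all $v$ (since $M$ is compact, one constant serves for a finite system of such coordinates). Let $W^{1,2}([0,1],M)$ be the Hilbert manifold of curves of Sobolev class $W^{1,2}$, with the atlas given by the local parametrizations $$\varphi_*:W^{1,2}([0,1],U)\to W^{1,2}([0,1],M),\qquad \varphi_*(u)(t)=\varphi(t,u(t)),$$ where $U\subset\mathbb{R}^n$ is open and $(t,q)\mapsto(t,\varphi(t,q))$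 is a smooth diffeomorphism of $[0,1]\times U$ onto an open subset of $[0,1]\times M$. Its tangent space at $\gamma$ consists of the $W^{1,2}$ sections $\xi$ of $\gamma^*(TM)$, with the Riemannian metric whose norm is $\|\xi\|^2=\int_0^1(|\nabla_t\xi|^2+|\xi|^2)\,dt$, where $\nabla_t$ is the Levi-Civita covariant derivative along $\gamma$. Let $$W^{1,2}_Q([0,1],M)=\{\gamma\in W^{1,2}([0,1],M) : (\gamma(0),\gamma(1))\in Q\},$$ a closed submanifold with tangent space at $\gamma$ $$T_\gamma W^{1,2}_Q([0,1],M)=\{\xi\in T_\gamma W^{1,2}([0,1],M) : (\xi(0),\xi(1))\in T_{(\gamma(0),\gamma(1))}Q\}.$$ Then the action $\mathbb{A}_L(\gamma)=\int_0^1L(t,\gamma(t),\gamma'(t))\,dt$ is finite (its integrand is integrable) and of class $C^1$ on $W^{1,2}([0,1],M)$, and its restriction to $W^{1,2}_Q([0,1],M)$ satisfies the Palais–Smale condition: every sequence $(\gamma_h)$ in $W^{1,2}_Q([0,1],M)$ such that $\mathbb{A}_L(\gamma_h)$ is bounded and $$\sup\{|d\mathbb{A}_L(\gamma_h)[\xi]|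 : \xi\in T_{\gamma_h}W^{1,2}_Q([0,1],M),\ \|\xi\|\le 1\}\to 0$$ has a subsequence converging in $W^{1,2}_Q([0,1],M)$. -/

import Mathlib

open Set Filter Topology MeasureTheory Bundle
open scoped Manifold ContDiff ENNReal

noncomputable section

namespace ActionPS

/-- The model space `ℝⁿ` with its Euclidean norm. -/
abbrev Vec (n : ℕ) := EuclideanSpace ℝ (Fin n)

/-! ### The Sobolev space `W^{1,2}([0,1], ℝⁿ)` -/

/-- Lebesgue measure on `[0,1]`. -/
abbrev mu01 : Measure ℝ := volume.restrict (Icc (0 : ℝ) 1)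

/-- The Hilbert space `L²([0,1], ℝⁿ)`. -/
abbrev L2 (n : ℕ) := Lp (Vec n) 2 mu01

lemma L2.intervalIntegrable {n : ℕ} (w : L2 n) {a b : ℝ} (ha : a ∈ Icc (0 : ℝ) 1)
    (hb : b ∈ Icc (0 : ℝ) 1) : IntervalIntegrable w volume a b := by
  have h1 : IntegrableOn w (Icc (0 : ℝ) 1) volume :=
    (Lp.memLp w).integrable (by norm_num)
  rw [intervalIntegrable_iff]
  refine h1.mono_set ?_
  intro x hx
  rw [uIoc, mem_Ioc] at hx
  exact ⟨(le_min ha.1 hb.1).trans hx.1.le, hx.2.trans (max_le ha.2 hb.2)⟩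

lemma L2.integral_add {n : ℕ} (w w' : L2 n) :
    ∀ t ∈ Icc (0 : ℝ) 1, ∫ s in (0 : ℝ)..t, (w + w' : L2 n) s =
      (∫ s in (0 : ℝ)..t, w s) + ∫ s in (0 : ℝ)..t, w' s := by
  intro t ht
  have h0 : (0 : ℝ) ∈ Icc (0 : ℝ) 1 := ⟨le_rfl, zero_le_one⟩
  rw [← intervalIntegral.integral_add (L2.intervalIntegrable w h0 ht)
    (L2.intervalIntegrable w' h0 ht)]
  apply intervalIntegral.integral_congr_ae
  have := (ae_restrict_iff' measurableSet_Icc).1 (Lp.coeFn_add w w')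
  filter_upwards [this] with x hx hxt
  rw [uIoc_of_le ht.1] at hxt
  exact hx ⟨hxt.1.le, hxt.2.trans ht.2⟩

lemma L2.integral_smul {n : ℕ} (c : ℝ) (w : L2 n) :
    ∀ t ∈ Icc (0 : ℝ) 1, ∫ s in (0 : ℝ)..t, (c • w : L2 n) s =
      c • ∫ s in (0 : ℝ)..t, w s := by
  intro t ht
  rw [← intervalIntegral.integral_smul]
  apply intervalIntegral.integral_congr_ae
  have := (ae_restrict_iff' measurableSet_Icc).1 (Lp.coeFn_smul c w)
  filter_upwards [this] with x hx hxt
  rw [uIoc_of_le ht.1] at hxt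
  exact hx ⟨hxt.1.le, hxt.2.trans ht.2⟩

/-- The Hilbert space `W^{1,2}([0,1], ℝⁿ)`: the pairs `(u, w)` in `L² × L²` such that `u` is
absolutely continuous with derivative `w`, i.e. `u(t) = c + ∫₀ᵗ w` for almost every `t`.
The norm is the standard one, `‖u‖² = ∫ |u|² + ∫ |w|²`. -/
def W12 (n : ℕ) : Submodule ℝ (WithLp 2 (L2 n × L2 n)) where
  carrier := {p | ∃ c : Vec n, p.fst =ᵐ[mu01] fun t => c + ∫ s in (0 : ℝ)..t, p.snd s}
  add_mem' := by
    rintro p q ⟨c, hc⟩ ⟨d, hd⟩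
    refine ⟨c + d, ?_⟩
    have hm : ∀ᵐ t ∂mu01, t ∈ Icc (0 : ℝ) 1 := ae_restrict_mem measurableSet_Icc
    filter_upwards [hc, hd, hm, Lp.coeFn_add p.fst q.fst] with t h1 h2 h3 h4
    have h5 := L2.integral_add p.snd q.snd t h3
    simp only [WithLp.add_fst, WithLp.add_snd]
    rw [h4, h5, Pi.add_apply, h1, h2]
    abel
  zero_mem' := by
    refine ⟨0, ?_⟩
    have hm : ∀ᵐ t ∂mu01, t ∈ Icc (0 : ℝ) 1 := ae_restrict_mem measurableSet_Icc
    filter_upwards [hm, Lp.coeFn_zero (Vec n) 2 mu01] with t h3 h4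
    have h5 := L2.integral_smul (0 : ℝ) (0 : L2 n) t h3
    simp only [zero_smul] at h5
    simp only [WithLp.zero_fst, WithLp.zero_snd]
    rw [h4, h5]
    simp
  smul_mem' := by
    rintro a p ⟨c, hc⟩
    refine ⟨a • c, ?_⟩
    have hm : ∀ᵐ t ∂mu01, t ∈ Icc (0 : ℝ) 1 := ae_restrict_mem measurableSet_Icc
    filter_upwards [hc, hm, Lp.coeFn_smul a p.fst] with t h1 h3 h4
    have h5 := L2.integral_smul a p.snd t h3
    simp only [WithLp.smul_fst, WithLp.smul_snd]
    rw [h4, h5, Pi.smul_apply, h1, smul_add]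

/-- The initial value `u(0)` of (the continuous representative of) `u`. -/
def W12.init {n : ℕ} (u : W12 n) : Vec n := u.2.choose

/-- The weak derivative `u'` of `u`. -/
def W12.der {n : ℕ} (u : W12 n) : L2 n := u.1.snd

/-- The continuous representative of `u` on `[0,1]`. -/
def W12.rep {n : ℕ} (u : W12 n) (t : ℝ) : Vec n := W12.init u + ∫ s in (0 : ℝ)..t, W12.der u s

instance {n : ℕ} : CoeFun (W12 n) (fun _ => ℝ → Vec n) := ⟨W12.rep⟩

lemma W12.continuousOn {n : ℕ} (u : W12 n) : ContinuousOn u (Icc (0 : ℝ) 1) := by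
  have h := intervalIntegral.continuousOn_primitive_interval'
    (L2.intervalIntegrable (W12.der u) (a := 0) (b := 1) (by simp) (by simp)) (a := 0) (by simp)
  rw [uIcc_of_le zero_le_one] at h
  exact continuousOn_const.add h

lemma W12.sub_eq {n : ℕ} (u : W12 n) {s t : ℝ} (hs : s ∈ Icc (0 : ℝ) 1) (ht : t ∈ Icc (0 : ℝ) 1) :
    u t - u s = ∫ r in s..t, W12.der u r := by
  have h0 : (0 : ℝ) ∈ Icc (0 : ℝ) 1 := by simp
  simp only [W12.rep]
  rw [← intervalIntegral.integral_add_adjacent_intervals (L2.intervalIntegrable (W12.der u) h0 hs)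
    (L2.intervalIntegrable (W12.der u) hs ht)]
  abel

lemma W12.exists_of_primitive {n : ℕ} (c : Vec n) (w : L2 n) :
    ∃ u : W12 n, ∀ t ∈ Icc (0 : ℝ) 1, u t = c + ∫ s in (0 : ℝ)..t, w s := by
  have h := intervalIntegral.continuousOn_primitive_interval'
    (L2.intervalIntegrable w (a := 0) (b := 1) (by simp) (by simp)) (a := 0) (by simp)
  rw [uIcc_of_le zero_le_one] at h
  have hc : ContinuousOn (fun t => c + ∫ s in (0 : ℝ)..t, w s) (Icc (0 : ℝ) 1) :=
    continuousOn_const.add h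
  have hm : MemLp (fun t => c + ∫ s in (0 : ℝ)..t, w s) 2 mu01 := by
    obtain ⟨C, hC⟩ := isCompact_Icc.exists_bound_of_continuousOn hc
    refine MemLp.of_bound (hc.aestronglyMeasurable measurableSet_Icc) C ?_
    filter_upwards [ae_restrict_mem (μ := volume) (measurableSet_Icc (a := (0 : ℝ)) (b := 1))] with t ht
    exact hC t ht
  let u : W12 n := ⟨WithLp.toLp 2 (hm.toLp _, w), c, hm.coeFn_toLp⟩
  refine ⟨u, ?_⟩
  have hu := u.2.choose_spec
  have hae : ∀ᵐ t ∂mu01, W12.init u = c := by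
    filter_upwards [hu, hm.coeFn_toLp] with t h1 h2
    have h3 : W12.init u + ∫ s in (0 : ℝ)..t, w s = c + ∫ s in (0 : ℝ)..t, w s :=
      h1.symm.trans h2
    exact add_right_cancel h3
  have hne : (ae mu01).NeBot := by
    rw [ae_neBot]
    intro h0
    have := Measure.restrict_eq_zero.1 h0
    simp at this
  obtain ⟨t, ht⟩ := hae.exists
  intro t _
  change W12.init u + _ = _
  rw [ht]
  rfl

/-- A curve whose increments are bounded by the integral of an `L²` function is of class
`W^{1,2}`. -/
lemma W12.exists_of_dist_le {n : ℕ} (v : ℝ → Vec n) (h : ℝ → ℝ) (hh : MemLp h 2 mu01)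
    (hv : ∀ s ∈ Icc (0 : ℝ) 1, ∀ t ∈ Icc (0 : ℝ) 1, s ≤ t → ‖v t - v s‖ ≤ ∫ r in s..t, h r) :
    ∃ u : W12 n, ∀ t ∈ Icc (0 : ℝ) 1, u t = v t := by
  have hI : IntervalIntegrable h volume 0 1 := by
    rw [intervalIntegrable_iff, uIoc_of_le zero_le_one]
    exact IntegrableOn.mono_set (hh.integrable (by norm_num)) Ioc_subset_Icc_self
  have hIst : ∀ s ∈ Icc (0 : ℝ) 1, ∀ t ∈ Icc (0 : ℝ) 1, IntervalIntegrable h volume s t := by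
    intro s hs t ht
    refine hI.mono_set ?_
    rw [uIcc_of_le zero_le_one]
    exact uIcc_subset_Icc hs ht
  let H : ℝ → ℝ := fun x => ∫ r in (0 : ℝ)..x, h r
  have hHsub : ∀ s ∈ Icc (0 : ℝ) 1, ∀ t ∈ Icc (0 : ℝ) 1, H t - H s = ∫ r in s..t, h r := by
    intro s hs t ht
    exact intervalIntegral.integral_interval_sub_left (hIst 0 (by simp) t ht) (hIst 0 (by simp) s hs)
  have hHac : AbsolutelyContinuousOnInterval H 0 1 :=
    hI.absolutelyContinuousOnInterval_intervalIntegral (by simp)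
  have hvH : ∀ s ∈ Icc (0 : ℝ) 1, ∀ t ∈ Icc (0 : ℝ) 1, ‖v t - v s‖ ≤ |H t - H s| := by
    intro s hs t ht
    rcases le_total s t with hst | hst
    · rw [hHsub s hs t ht]
      exact (hv s hs t ht hst).trans (le_abs_self _)
    · rw [norm_sub_rev, abs_sub_comm, hHsub t ht s hs]
      exact (hv t ht s hs hst).trans (le_abs_self _)
  have hk : ∀ k : Fin n, ∀ s ∈ Icc (0 : ℝ) 1, ∀ t ∈ Icc (0 : ℝ) 1,
      |v t k - v s k| ≤ |H t - H s| := by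
    intro k s hs t ht
    have := PiLp.norm_apply_le (v t - v s) k
    simp only [PiLp.sub_apply, Real.norm_eq_abs] at this
    exact this.trans (hvH s hs t ht)
  have hac : ∀ k : Fin n, AbsolutelyContinuousOnInterval (fun t => v t k) 0 1 := by
    intro k
    rw [absolutelyContinuousOnInterval_iff] at hHac ⊢
    intro ε hε
    obtain ⟨δ, hδ, hd⟩ := hHac ε hε
    refine ⟨δ, hδ, fun P hP hPd => lt_of_le_of_lt (Finset.sum_le_sum ?_) (hd P hP hPd)⟩
    intro i hi
    have h1 := hP.1 i hi
    rw [uIcc_of_le zero_le_one] at h1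
    rw [Real.dist_eq, Real.dist_eq]
    exact hk k _ h1.2 _ h1.1
  have hderiv : ∀ k : Fin n, MemLp (deriv fun t => v t k) 2 mu01 := by
    intro k
    refine hh.mono (measurable_deriv _).aestronglyMeasurable ?_
    rw [ae_restrict_iff' measurableSet_Icc]
    have hne0 : ∀ᵐ x : ℝ, x ≠ 0 := by simp [ae_iff, measure_singleton]
    have hne1 : ∀ᵐ x : ℝ, x ≠ 1 := by simp [ae_iff, measure_singleton]
    filter_upwards [(hac k).ae_differentiableAt, hI.ae_hasDerivAt_integral, hne0, hne1]
      with x h1 h2 h3 h4 hx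
    have hxu : x ∈ uIcc (0 : ℝ) 1 := by rwa [uIcc_of_le zero_le_one]
    have hd1 := (h1 hxu).hasDerivAt.tendsto_slope.norm
    have hd2 := (h2 hxu 0 (by simp)).tendsto_slope.norm
    refine le_of_tendsto_of_tendsto hd1 hd2 ?_
    have hnb : ∀ᶠ y in 𝓝[≠] x, y ∈ Icc (0 : ℝ) 1 :=
      nhdsWithin_le_nhds (Icc_mem_nhds (lt_of_le_of_ne hx.1 h3.symm) (lt_of_le_of_ne hx.2 h4))
    filter_upwards [hnb] with y hy
    simp only [slope, vsub_eq_sub, smul_eq_mul, norm_mul]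
    exact mul_le_mul_of_nonneg_left (hk k x hx y hy) (norm_nonneg _)
  have hg : MemLp (fun t => WithLp.toLp 2 (fun k => deriv (fun t => v t k) t) : ℝ → Vec n)
      2 mu01 := by
    exact MemLp.of_eval_piLp hderiv
  obtain ⟨u, hu⟩ := W12.exists_of_primitive (v 0) (hg.toLp _)
  refine ⟨u, fun t ht => ?_⟩
  rw [hu t ht]
  have h0 : (0 : ℝ) ∈ Icc (0 : ℝ) 1 := by simp
  have e1 : ∫ s in (0 : ℝ)..t, (hg.toLp _ : L2 n) s =
      ∫ s in (0 : ℝ)..t, (WithLp.toLp 2 (fun k => deriv (fun t => v t k) s) : Vec n) := by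
    apply intervalIntegral.integral_congr_ae
    have := (ae_restrict_iff' measurableSet_Icc).1 hg.coeFn_toLp
    filter_upwards [this] with x hx hxt
    rw [uIoc_of_le ht.1] at hxt
    exact hx ⟨hxt.1.le, hxt.2.trans ht.2⟩
  rw [e1]
  have hgi : IntervalIntegrable
      (fun s => (WithLp.toLp 2 (fun k => deriv (fun t => v t k) s) : Vec n)) volume 0 t := by
    rw [intervalIntegrable_iff, uIoc_of_le ht.1]
    exact IntegrableOn.mono_set (hg.integrable (by norm_num))
      (fun x hx => ⟨hx.1.le, hx.2.trans ht.2⟩)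
  ext k
  have e2 := ContinuousLinearMap.intervalIntegral_comp_comm
    (EuclideanSpace.proj k : Vec n →L[ℝ] ℝ) hgi
  have e3 := AbsolutelyContinuousOnInterval.integral_deriv_eq_sub
    ((hac k).mono (c := 0) (d := t) (by
      rw [uIcc_of_le zero_le_one, uIcc_of_le ht.1]; exact Icc_subset_Icc_right ht.2))
  change _ = (∫ s in (0 : ℝ)..t,
    (WithLp.toLp 2 (fun k => deriv (fun t => v t k) s) : Vec n)) k at e2
  rw [PiLp.add_apply, ← e2]
  change _ + (∫ s in (0 : ℝ)..t, deriv (fun t => v t k) s) = _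
  rw [e3]
  ring

/-! ### The Hilbert manifold `W^{1,2}([0,1], M)` -/

section Manifold

variable {n : ℕ} {M : Type*} [TopologicalSpace M] [ChartedSpace (Vec n) M]

/-- A continuous curve is of class `W^{1,2}` if its expression in local coordinates is, near each
time. -/
def IsW12Curve (n : ℕ) {M : Type*} [TopologicalSpace M] [ChartedSpace (Vec n) M]
    (γ : C(unitInterval, M)) : Prop :=
  ∀ t₀ : unitInterval, ∃ u : W12 n, ∀ᶠ t in 𝓝 t₀, extChartAt (𝓡 n) (γ t₀) (γ t) = u t

/-- The set `W^{1,2}([0,1], M)`. -/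
def W12Curve (n : ℕ) (M : Type*) [TopologicalSpace M] [ChartedSpace (Vec n) M] :=
  {γ : C(unitInterval, M) // IsW12Curve n γ}

/-- A curve regarded as a function on `ℝ`, constant outside `[0,1]`. -/
def W12Curve.ext (γ : W12Curve n M) (t : ℝ) : M := γ.1 (projIcc 0 1 zero_le_one t)

/-- A smooth time dependent coordinate system `(t, q) ↦ (t, φ(t, q))` from `[0,1] × U` onto an
open subset of `[0,1] × M`. By the inverse function theorem, the last two fields say that this map
is a diffeomorphism onto an open subset. -/
structure PathChart (n : ℕ) (M : Type*) [TopologicalSpace M] [ChartedSpace (Vec n) M] where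
  U : Set (Vec n)
  isOpen_U : IsOpen U
  φ : ℝ → Vec n → M
  smooth : ContMDiffOn (𝓘(ℝ, ℝ).prod 𝓘(ℝ, Vec n)) (𝓡 n) ∞ (fun p : ℝ × Vec n => φ p.1 p.2)
    (Icc (0 : ℝ) 1 ×ˢ U)
  injOn : ∀ t ∈ Icc (0 : ℝ) 1, InjOn (φ t) U
  bijective_mfderiv : ∀ t ∈ Icc (0 : ℝ) 1, ∀ q ∈ U,
    Function.Bijective (mfderiv 𝓘(ℝ, Vec n) (𝓡 n) (φ t) q)

namespace PathChart

/-- The open subset `W^{1,2}([0,1], U)` of `W^{1,2}([0,1], ℝⁿ)`. -/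
def dom (κ : PathChart n M) : Set (W12 n) := {u | ∀ t ∈ Icc (0 : ℝ) 1, u t ∈ κ.U}

/-- The curve `t ↦ φ(t, u(t))`. -/
def curve (κ : PathChart n M) (u : W12 n) (t : ℝ) : M := κ.φ t (u t)

lemma continuousOn_curve (κ : PathChart n M) {u : W12 n} (hu : u ∈ κ.dom) :
    ContinuousOn (κ.curve u) (Icc (0 : ℝ) 1) := by
  have h1 : ContinuousOn (fun t : ℝ => (t, u t)) (Icc (0 : ℝ) 1) :=
    continuousOn_id.prodMk (W12.continuousOn u)
  exact κ.smooth.continuousOn.comp h1 (fun t ht => ⟨ht, hu t ht⟩)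

/-- The curve `t ↦ φ(t, u(t))` as a continuous map on `[0,1]`. -/
def curveMap (κ : PathChart n M) (u : κ.dom) : C(unitInterval, M) :=
  ⟨fun t => κ.curve u.1 t, continuousOn_iff_continuous_domRestrict.1 (κ.continuousOn_curve u.2)⟩

lemma isW12Curve_curveMap (κ : PathChart n M) (u : κ.dom) :
    IsW12Curve n (κ.curveMap u) := by
  obtain ⟨u, hu⟩ := u
  rintro ⟨t₀, ht₀⟩
  set q₀ : M := κ.curve u t₀ with hq₀
  let f : ℝ × Vec n → Vec n := fun p => extChartAt (𝓡 n) q₀ (κ.φ p.1 p.2)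
  have hf : ContDiffWithinAt ℝ 1 f (Icc (0 : ℝ) 1 ×ˢ κ.U) (t₀, u t₀) := by
    have h1 : ContMDiffWithinAt (𝓘(ℝ, ℝ).prod 𝓘(ℝ, Vec n)) (𝓡 n) 1
        (fun p : ℝ × Vec n => κ.φ p.1 p.2) (Icc (0 : ℝ) 1 ×ˢ κ.U) (t₀, u t₀) :=
      (κ.smooth (t₀, u t₀) ⟨ht₀, hu t₀ ht₀⟩).of_le (by exact_mod_cast le_top)
    have h2 := (contMDiffWithinAt_iff_target.1 h1).2
    rw [← modelWithCornersSelf_prod, chartedSpaceSelf_prod] at h2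
    exact h2.contDiffWithinAt
  obtain ⟨r, hr, hball⟩ := Metric.isOpen_iff.1 κ.isOpen_U (u t₀) (hu t₀ ht₀)
  have hconv : Convex ℝ (Icc (0 : ℝ) 1 ×ˢ Metric.ball (u t₀) r) :=
    (convex_Icc 0 1).prod (convex_ball _ _)
  have hf' : ContDiffWithinAt ℝ 1 f (Icc (0 : ℝ) 1 ×ˢ Metric.ball (u t₀) r) (t₀, u t₀) :=
    hf.mono (prod_mono le_rfl hball)
  obtain ⟨K, s, hs, hK⟩ := hf'.exists_lipschitzOnWith hconv
  have hpair : Tendsto (fun t : ℝ => (t, u t)) (𝓝[Icc 0 1] t₀)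
      (𝓝[Icc (0 : ℝ) 1 ×ˢ Metric.ball (u t₀) r] (t₀, u t₀)) := by
    refine tendsto_nhdsWithin_iff.2 ⟨?_, ?_⟩
    · exact (continuousOn_id.prodMk (W12.continuousOn u)) t₀ ht₀
    · have h3 : ∀ᶠ t in 𝓝[Icc 0 1] t₀, u t ∈ Metric.ball (u t₀) r :=
        (W12.continuousOn u t₀ ht₀) (Metric.ball_mem_nhds _ hr)
      filter_upwards [h3, self_mem_nhdsWithin] with t h4 h5 using ⟨h5, h4⟩
  have hev : ∀ᶠ t in 𝓝[Icc 0 1] t₀, (t, u t) ∈ s := hpair hs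
  rw [eventually_nhdsWithin_iff, Metric.eventually_nhds_iff] at hev
  obtain ⟨δ, hδ, hδs⟩ := hev
  let a : ℝ := max 0 (t₀ - δ / 2)
  let b : ℝ := min 1 (t₀ + δ / 2)
  have hat : a ≤ t₀ := max_le ht₀.1 (by linarith)
  have htb : t₀ ≤ b := le_min ht₀.2 (by linarith)
  have hab : a ≤ b := hat.trans htb
  have hsub : ∀ t ∈ Icc a b, t ∈ Icc (0 : ℝ) 1 ∧ (t, u t) ∈ s := by
    intro t ht
    have h1 : t ∈ Icc (0 : ℝ) 1 :=
      ⟨(le_max_left _ _).trans ht.1, ht.2.trans (min_le_left _ _)⟩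
    refine ⟨h1, hδs ?_ h1⟩
    have h2 : t₀ - δ / 2 ≤ t := (le_max_right _ _).trans ht.1
    have h3 : t ≤ t₀ + δ / 2 := ht.2.trans (min_le_right _ _)
    rw [Real.dist_eq, abs_lt]
    constructor <;> linarith
  let P : ℝ → ℝ := fun t => max a (min b t)
  have hP : ∀ t, P t ∈ Icc a b := fun t => ⟨le_max_left _ _, max_le hab (min_le_left _ _)⟩
  have hPid : ∀ t ∈ Icc a b, P t = t := fun t ht => by
    simp only [P]; rw [min_eq_right ht.2, max_eq_right ht.1]
  let h : ℝ → ℝ := fun t => (K : ℝ) * (1 + ‖W12.der u t‖)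
  have hh : MemLp h 2 mu01 :=
    ((memLp_const (1 : ℝ)).add (Lp.memLp (W12.der u)).norm).const_mul (K : ℝ)
  have hnn : ∀ t, 0 ≤ h t := fun t => by positivity
  have hI : ∀ x ∈ Icc (0 : ℝ) 1, ∀ y ∈ Icc (0 : ℝ) 1, IntervalIntegrable h volume x y := by
    intro x hx y hy
    have h1 : IntegrableOn h (Icc (0 : ℝ) 1) volume := hh.integrable (by norm_num)
    rw [intervalIntegrable_iff]
    refine h1.mono_set ?_
    intro z hz
    rw [uIoc, mem_Ioc] at hz
    exact ⟨(le_min hx.1 hy.1).trans hz.1.le, hz.2.trans (max_le hx.2 hy.2)⟩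
  have hlip : ∀ x ∈ Icc a b, ∀ y ∈ Icc a b, x ≤ y →
      ‖f (y, u y) - f (x, u x)‖ ≤ ∫ r in x..y, h r := by
    intro x hx y hy hxy
    obtain ⟨hx1, hxs⟩ := hsub x hx
    obtain ⟨hy1, hys⟩ := hsub y hy
    have h1 := hK.dist_le_mul _ hys _ hxs
    rw [dist_eq_norm] at h1
    have h2 : dist ((y, u y) : ℝ × Vec n) (x, u x) ≤ (y - x) + ‖u y - u x‖ := by
      rw [Prod.dist_eq]
      refine max_le ?_ ?_
      · rw [Real.dist_eq, abs_of_nonneg (by linarith)]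
        linarith [norm_nonneg (u y - u x)]
      · rw [dist_eq_norm]; linarith
    have h3 : ‖u y - u x‖ ≤ ∫ r in x..y, ‖W12.der u r‖ := by
      rw [W12.sub_eq u hx1 hy1]
      exact intervalIntegral.norm_integral_le_integral_norm hxy
    have h4 : ∫ r in x..y, h r = (K : ℝ) * ((y - x) + ∫ r in x..y, ‖W12.der u r‖) := by
      simp only [h]
      rw [intervalIntegral.integral_const_mul, intervalIntegral.integral_add
        intervalIntegrable_const (L2.intervalIntegrable _ hx1 hy1).norm]
      simp
    rw [h4]
    refine h1.trans (mul_le_mul_of_nonneg_left ?_ K.2)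
    linarith
  obtain ⟨v, hv⟩ := W12.exists_of_dist_le (fun t => f (P t, u (P t))) h hh (by
    intro x hx y hy hxy
    have hPm : P x ≤ P y := max_le_max le_rfl (min_le_min le_rfl hxy)
    refine (hlip _ (hP x) _ (hP y) hPm).trans ?_
    rcases hPm.eq_or_lt with he | hlt
    · rw [he, intervalIntegral.integral_same]
      exact intervalIntegral.integral_nonneg hxy (fun t _ => hnn t)
    · have hx' : x ≤ P x := by
        by_contra hc
        push Not at hc
        have h1 : b ≤ x := by
          by_contra hc2
          push Not at hc2
          have : P x = max a x := by simp only [P]; rw [min_eq_right hc2.le]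
          rw [this] at hc
          exact absurd (le_max_right a x) (not_le.2 hc)
        have h2 : P x = b := by simp only [P]; rw [min_eq_left h1, max_eq_right hab]
        have h3 := (hP y).2
        linarith
      have hy' : P y ≤ y := by
        by_contra hc
        push Not at hc
        have h1 : y ≤ a := by
          by_contra hc2
          push Not at hc2
          have : P y ≤ y := max_le hc2.le (min_le_right _ _)
          linarith
        have h2 : P y = a := by
          simp only [P]; rw [max_eq_left ((min_le_right _ _).trans h1)]
        have h3 := (hP x).1
        linarith
      refine intervalIntegral.integral_mono_interval hx' hlt.le hy' ?_ (hI x hx y hy)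
      exact Eventually.of_forall hnn)
  refine ⟨v, ?_⟩
  have hnb : ∀ᶠ t : unitInterval in 𝓝 ⟨t₀, ht₀⟩, dist (t : ℝ) t₀ < δ / 2 :=
    (isOpen_lt (continuous_subtype_val.dist continuous_const) continuous_const).mem_nhds
      (by simp [hδ])
  filter_upwards [hnb] with t ht
  rw [Real.dist_eq, abs_lt] at ht
  have htab : (t : ℝ) ∈ Icc a b :=
    ⟨max_le t.2.1 (by linarith), le_min t.2.2 (by linarith)⟩
  rw [hv t t.2, hPid t htab]
  rfl

/-- The local parametrization `φ_* : W^{1,2}([0,1], U) → W^{1,2}([0,1], M)`,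
`φ_*(u)(t) = φ(t, u(t))`. -/
def push (κ : PathChart n M) (u : κ.dom) : W12Curve n M :=
  ⟨κ.curveMap u, κ.isW12Curve_curveMap u⟩

/-- The differential of `φ_*` at `u` applied to `η`: the section `t ↦ D_qφ(t, u(t)) η(t)` along
the curve `φ_*(u)`. -/
def pushTangent (κ : PathChart n M) (u η : W12 n) (t : ℝ) : TangentSpace (𝓡 n) (κ.curve u t) :=
  mfderiv 𝓘(ℝ, Vec n) (𝓡 n) (κ.φ t) (u t) (η t)

end PathChart

/-- The topology of the Hilbert manifold `W^{1,2}([0,1], M)`: a set is open if and only if its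
inverse image by each of the local parametrizations `φ_*` of the atlas is open. -/
instance : TopologicalSpace (W12Curve n M) :=
  ⨆ κ : PathChart n M, TopologicalSpace.coinduced κ.push inferInstance

/-! ### Submanifolds of `M × M` and boundary conditions -/

/-- `Q` is a smooth closed submanifold of `M × M`: a closed set which in suitable smooth charts of
`M × M` is a linear slice. -/
def IsClosedSubmanifold [IsManifold (𝓡 n) ∞ M] (Q : Set (M × M)) : Prop :=
  IsClosed Q ∧ ∀ p ∈ Q, ∃ e ∈ IsManifold.maximalAtlas ((𝓡 n).prod (𝓡 n)) ∞ (M × M),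
    p ∈ e.source ∧ ∃ V : Submodule ℝ (Vec n × Vec n),
      ∀ x ∈ e.source, x ∈ Q ↔ ((𝓡 n).prod (𝓡 n)) (e x) ∈ V

/-- `(ξ₀, ξ₁)` is tangent to `Q` at `(q₀, q₁)`: it is the velocity of a smooth curve in `Q`. -/
def IsTangentTo (Q : Set (M × M)) (q₀ q₁ : M) (ξ₀ : TangentSpace (𝓡 n) q₀)
    (ξ₁ : TangentSpace (𝓡 n) q₁) : Prop :=
  ∃ σ : ℝ → M × M, ContMDiff 𝓘(ℝ, ℝ) ((𝓡 n).prod (𝓡 n)) ∞ σ ∧ (∀ s, σ s ∈ Q) ∧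
    σ 0 = (q₀, q₁) ∧
    (mfderiv 𝓘(ℝ, ℝ) ((𝓡 n).prod (𝓡 n)) σ 0 (1 : ℝ) : Vec n × Vec n) = (ξ₀, ξ₁)

/-- `W^{1,2}_Q([0,1], M)`, with the subspace topology. -/
abbrev W12CurveIn (n : ℕ) {M : Type*} [TopologicalSpace M] [ChartedSpace (Vec n) M]
    (Q : Set (M × M)) :=
  {γ : W12Curve n M // (γ.1 0, γ.1 1) ∈ Q}

/-! ### The Riemannian metric of `W^{1,2}([0,1], M)` -/

/-- Smooth Riemannian metrics on `M`. -/
abbrev RMetric (n : ℕ) (M : Type*) [TopologicalSpace M] [ChartedSpace (Vec n) M]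
    [IsManifold (𝓡 n) ∞ M] :=
  ContMDiffRiemannianMetric (𝓡 n) ∞ (Vec n) (fun q : M => TangentSpace (𝓡 n) q)

/-- The tangent vector at the point with coordinates `x`, in the chart at `q₀`, whose coordinates
are `v`. -/
def coordVec (q₀ : M) (x v : Vec n) : TangentSpace (𝓡 n) ((extChartAt (𝓡 n) q₀).symm x) :=
  mfderiv 𝓘(ℝ, Vec n) (𝓡 n) (extChartAt (𝓡 n) q₀).symm x v

variable [IsManifold (𝓡 n) ∞ M]

/-- The matrix `(g_{ij}(x))` of the metric in the chart at `q₀`. -/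
def metricMatrix (g : RMetric n M) (q₀ : M) (x : Vec n) : Matrix (Fin n) (Fin n) ℝ :=
  Matrix.of fun i j => g.inner ((extChartAt (𝓡 n) q₀).symm x)
    (coordVec q₀ x (EuclideanSpace.single i 1)) (coordVec q₀ x (EuclideanSpace.single j 1))

/-- The partial derivative `∂_k g_{ij}(x)`. -/
def metricPartial (g : RMetric n M) (q₀ : M) (x : Vec n) (k i j : Fin n) : ℝ :=
  fderiv ℝ (fun y => metricMatrix g q₀ y i j) x (EuclideanSpace.single k 1)

/-- The Christoffel symbol `Γ^k_{ij}(x)` of the Levi-Civita connection in the chart at `q₀`. -/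
def christoffel (g : RMetric n M) (q₀ : M) (x : Vec n) (k i j : Fin n) : ℝ :=
  (1 / 2 : ℝ) * ∑ l, (metricMatrix g q₀ x)⁻¹ k l *
    (metricPartial g q₀ x i j l + metricPartial g q₀ x j i l - metricPartial g q₀ x l i j)

/-- The velocity `c'(t)`. -/
def velocity (c : ℝ → M) (t : ℝ) : TangentSpace (𝓡 n) (c t) :=
  mfderiv 𝓘(ℝ, ℝ) (𝓡 n) c t (1 : ℝ)

/-- The Levi-Civita covariant derivative `∇_t ξ` of a section `ξ` along the curve `c`. It is
computed in the chart at `c t`, whose coordinates on the tangent space at `c t` are the standard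
identification of this space with `ℝⁿ`:
`(∇_t ξ)^k = (ξ^k)' + ∑_{i,j} Γ^k_{ij}(c) (c^i)' ξ^j`. -/
def covDeriv (g : RMetric n M) (c : ℝ → M) (ξ : ∀ t, TangentSpace (𝓡 n) (c t)) (t : ℝ) :
    TangentSpace (𝓡 n) (c t) :=
  let q₀ := c t
  let coord : ℝ → Vec n := fun s =>
    mfderiv (𝓡 n) 𝓘(ℝ, Vec n) (extChartAt (𝓡 n) q₀) (c s) (ξ s)
  let vel : Vec n := velocity c t
  let res : Vec n := WithLp.toLp 2 fun k => deriv coord t k +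
    ∑ i, ∑ j, christoffel g q₀ (extChartAt (𝓡 n) q₀ q₀) k i j * vel i * coord t j
  res

/-- The norm `(∫₀¹ |∇_t ξ|² + |ξ|² dt)^{1/2}` of a section `ξ` along `c`. -/
def sectionNorm (g : RMetric n M) (c : ℝ → M) (ξ : ∀ t, TangentSpace (𝓡 n) (c t)) : ℝ :=
  Real.sqrt (∫ t in (0 : ℝ)..1,
    (g.inner (c t) (covDeriv g c ξ t) (covDeriv g c ξ t) + g.inner (c t) (ξ t) (ξ t)))

/-! ### Lagrangians and their action -/

/-- Uniform convexity: there is `ℓ₀ > 0` such that `∂_{vv} L(t,q,v)[w,w] ≥ ℓ₀ |w|²`. -/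
def IsUniformlyConvex (g : RMetric n M) (L : ℝ × TangentBundle (𝓡 n) M → ℝ) : Prop :=
  ∃ ℓ₀ > (0 : ℝ), ∀ t ∈ Icc (0 : ℝ) 1, ∀ (q : M) (v w : TangentSpace (𝓡 n) q),
    ℓ₀ * g.inner q w w ≤ iteratedDeriv 2 (fun s : ℝ => L (t, ⟨q, v + s • w⟩)) 0

/-- The expression of `L` in the coordinates `(x, v)` of `TM` induced by the chart at `q₀`. -/
def localLagrangian (L : ℝ × TangentBundle (𝓡 n) M → ℝ) (q₀ : M) (t : ℝ) (x v : Vec n) : ℝ :=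
  L (t, ⟨(extChartAt (𝓡 n) q₀).symm x, coordVec q₀ x v⟩)

/-- The length `|v|_q` of the tangent vector with coordinates `(x, v)`. -/
def coordLength (g : RMetric n M) (q₀ : M) (x v : Vec n) : ℝ :=
  Real.sqrt (g.inner ((extChartAt (𝓡 n) q₀).symm x) (coordVec q₀ x v) (coordVec q₀ x v))

/-- Quadratic bounds on the second derivatives: near each point, in local coordinates,
`‖∂_{vv} L‖ ≤ ℓ₁`, `‖∂_{qv} L‖ ≤ ℓ₁ (1 + |v|_q)` and `‖∂_{qq} L‖ ≤ ℓ₁ (1 + |v|_q²)`. If `M` is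
compact, then finitely many of these coordinate systems cover `M`, and the constant can be taken
to be the same for all of them. -/
def HasQuadraticBounds (g : RMetric n M) (L : ℝ × TangentBundle (𝓡 n) M → ℝ) : Prop :=
  ∀ q₀ : M, ∃ ℓ₁ > (0 : ℝ), ∀ᶠ x in 𝓝 (extChartAt (𝓡 n) q₀ q₀),
    ∀ t ∈ Icc (0 : ℝ) 1, ∀ v : Vec n,
      ‖fderiv ℝ (fun v' => fderiv ℝ (fun w => localLagrangian L q₀ t x w) v') v‖ ≤ ℓ₁ ∧
      ‖fderiv ℝ (fun x' => fderiv ℝ (fun w => localLagrangian L q₀ t x' w) v) x‖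
        ≤ ℓ₁ * (1 + coordLength g q₀ x v) ∧
      ‖fderiv ℝ (fun x' => fderiv ℝ (fun y => localLagrangian L q₀ t y v) x') x‖
        ≤ ℓ₁ * (1 + coordLength g q₀ x v ^ 2)

/-- The integrand `L(t, c(t), c'(t))`. -/
def actionIntegrand (L : ℝ × TangentBundle (𝓡 n) M → ℝ) (c : ℝ → M) (t : ℝ) : ℝ :=
  L (t, ⟨c t, velocity c t⟩)

/-- The action `∫₀¹ L(t, c(t), c'(t)) dt`. -/
def action (L : ℝ × TangentBundle (𝓡 n) M → ℝ) (c : ℝ → M) : ℝ :=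
  ∫ t in (0 : ℝ)..1, actionIntegrand L c t

/-- The action in the local coordinates `φ_*`. -/
def localAction (L : ℝ × TangentBundle (𝓡 n) M → ℝ) (κ : PathChart n M) (u : W12 n) : ℝ :=
  action L (κ.curve u)

/-- The dual norm of the differential at `γ` of the restriction of the action to
`W^{1,2}_Q([0,1], M)`: the supremum of `|d𝔸_L(γ)[ξ]|` over the tangent vectors `ξ` with norm at
most `1`. Writing `γ = φ_*(u)` in local coordinates, the vectors tangent to `W^{1,2}([0,1], M)` at
`γ` are the sections `ξ = Dφ_*(u)[η]`, those tangent to `W^{1,2}_Q([0,1], M)` satisfy moreover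
`(ξ(0), ξ(1)) ∈ T_{(γ(0), γ(1))} Q`, and `d𝔸_L(γ)[ξ] = D(𝔸_L ∘ φ_*)(u)[η]`. By the chain rule
the latter number does not depend on the local coordinates, which therefore may vary freely. -/
def diffActionNorm (g : RMetric n M) (L : ℝ × TangentBundle (𝓡 n) M → ℝ) (Q : Set (M × M))
    (γ : W12Curve n M) : ℝ≥0∞ :=
  ⨆ (κ : PathChart n M) (u : κ.dom) (η : W12 n) (_ : κ.push u = γ)
    (_ : IsTangentTo Q (κ.curve u 0) (κ.curve u 1) (κ.pushTangent u η 0) (κ.pushTangent u η 1))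
    (_ : sectionNorm g (κ.curve u) (κ.pushTangent u η) ≤ 1),
    ENNReal.ofReal |fderiv ℝ (localAction L κ) u η|

end Manifold

/-- The Palais-Smale condition for a functional `f`, where `dnorm x` is the dual norm of the
differential of `f` at `x`. -/
def PalaisSmale {X : Type*} [TopologicalSpace X] (f : X → ℝ) (dnorm : X → ℝ≥0∞) : Prop :=
  ∀ u : ℕ → X, (∃ C : ℝ, ∀ h, |f (u h)| ≤ C) → Tendsto (fun h => dnorm (u h)) atTop (𝓝 0) →
    ∃ (x : X) (k : ℕ → ℕ), StrictMono k ∧ Tendsto (fun h => u (k h)) atTop (𝓝 x)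

end ActionPS

end

open ActionPS

open Set Filter Topology MeasureTheory Bundle
open scoped Manifold ContDiff ENNReal

noncomputable section

namespace ActionPS

/-! In a chart of `M` the bounds on the second derivatives integrate to growth estimates of first
order (`QuadEst`): the Lagrangian grows like `(1 + |v|)²`, and in its differential and in the
increments of that differential a variation of the position is weighted by `1 + |v|` and a variation
of the velocity by `1`. These estimates survive the smooth changes of variables given by a
`PathChart`. Along a curve of class `W^{1,2}` the weight is an `L²` function and positions are
controlled in the sup norm by the Sobolev inequality, so Cauchy-Schwarz gives the action a first
order expansion with quadratic remainder and a locally Lipschitz differential. This is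
`W12.contDiffOn_integral`, and it yields the `C¹` claim.

For the Palais-Smale condition, convexity bounds `|v|²` by an affine function of `L`, so a bound on
the action bounds the energy (`exists_energy_le`). In a Euclidean embedding of `M` the curves are
then equi-Hölder of exponent `1/2`, and the Arzelà-Ascoli theorem extracts a subsequence converging
uniformly to a continuous curve. Every continuous curve lies in the image of one time dependent
coordinate system (`exists_pathChart`): a smooth moving frame `P(t)` makes `(t, x) ↦ (t, P(t) e(x))`
a diffeomorphism near its graph. The tail of the subsequence thus becomes a uniformly convergent
sequence `u_h` of curves in `ℝⁿ` with `u_h'` bounded in `L²`.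

Let `η` be `u_i - u_j` minus the affine function with the same end values. Being zero at the end
points, `η` gives a variation tangent to the boundary condition, and strong monotonicity of the
velocity derivative of `L` gives `‖u_i' - u_j'‖² ≤ C (d𝔸(u_i)[η] - d𝔸(u_j)[η] + C sup |u_i - u_j|)`.
The differentials are small by assumption, once the Riemannian norm of the section defined by `η` is
bounded by a constant times `‖η‖`. That bound is `PathChart.exists_sectionNorm_le`; it rests on the
Koszul formula, which expresses the covariant derivative through the pull-back of the metric to
`[0,1] × U`. So the derivatives are Cauchy in `L²`, the sequence converges in `W^{1,2}`, and the
limit satisfies the boundary condition because `Q` is closed. -/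

/-! ### Integration on `[0,1]` -/

instance : IsProbabilityMeasure mu01 := ⟨by simp⟩

/-- The end points are negligible. All pointwise differential estimates below are made at interior
times, where `[0,1] × U` is a neighbourhood of the point and unrestricted derivatives are
meaningful. -/
lemma ae_mu01_Ioo : ∀ᵐ t ∂mu01, t ∈ Ioo (0 : ℝ) 1 := by
  rw [ae_restrict_iff' measurableSet_Icc]
  have hne0 : ∀ᵐ x : ℝ, x ≠ 0 := by simp [ae_iff, measure_singleton]
  have hne1 : ∀ᵐ x : ℝ, x ≠ 1 := by simp [ae_iff, measure_singleton]
  filter_upwards [hne0, hne1] with x h0 h1 hx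
  exact ⟨lt_of_le_of_ne hx.1 h0.symm, lt_of_le_of_ne hx.2 h1⟩

lemma intervalIntegral_eq_mu01 {E : Type*} [NormedAddCommGroup E] [NormedSpace ℝ E] (f : ℝ → E) :
    ∫ t in (0 : ℝ)..1, f t = ∫ t, f t ∂mu01 := by
  rw [intervalIntegral.integral_of_le zero_le_one, integral_Icc_eq_integral_Ioc]

lemma intervalIntegrable_iff_mu01 {E : Type*} [NormedAddCommGroup E] {f : ℝ → E} :
    IntervalIntegrable f volume 0 1 ↔ Integrable f mu01 := by
  rw [intervalIntegrable_iff_integrableOn_Icc_of_le zero_le_one]; rfl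

/-- The Cauchy-Schwarz inequality on `[0,1]`. -/
lemma integral_mul_le_sqrt {f h : ℝ → ℝ} (hf : MemLp f 2 mu01) (hh : MemLp h 2 mu01)
    (hf0 : 0 ≤ᵐ[mu01] f) (hh0 : 0 ≤ᵐ[mu01] h) :
    ∫ t, f t * h t ∂mu01 ≤ Real.sqrt (∫ t, f t ^ 2 ∂mu01) * Real.sqrt (∫ t, h t ^ 2 ∂mu01) := by
  have := integral_mul_le_Lp_mul_Lq_of_nonneg (μ := mu01) (p := 2) (q := 2)
    (by constructor <;> norm_num) hf0 hh0 (by simpa using hf) (by simpa using hh)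
  simpa [Real.sqrt_eq_rpow] using this

lemma L2.norm_sq_eq {n : ℕ} (w : L2 n) : ‖w‖ ^ 2 = ∫ t, ‖w t‖ ^ 2 ∂mu01 := by
  have h := L2.inner_def (𝕜 := ℝ) w w
  rw [real_inner_self_eq_norm_sq] at h
  rw [h]
  simp

lemma L2.integrable_norm_sq {n : ℕ} (w : L2 n) : Integrable (fun t => ‖w t‖ ^ 2) mu01 :=
  (Lp.memLp w).norm.integrable_sq

lemma L2.integral_norm_le {n : ℕ} (w : L2 n) : ∫ t, ‖w t‖ ∂mu01 ≤ ‖w‖ := by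
  have := integral_mul_le_sqrt (Lp.memLp w).norm (memLp_const (1 : ℝ))
    (Eventually.of_forall fun t => norm_nonneg _) (Eventually.of_forall fun t => zero_le_one)
  simpa [← L2.norm_sq_eq] using this

/-! ### Calculus, Sobolev inequality and completeness in `W^{1,2}` -/

namespace W12

variable {n : ℕ}

lemma fst_ae (u : W12 n) : u.1.fst =ᵐ[mu01] rep u := u.2.choose_spec

/-- Two representations agree at some common time, since `mu01` is not zero; the integral terms
there are the same. This makes the chosen constant `init` computable. -/
lemma init_eq {u : W12 n} {c : Vec n}
    (h : u.1.fst =ᵐ[mu01] fun t => c + ∫ s in (0 : ℝ)..t, u.1.snd s) : init u = c := by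
  obtain ⟨t, ht, ht'⟩ := ((fst_ae u).and h).exists
  rw [ht] at ht'
  exact add_right_cancel ht'

lemma der_add (u v : W12 n) : der (u + v) = der u + der v := rfl

lemma der_sub (u v : W12 n) : der (u - v) = der u - der v := rfl

lemma der_smul (c : ℝ) (v : W12 n) : der (c • v) = c • der v := rfl

lemma rep_add (u v : W12 n) {t : ℝ} (ht : t ∈ Icc (0 : ℝ) 1) : (u + v) t = u t + v t := by
  have h : init (u + v) = init u + init v := by
    apply init_eq
    filter_upwards [fst_ae u, fst_ae v, Lp.coeFn_add u.1.fst v.1.fst,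
      ae_restrict_mem measurableSet_Icc] with t h1 h2 h3 h4
    change (u.1.fst + v.1.fst : L2 n) t = _ + ∫ s in (0 : ℝ)..t, (u.1.snd + v.1.snd : L2 n) s
    rw [h3, L2.integral_add _ _ t h4, Pi.add_apply, h1, h2]
    simp only [rep, der]; abel
  simp only [rep]
  rw [h, der_add, L2.integral_add _ _ t ht]; abel

lemma rep_smul (c : ℝ) (u : W12 n) {t : ℝ} (ht : t ∈ Icc (0 : ℝ) 1) : (c • u) t = c • u t := by
  have h : init (c • u) = c • init u := by
    apply init_eq
    filter_upwards [fst_ae u, Lp.coeFn_smul c u.1.fst,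
      ae_restrict_mem measurableSet_Icc] with t h1 h3 h4
    change (c • u.1.fst : L2 n) t = _ + ∫ s in (0 : ℝ)..t, (c • u.1.snd : L2 n) s
    rw [h3, L2.integral_smul _ _ t h4, Pi.smul_apply, h1]
    simp only [rep, der, smul_add]
  simp only [rep]
  rw [h, der_smul, L2.integral_smul _ _ t ht, smul_add]

lemma rep_sub (u v : W12 n) {t : ℝ} (ht : t ∈ Icc (0 : ℝ) 1) : (u - v) t = u t - v t := by
  have := rep_add (u - v) v ht
  rw [sub_add_cancel] at this
  rw [this]; abel

lemma norm_sq_eq (u : W12 n) : ‖u‖ ^ 2 = ‖u.1.fst‖ ^ 2 + ‖der u‖ ^ 2 :=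
  WithLp.prod_norm_sq_eq_of_L2 u.1

lemma norm_der_le (u : W12 n) : ‖der u‖ ≤ ‖u‖ := by
  have := norm_sq_eq u
  nlinarith [norm_nonneg u, norm_nonneg (der u), sq_nonneg ‖u.1.fst‖]

lemma norm_fst_le (u : W12 n) : ‖u.1.fst‖ ≤ ‖u‖ := by
  have := norm_sq_eq u
  nlinarith [norm_nonneg u, norm_nonneg u.1.fst, sq_nonneg ‖der u‖]

lemma norm_le_of_bound (u : W12 n) {r : ℝ} (hr : 0 ≤ r)
    (h : ∀ t ∈ Icc (0 : ℝ) 1, ‖u t‖ ≤ r) : ‖u‖ ≤ r + ‖der u‖ := by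
  have h1 : ‖u.1.fst‖ ≤ r := by
    rw [← sq_le_sq₀ (norm_nonneg _) hr, L2.norm_sq_eq]
    calc ∫ t, ‖u.1.fst t‖ ^ 2 ∂mu01 ≤ ∫ t, r ^ 2 ∂mu01 := by
          apply integral_mono_ae (L2.integrable_norm_sq _) (integrable_const _)
          filter_upwards [fst_ae u, ae_restrict_mem measurableSet_Icc] with t h1 h2
          simp only [h1]
          exact pow_le_pow_left₀ (norm_nonneg _) (h t h2) 2
      _ = r ^ 2 := by simp
  have := norm_sq_eq u
  nlinarith [norm_nonneg u, norm_nonneg u.1.fst, norm_nonneg (der u)]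

lemma norm_sub_le (u : W12 n) {s t : ℝ} (hs : s ∈ Icc (0 : ℝ) 1) (ht : t ∈ Icc (0 : ℝ) 1) :
    ‖u t - u s‖ ≤ ‖der u‖ := by
  rw [sub_eq u hs ht]
  refine (intervalIntegral.norm_integral_le_integral_norm_uIoc).trans
    (le_trans ?_ (L2.integral_norm_le _))
  refine setIntegral_mono_set ((Lp.memLp (der u)).norm.integrable (by norm_num))
    (Eventually.of_forall fun t => norm_nonneg _) ?_
  refine LE.le.eventuallyLE ?_
  intro x hx
  rw [uIoc, mem_Ioc] at hx
  exact ⟨(le_min hs.1 ht.1).trans hx.1.le, hx.2.trans (max_le hs.2 ht.2)⟩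

/-- The Sobolev inequality `‖u‖_∞ ≤ 2 ‖u‖`. -/
lemma norm_rep_le (u : W12 n) {t : ℝ} (ht : t ∈ Icc (0 : ℝ) 1) : ‖u t‖ ≤ 2 * ‖u‖ := by
  -- The inequality `‖u(t)‖ ≤ ‖u(s)‖ + ‖u'‖` is averaged over `s`; each of the two averages is at
  -- most `‖u‖`, whence the factor `2`.
  have h : ∫ _, ‖u t‖ ∂mu01 ≤ ∫ s, (‖u.1.fst s‖ + ‖der u‖) ∂mu01 := by
    apply integral_mono_ae (integrable_const _)
      (((Lp.memLp u.1.fst).norm.integrable (by norm_num)).add (integrable_const _))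
    filter_upwards [fst_ae u, ae_restrict_mem measurableSet_Icc] with s h1 h2
    change ‖rep u t‖ ≤ ‖u.1.fst s‖ + ‖der u‖
    rw [h1]
    have := norm_sub_le u h2 ht
    have h3 := norm_sub_norm_le (u t) (u s)
    linarith
  rw [integral_add ((Lp.memLp u.1.fst).norm.integrable (by norm_num)) (integrable_const _)] at h
  simp only [integral_const, probReal_univ, one_smul] at h
  linarith [L2.integral_norm_le u.1.fst, norm_fst_le u, norm_der_le u]

lemma ae_hasDerivAt (u : W12 n) : ∀ᵐ t ∂mu01, HasDerivAt u (der u t) t := by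
  have hI := L2.intervalIntegrable (der u) (a := 0) (b := 1) (by simp) (by simp)
  have := hI.ae_hasDerivAt_integral
  rw [ae_restrict_iff' measurableSet_Icc]
  filter_upwards [this] with t ht h
  have := ht (by rwa [uIcc_of_le zero_le_one]) 0 (by simp)
  exact this.const_add (init u)

/-- The image of a curve is compact, so a whole thickening of it lies in `U`; the Sobolev inequality
turns `W^{1,2}`-closeness into uniform closeness. -/
lemma isOpen_setOf_mapsTo {U : Set (Vec n)} (hU : IsOpen U) :
    IsOpen {u : W12 n | ∀ t ∈ Icc (0 : ℝ) 1, u t ∈ U} := by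
  rw [Metric.isOpen_iff]
  intro u hu
  have hK : IsCompact (rep u '' Icc 0 1) := isCompact_Icc.image_of_continuousOn (continuousOn u)
  obtain ⟨δ, hδ, hsub⟩ := hK.exists_thickening_subset_open hU (by
    rintro _ ⟨t, ht, rfl⟩; exact hu t ht)
  refine ⟨δ / 2, by positivity, fun v hv t ht => hsub ?_⟩
  rw [Metric.mem_thickening_iff]
  refine ⟨u t, ⟨t, ht, rfl⟩, ?_⟩
  rw [dist_eq_norm, ← rep_sub _ _ ht]
  have := norm_rep_le (v - u) ht
  rw [Metric.mem_ball, dist_eq_norm] at hv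
  linarith

/-- A function on `[0,1]` which locally is of class `W^{1,2}` is of class `W^{1,2}`. -/
lemma exists_of_locally (v : ℝ → Vec n)
    (h : ∀ t₀ ∈ Icc (0 : ℝ) 1, ∃ u : W12 n, ∀ᶠ t in 𝓝[Icc 0 1] t₀, v t = u t) :
    ∃ u : W12 n, ∀ t ∈ Icc (0 : ℝ) 1, u t = v t := by
  choose! u hu using h
  have hmem : ∀ t₀ ∈ Icc (0 : ℝ) 1, ∃ a b, t₀ ∈ Ioo a b ∧
      ∀ t ∈ Icc (0 : ℝ) 1 ∩ Ioo a b, v t = u t₀ t := by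
    intro t₀ ht₀
    have := hu t₀ ht₀
    rw [eventually_nhdsWithin_iff, Metric.eventually_nhds_iff] at this
    obtain ⟨ε, hε, h⟩ := this
    refine ⟨t₀ - ε, t₀ + ε, ⟨by linarith, by linarith⟩, fun t ht => h ?_ ht.1⟩
    rw [Real.dist_eq, abs_lt]
    constructor <;> linarith [ht.2.1, ht.2.2]
  choose! a b hab hv using hmem
  obtain ⟨T, hT, hcov⟩ := isCompact_Icc.elim_nhds_subcover (X := ℝ) (s := Icc 0 1)
    (fun t₀ => Ioo (a t₀) (b t₀)) (fun t₀ ht₀ => Ioo_mem_nhds (hab t₀ ht₀).1 (hab t₀ ht₀).2)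
  -- A single integrand dominating the derivatives of all the local representatives of a finite
  -- cover, so that increments can be added across overlapping pieces.
  let h : ℝ → ℝ := fun t => ∑ i ∈ T, ‖der (u i) t‖
  have hh : MemLp h 2 mu01 := memLp_finsetSum _ fun i _ => (Lp.memLp (der (u i))).norm
  have hI : ∀ x ∈ Icc (0 : ℝ) 1, ∀ y ∈ Icc (0 : ℝ) 1, IntervalIntegrable h volume x y := by
    intro x hx y hy
    exact (intervalIntegrable_iff_mu01.2 (hh.integrable (by norm_num))).mono_set (by
      rw [uIcc_of_le zero_le_one]; exact uIcc_subset_Icc hx hy)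
  have hloc : ∀ t₀ ∈ Icc (0 : ℝ) 1, ∃ i ∈ T, t₀ ∈ Ioo (a i) (b i) := by
    intro t₀ ht₀
    obtain ⟨i, hi, h⟩ := mem_iUnion₂.1 (hcov ht₀)
    exact ⟨i, hi, h⟩
  have hstep : ∀ i ∈ T, ∀ s ∈ Icc (0 : ℝ) 1 ∩ Ioo (a i) (b i),
      ∀ t ∈ Icc (0 : ℝ) 1 ∩ Ioo (a i) (b i), s ≤ t → ‖v t - v s‖ ≤ ∫ r in s..t, h r := by
    intro i hi s hs t ht hst
    rw [hv i (hT i hi) s hs, hv i (hT i hi) t ht, sub_eq (u i) hs.1 ht.1]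
    refine (intervalIntegral.norm_integral_le_integral_norm hst).trans ?_
    refine intervalIntegral.integral_mono_on hst (L2.intervalIntegrable _ hs.1 ht.1).norm
      (hI s hs.1 t ht.1) fun r _ => ?_
    exact Finset.single_le_sum (f := fun i => ‖der (u i) r‖) (fun j _ => norm_nonneg _) hi
  have hvc : ContinuousOn v (Icc 0 1) := fun t₀ ht₀ =>
    (W12.continuousOn (u t₀) t₀ ht₀).congr_of_eventuallyEq (hu t₀ ht₀)
      ((hu t₀ ht₀).self_of_nhdsWithin ht₀)
  refine exists_of_dist_le v h hh fun s hs t ht hst => ?_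
  have hHc : ContinuousOn (fun t => ∫ r in s..t, h r) (Icc s 1) := by
    have := intervalIntegral.continuousOn_primitive_interval'
      (hI s hs 1 (by simp)) (a := s) (by simp)
    rwa [uIcc_of_le hs.2] at this
  have hsub : Icc s t ⊆ Icc (0 : ℝ) 1 := Icc_subset_Icc hs.1 ht.2
  have hcl : IsClosed ({x | ‖v x - v s‖ ≤ ∫ r in s..x, h r} ∩ Icc s t) := by
    rw [inter_comm]
    exact isClosed_Icc.isClosed_le (f := fun x => ‖v x - v s‖) (g := fun x => ∫ r in s..x, h r)
      ((hvc.mono hsub).sub continuousOn_const).norm (hHc.mono (Icc_subset_Icc_right ht.2))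
  -- Continuous induction: the set of `x` for which the increment bound from `s` holds is closed,
  -- and a local step always pushes it further to the right.
  refine hcl.Icc_subset_of_forall_exists_gt (by simp) ?_ (right_mem_Icc.2 hst)
  rintro x ⟨hx, hxs⟩ y hy
  have hx01 : x ∈ Icc (0 : ℝ) 1 := hsub (Ico_subset_Icc_self hxs)
  obtain ⟨i, hi, hxi⟩ := hloc x hx01
  obtain ⟨z, hz1, hz2⟩ := exists_between (lt_min (lt_min hxs.2 hy) hxi.2)
  have hzt : z < t := hz2.trans_le ((min_le_left _ _).trans (min_le_left _ _))
  have hzy : z < y := hz2.trans_le ((min_le_left _ _).trans (min_le_right _ _))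
  have hzb : z < b i := hz2.trans_le (min_le_right _ _)
  have hz01 : z ∈ Icc (0 : ℝ) 1 := hsub ⟨hxs.1.trans hz1.le, hzt.le⟩
  refine ⟨z, ?_, hz1, hzy.le⟩
  have h1 := hstep i hi x ⟨hx01, hxi⟩ z ⟨hz01, hxi.1.trans hz1, hzb⟩ hz1.le
  have h2 := norm_add_le (v z - v x) (v x - v s)
  rw [sub_add_sub_cancel] at h2
  change ‖v z - v s‖ ≤ ∫ r in s..z, h r
  rw [← intervalIntegral.integral_add_adjacent_intervals (hI s hs x hx01) (hI x hx01 z hz01)]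
  change ‖v x - v s‖ ≤ _ at hx
  linarith

/-- Both functions are almost everywhere the classical derivative of `v`, by Lebesgue
differentiation, and derivatives are unique. -/
lemma der_eq {v : W12 n} {c : Vec n} {w : L2 n}
    (h : ∀ t ∈ Icc (0 : ℝ) 1, v t = c + ∫ s in (0 : ℝ)..t, w s) : der v = w := by
  apply Lp.ext
  have hI := (L2.intervalIntegrable w (a := 0) (b := 1) (by simp) (by simp)).ae_hasDerivAt_integral
  filter_upwards [ae_hasDerivAt v, (ae_restrict_of_ae hI : ∀ᵐ t ∂mu01, _), ae_mu01_Ioo]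
    with t h1 h2 h3
  have h4 := (h2 (by rw [uIcc_of_le zero_le_one]; exact Ioo_subset_Icc_self h3) 0
    (by simp)).const_add c
  refine h1.unique (h4.congr_of_eventuallyEq ?_)
  filter_upwards [Ioo_mem_nhds h3.1 h3.2] with s hs using h s (Ioo_subset_Icc_self hs)

/-- The space `W^{1,2}` is complete. -/
lemma exists_tendsto (u : ℕ → W12 n) (h1 : CauchySeq fun i => u i 0)
    (h2 : CauchySeq fun i => der (u i)) : ∃ v : W12 n, Tendsto u atTop (𝓝 v) := by
  obtain ⟨c, hc⟩ := cauchySeq_tendsto_of_complete h1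
  obtain ⟨w, hw⟩ := cauchySeq_tendsto_of_complete h2
  obtain ⟨v, hv⟩ := exists_of_primitive c w
  have hvd := der_eq hv
  have hv0 : v 0 = c := by simpa using hv 0 (by simp)
  refine ⟨v, ?_⟩
  rw [tendsto_iff_norm_sub_tendsto_zero] at hc hw ⊢
  have h3 := hc.add (hw.const_mul 2)
  simp only [mul_zero, add_zero] at h3
  refine squeeze_zero (fun i => norm_nonneg _) (fun i => ?_) h3
  -- The sup norm of `u_i - v` is at most its size at time `0` plus the `L²` norm of its derivative.
  have h4 : ‖u i - v‖ ≤ (‖u i 0 - c‖ + ‖der (u i) - w‖) + ‖der (u i - v)‖ := by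
    refine norm_le_of_bound _ (by positivity) fun t ht => ?_
    have h5 := norm_sub_le (u i - v) (s := 0) (by simp) ht
    have h6 := norm_sub_norm_le ((u i - v) t) ((u i - v) 0)
    rw [rep_sub (u i) v (t := 0) (by simp), hv0] at h5 h6
    rw [der_sub, hvd] at h5
    linarith
  rw [der_sub, hvd] at h4
  linarith

/-- The affine function with given values at `0` and `1`. -/
lemma exists_affine (a b : Vec n) :
    ∃ u : W12 n, (∀ t ∈ Icc (0 : ℝ) 1, u t = a + t • (b - a)) ∧ der u =ᵐ[mu01] fun _ => b - a := by
  obtain ⟨u, hu⟩ := exists_of_primitive a ((memLp_const (μ := mu01) (p := 2) (b - a)).toLp _)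
  refine ⟨u, fun t ht => ?_, ?_⟩
  · rw [hu t ht]
    congr 1
    have : ∫ s in (0 : ℝ)..t, ((memLp_const (μ := mu01) (p := 2) (b - a)).toLp _ : L2 n) s =
        ∫ s in (0 : ℝ)..t, b - a := by
      apply intervalIntegral.integral_congr_ae
      have := (ae_restrict_iff' measurableSet_Icc).1
        (memLp_const (μ := mu01) (p := 2) (b - a)).coeFn_toLp
      filter_upwards [this] with x hx hxt
      rw [uIoc_of_le ht.1] at hxt
      exact hx ⟨hxt.1.le, hxt.2.trans ht.2⟩
    rw [this]
    simp [smul_sub]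
  · rw [der_eq hu]
    exact MemLp.coeFn_toLp _

end W12

/-! ### Quadratic growth estimates -/

variable {n : ℕ}

/-- Quadratic growth estimates for a Lagrangian `(q, v) ↦ ℓ(q, v)` with `q ∈ S`. -/
structure QuadEst (C : ℝ) (S : Set (Vec n)) (ℓ : Vec n × Vec n → ℝ) : Prop where
  diff : ∀ q ∈ S, ∀ v, DifferentiableAt ℝ ℓ (q, v)
  bound : ∀ q ∈ S, ∀ v, |ℓ (q, v)| ≤ C * (1 + ‖v‖) ^ 2
  bound_fderiv : ∀ q ∈ S, ∀ v a b, |fderiv ℝ ℓ (q, v) (a, b)| ≤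
    C * (1 + ‖v‖) * ((1 + ‖v‖) * ‖a‖ + ‖b‖)
  lip_fderiv : ∀ q ∈ S, ∀ q' ∈ S, ∀ v v' a b,
    |(fderiv ℝ ℓ (q', v') - fderiv ℝ ℓ (q, v)) (a, b)| ≤
      C * ((1 + ‖v‖ + ‖v'‖) * ‖q' - q‖ + ‖v' - v‖) * ((1 + ‖v‖ + ‖v'‖) * ‖a‖ + ‖b‖)

lemma QuadEst.mono {C C' : ℝ} {S S' : Set (Vec n)} {ℓ : Vec n × Vec n → ℝ}
    (h : QuadEst C S ℓ) (hC : C ≤ C') (hS : S' ⊆ S) : QuadEst C' S' ℓ where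
  diff q hq v := h.diff q (hS hq) v
  bound q hq v := (h.bound q (hS hq) v).trans (by gcongr)
  bound_fderiv q hq v a b := (h.bound_fderiv q (hS hq) v a b).trans (by gcongr)
  lip_fderiv q hq q' hq' v v' a b :=
    (h.lip_fderiv q (hS hq) q' (hS hq') v v' a b).trans (by gcongr)

/-- By the mean value theorem the increment is the differential at an intermediate point of the
segment applied to `(a, b)`; `lip_fderiv` compares it with the differential at the starting point.
The weight `1 + 2‖v‖ + ‖b‖` bounds `1 + ‖v‖ + ‖v + s b‖`. -/
lemma QuadEst.taylor {C : ℝ} {S : Set (Vec n)} {ℓ : Vec n × Vec n → ℝ} (hC : 0 ≤ C)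
    (h : QuadEst C S ℓ) (hS : Convex ℝ S) {q a : Vec n} (v b : Vec n) (hq : q ∈ S)
    (hqa : q + a ∈ S) :
    |ℓ (q + a, v + b) - ℓ (q, v) - fderiv ℝ ℓ (q, v) (a, b)| ≤
      C * ((1 + 2 * ‖v‖ + ‖b‖) * ‖a‖ + ‖b‖) ^ 2 := by
  have hmem : ∀ s ∈ Icc (0 : ℝ) 1, q + s • a ∈ S := by
    intro s hs
    exact hS.add_smul_mem hq hqa hs
  have hd : ∀ s ∈ Icc (0 : ℝ) 1, HasDerivAt (fun s : ℝ => ℓ (q + s • a, v + s • b))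
      (fderiv ℝ ℓ (q + s • a, v + s • b) (a, b)) s := by
    intro s hs
    have h1 := (h.diff _ (hmem s hs) (v + s • b)).hasFDerivAt
    have h2 : HasDerivAt (fun s : ℝ => (q + s • a, v + s • b)) (a, b) s := by
      have := ((hasDerivAt_id s).smul_const a).const_add q
      have h3 := ((hasDerivAt_id s).smul_const b).const_add v
      simpa using this.prodMk h3
    exact h1.comp_hasDerivAt s h2
  obtain ⟨s, hs, hs'⟩ := exists_hasDerivAt_eq_slope (fun s : ℝ => ℓ (q + s • a, v + s • b))
    (fun s => fderiv ℝ ℓ (q + s • a, v + s • b) (a, b)) one_pos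
    (fun s hs => (hd s hs).continuousAt.continuousWithinAt)
    (fun s hs => hd s (Ioo_subset_Icc_self hs))
  simp only [one_smul, zero_smul, add_zero, sub_zero, div_one] at hs'
  rw [← hs', ← sub_apply]
  refine (h.lip_fderiv _ hq _ (hmem s (Ioo_subset_Icc_self hs)) v (v + s • b) a b).trans ?_
  have h1 : ‖v + s • b‖ ≤ ‖v‖ + ‖b‖ := by
    refine (norm_add_le _ _).trans ?_
    rw [norm_smul, Real.norm_eq_abs, abs_of_pos hs.1]
    nlinarith [norm_nonneg b, hs.2]
  have h2 : ‖q + s • a - q‖ ≤ ‖a‖ := by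
    rw [add_sub_cancel_left, norm_smul, Real.norm_eq_abs, abs_of_pos hs.1]
    nlinarith [norm_nonneg a, hs.2]
  have h3 : ‖v + s • b - v‖ ≤ ‖b‖ := by
    rw [add_sub_cancel_left, norm_smul, Real.norm_eq_abs, abs_of_pos hs.1]
    nlinarith [norm_nonneg b, hs.2]
  have h4 : 1 + ‖v‖ + ‖v + s • b‖ ≤ 1 + 2 * ‖v‖ + ‖b‖ := by linarith
  rw [sq, ← mul_assoc]
  gcongr

/-- `ℓ` satisfies the quadratic growth estimates locally in `[0,1] × U`. -/
def LocallyQuadEst (U : Set (Vec n)) (ℓ : ℝ → Vec n × Vec n → ℝ) : Prop :=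
  ∀ t₀ ∈ Icc (0 : ℝ) 1, ∀ q₀ ∈ U, ∃ C, ∃ r > 0, ∀ t ∈ Ioo (0 : ℝ) 1, |t - t₀| < r →
    QuadEst C (Metric.ball q₀ r) (ℓ t)

/-- A local property on `[0,1] × U` which is monotone in a constant and in the domain holds with
uniform constants along a continuous curve. -/
lemma exists_uniform_along {U : Set (Vec n)} (P : ℝ → ℝ → Set (Vec n) → Prop)
    (hmono : ∀ t C C' S S', C ≤ C' → S' ⊆ S → P t C S → P t C' S')
    (hloc : ∀ t₀ ∈ Icc (0 : ℝ) 1, ∀ q₀ ∈ U, ∃ C, ∃ r > 0, ∀ t ∈ Ioo (0 : ℝ) 1, |t - t₀| < r →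
      P t C (Metric.ball q₀ r)) {c : ℝ → Vec n} (hc : ContinuousOn c (Icc 0 1))
    (hcU : ∀ t ∈ Icc (0 : ℝ) 1, c t ∈ U) :
    ∃ C > 0, ∃ δ > 0, ∀ t ∈ Ioo (0 : ℝ) 1, P t C (Metric.ball (c t) δ) := by
  have : ∃ C > 0, ∃ δ > 0, ∀ t ∈ Icc (0 : ℝ) 1, t ∈ Ioo (0 : ℝ) 1 → P t C (Metric.ball (c t) δ) := by
    refine isCompact_Icc.induction_on (p := fun s => ∃ C > 0, ∃ δ > 0, ∀ t ∈ s, t ∈ Ioo (0 : ℝ) 1 →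
      P t C (Metric.ball (c t) δ)) ⟨1, one_pos, 1, one_pos, by simp⟩ ?_ ?_ ?_
    · rintro s s' hss ⟨C, hC, δ, hδ, h⟩
      exact ⟨C, hC, δ, hδ, fun t ht => h t (hss ht)⟩
    · rintro s s' ⟨C, hC, δ, hδ, h⟩ ⟨C', hC', δ', hδ', h'⟩
      refine ⟨max C C', by positivity, min δ δ', by positivity, fun t ht htI => ?_⟩
      rcases ht with ht | ht
      · exact hmono _ _ _ _ _ (le_max_left _ _) (Metric.ball_subset_ball (min_le_left _ _))
          (h t ht htI)
      · exact hmono _ _ _ _ _ (le_max_right _ _) (Metric.ball_subset_ball (min_le_right _ _))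
          (h' t ht htI)
    · intro t₀ ht₀
      obtain ⟨C, r, hr, h⟩ := hloc t₀ ht₀ (c t₀) (hcU t₀ ht₀)
      have h1 : ∀ᶠ t in 𝓝[Icc 0 1] t₀, c t ∈ Metric.ball (c t₀) (r / 2) :=
        hc t₀ ht₀ (Metric.ball_mem_nhds _ (by positivity))
      have h2 : ∀ᶠ t in 𝓝[Icc 0 1] t₀, |t - t₀| < r :=
        nhdsWithin_le_nhds (Metric.ball_mem_nhds t₀ hr)
      refine ⟨_, h1.and h2, max C 1, by positivity, r / 2, by positivity, fun t ht htI => ?_⟩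
      refine hmono _ _ _ _ _ (le_max_left _ _) ?_ (h t htI ht.2)
      refine Metric.ball_subset_ball' ?_
      have := Metric.mem_ball.1 ht.1
      linarith
  obtain ⟨C, hC, δ, hδ, h⟩ := this
  exact ⟨C, hC, δ, hδ, fun t ht => h t (Ioo_subset_Icc_self ht) ht⟩

lemma LocallyQuadEst.exists_uniform {U : Set (Vec n)} {ℓ : ℝ → Vec n × Vec n → ℝ}
    (h : LocallyQuadEst U ℓ) {c : ℝ → Vec n} (hc : ContinuousOn c (Icc 0 1))
    (hcU : ∀ t ∈ Icc (0 : ℝ) 1, c t ∈ U) :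
    ∃ C > 0, ∃ δ > 0, ∀ t ∈ Ioo (0 : ℝ) 1, QuadEst C (Metric.ball (c t) δ) (ℓ t) :=
  exists_uniform_along (fun t C S => QuadEst C S (ℓ t))
    (fun _ _ _ _ _ hC hS h => h.mono hC hS) h hc hcU

/-- A function with a first order expansion whose remainder is quadratic, and whose differential
is locally Lipschitz, is of class `C¹`. -/
lemma contDiffOn_one_of_quadratic {E : Type*} [NormedAddCommGroup E] [NormedSpace ℝ E]
    {f : E → ℝ} {A : E → E →L[ℝ] ℝ} {D : Set E} (hD : IsOpen D)
    (h1 : ∀ u ∈ D, ∃ C, ∃ ε > 0, ∀ η, ‖η‖ < ε → u + η ∈ D →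
      |f (u + η) - f u - A u η| ≤ C * ‖η‖ ^ 2)
    (h2 : ∀ u ∈ D, ∃ C, 0 ≤ C ∧ ∃ ε > 0, ∀ w ∈ D, ‖w - u‖ < ε → ∀ η,
      |A w η - A u η| ≤ C * ‖w - u‖ * ‖η‖) :
    ContDiffOn ℝ 1 f D ∧ ∀ u ∈ D, HasFDerivAt f (A u) u := by
  have hd : ∀ u ∈ D, HasFDerivAt f (A u) u := by
    intro u hu
    obtain ⟨C, ε, hε, hC⟩ := h1 u hu
    have e1 : ∀ᶠ η in 𝓝 (0 : E), u + η ∈ D := by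
      have : Tendsto (fun η => u + η) (𝓝 0) (𝓝 (u + 0)) :=
        (continuous_const.add continuous_id).tendsto _
      rw [add_zero] at this
      exact this (hD.mem_nhds hu)
    rw [hasFDerivAt_iff_isLittleO_nhds_zero]
    have hO : (fun η => f (u + η) - f u - A u η) =O[𝓝 0] fun η => ‖η‖ ^ 2 := by
      refine Asymptotics.IsBigO.of_bound C ?_
      filter_upwards [e1, Metric.ball_mem_nhds 0 hε] with η h3 h4
      rw [Real.norm_eq_abs, norm_pow, norm_norm]
      exact hC η (mem_ball_zero_iff.1 h4) h3
    refine hO.trans_isLittleO ?_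
    have := (Asymptotics.isLittleO_pow_id (𝕜 := ℝ) (n := 2) (by norm_num)).comp_tendsto
      (tendsto_norm_zero (E := E))
    exact Asymptotics.IsLittleO.of_norm_right this
  refine ⟨?_, hd⟩
  rw [show (1 : WithTop ℕ∞) = 0 + 1 from rfl, contDiffOn_succ_iff_fderiv_of_isOpen hD]
  refine ⟨fun u hu => (hd u hu).differentiableAt.differentiableWithinAt, by simp, ?_⟩
  rw [contDiffOn_zero]
  refine ContinuousOn.congr (f := A) ?_ fun u hu => (hd u hu).fderiv
  intro u hu
  apply ContinuousAt.continuousWithinAt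
  obtain ⟨C, hC0, ε, hε, hC⟩ := h2 u hu
  rw [ContinuousAt, tendsto_iff_norm_sub_tendsto_zero]
  have hb : ∀ᶠ w in 𝓝 u, ‖A w - A u‖ ≤ C * ‖w - u‖ := by
    filter_upwards [hD.mem_nhds hu, Metric.ball_mem_nhds u hε] with w hw hw'
    exact ContinuousLinearMap.opNorm_le_bound _ (by positivity) fun η =>
      hC w hw (mem_ball_iff_norm.1 hw') η
  refine squeeze_zero' (Eventually.of_forall fun _ => norm_nonneg _) hb ?_
  have : Tendsto (fun w => C * ‖w - u‖) (𝓝 u) (𝓝 (C * ‖u - u‖)) :=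
    (continuous_const.mul (continuous_id.sub continuous_const).norm).tendsto u
  simpa using this

/-! ### The functional `∫ ℓ(t, u, u') dt` is of class `C¹` -/

namespace W12

/-- The weighted pointwise norm `ρ |η| + |η'|`. -/
def wnorm (ρ : ℝ → ℝ) (η : W12 n) (t : ℝ) : ℝ := ρ t * ‖η t‖ + ‖der η t‖

lemma aestronglyMeasurable (u : W12 n) : AEStronglyMeasurable (rep u) mu01 :=
  (W12.continuousOn u).aestronglyMeasurable measurableSet_Icc

lemma memLp_wnorm {ρ : ℝ → ℝ} (hρ : MemLp ρ 2 mu01) (η : W12 n) : MemLp (wnorm ρ η) 2 mu01 := by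
  refine MemLp.add ?_ (Lp.memLp (der η)).norm
  refine (hρ.const_mul (2 * ‖η‖)).mono (hρ.1.mul (aestronglyMeasurable η).norm) ?_
  filter_upwards [ae_restrict_mem measurableSet_Icc] with t ht
  have := norm_rep_le η ht
  rw [norm_mul, norm_mul, norm_norm, mul_comm,
    Real.norm_of_nonneg (by positivity : (0 : ℝ) ≤ 2 * ‖η‖)]
  gcongr

/-- From `(x + y)² ≤ 2x² + 2y²` and the Sobolev bound `|η| ≤ 2‖η‖`: the constant `8` is `2 · 2²`. -/
lemma integral_wnorm_sq_le {ρ : ℝ → ℝ} (hρ : MemLp ρ 2 mu01) (η : W12 n) :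
    ∫ t, wnorm ρ η t ^ 2 ∂mu01 ≤ (8 * ∫ t, ρ t ^ 2 ∂mu01 + 2) * ‖η‖ ^ 2 := by
  have h1 : ∫ t, wnorm ρ η t ^ 2 ∂mu01 ≤
      ∫ t, (8 * ‖η‖ ^ 2 * ρ t ^ 2 + 2 * ‖der η t‖ ^ 2) ∂mu01 := by
    apply integral_mono_ae (memLp_wnorm hρ η).integrable_sq
      ((hρ.integrable_sq.const_mul _).add ((L2.integrable_norm_sq _).const_mul _))
    filter_upwards [ae_restrict_mem measurableSet_Icc] with t ht
    have h2 : ‖η t‖ ^ 2 ≤ 4 * ‖η‖ ^ 2 := by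
      have := pow_le_pow_left₀ (norm_nonneg _) (norm_rep_le η ht) 2
      linarith
    have h3 := mul_le_mul_of_nonneg_left h2 (sq_nonneg (ρ t))
    change (ρ t * ‖η t‖ + ‖der η t‖) ^ 2 ≤ 8 * ‖η‖ ^ 2 * ρ t ^ 2 + 2 * ‖der η t‖ ^ 2
    nlinarith [sq_nonneg (ρ t * ‖η t‖ - ‖der η t‖)]
  rw [integral_add (hρ.integrable_sq.const_mul _) ((L2.integrable_norm_sq _).const_mul _),
    integral_const_mul, integral_const_mul, ← L2.norm_sq_eq] at h1
  have := pow_le_pow_left₀ (norm_nonneg _) (norm_der_le η) 2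
  nlinarith

lemma wnorm_nonneg {ρ : ℝ → ℝ} (hρ : ∀ t, 0 ≤ ρ t) (η : W12 n) (t : ℝ) : 0 ≤ wnorm ρ η t := by
  have := hρ t
  simp only [wnorm]
  positivity

lemma integral_mul_wnorm_le {ρ f : ℝ → ℝ} (hρ : MemLp ρ 2 mu01) (hρ0 : ∀ t, 0 ≤ ρ t)
    (hf : MemLp f 2 mu01) (hf0 : ∀ t, 0 ≤ f t) (η : W12 n) :
    ∫ t, f t * wnorm ρ η t ∂mu01 ≤
      Real.sqrt (∫ t, f t ^ 2 ∂mu01) * Real.sqrt (8 * ∫ t, ρ t ^ 2 ∂mu01 + 2) * ‖η‖ := by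
  refine (integral_mul_le_sqrt hf (memLp_wnorm hρ η) (Eventually.of_forall hf0)
    (Eventually.of_forall (wnorm_nonneg hρ0 η))).trans ?_
  rw [mul_assoc]
  refine mul_le_mul_of_nonneg_left ?_ (Real.sqrt_nonneg _)
  have h := Real.sqrt_le_sqrt (integral_wnorm_sq_le hρ η)
  rwa [Real.sqrt_mul' _ (by positivity), Real.sqrt_sq (norm_nonneg η)] at h


/-- Continuity is available only on the open set `Ω`; extension by zero gives a Borel function on
the whole space with almost everywhere the same composition. -/
lemma aestronglyMeasurable_comp {X : Type*} [TopologicalSpace X] [MeasurableSpace X]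
    [BorelSpace X] {G : X → ℝ} {Ω : Set X} (hΩ : IsOpen Ω) (hG : ContinuousOn G Ω) {f : ℝ → X}
    (hf : AEMeasurable f mu01) (hfΩ : ∀ᵐ t ∂mu01, f t ∈ Ω) :
    AEStronglyMeasurable (fun t => G (f t)) mu01 := by
  classical
  have h : Measurable (Ω.piecewise G 0) :=
    hG.measurable_piecewise continuousOn_const hΩ.measurableSet
  refine (h.comp_aemeasurable hf).aestronglyMeasurable.congr ?_
  filter_upwards [hfΩ] with t ht
  exact piecewise_eq_of_mem _ _ _ ht

lemma aemeasurable_jet (u : W12 n) : AEMeasurable (fun t => (u t, der u t)) mu01 :=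
  (aestronglyMeasurable u).aemeasurable.prodMk (Lp.aestronglyMeasurable (der u)).aemeasurable

/-- The weight `1 + |u'| + |w'|`. -/
def weight (u w : W12 n) (t : ℝ) : ℝ := 1 + ‖der u t‖ + ‖der w t‖

lemma weight_nonneg (u w : W12 n) (t : ℝ) : 0 ≤ weight u w t := by
  simp only [weight]; positivity

lemma memLp_weight (u w : W12 n) : MemLp (weight u w) 2 mu01 :=
  MemLp.add (f := fun t => 1 + ‖der u t‖) (g := fun t => ‖der w t‖)
    (MemLp.add (f := fun _ => (1 : ℝ)) (g := fun t => ‖der u t‖) (memLp_const 1)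
      (Lp.memLp (der u)).norm) (Lp.memLp (der w)).norm

lemma integral_weight_sq_le (u w : W12 n) :
    ∫ t, weight u w t ^ 2 ∂mu01 ≤ 3 * (1 + ‖der u‖ ^ 2 + ‖der w‖ ^ 2) := by
  have i1 : Integrable (fun t => 1 + ‖der u t‖ ^ 2) mu01 :=
    (integrable_const _).add (L2.integrable_norm_sq _)
  have i2 : Integrable (fun t => 1 + ‖der u t‖ ^ 2 + ‖der w t‖ ^ 2) mu01 :=
    i1.add (L2.integrable_norm_sq _)
  have h1 : ∫ t, weight u w t ^ 2 ∂mu01 ≤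
      ∫ t, (3 * (1 + ‖der u t‖ ^ 2 + ‖der w t‖ ^ 2)) ∂mu01 := by
    refine integral_mono (memLp_weight u w).integrable_sq (i2.const_mul 3) fun t => ?_
    simp only [weight]
    nlinarith [sq_nonneg (1 - ‖der u t‖), sq_nonneg (1 - ‖der w t‖),
      sq_nonneg (‖der u t‖ - ‖der w t‖)]
  rwa [integral_const_mul, integral_add i1 (L2.integrable_norm_sq _),
    integral_add (integrable_const _) (L2.integrable_norm_sq _),
    ← L2.norm_sq_eq, ← L2.norm_sq_eq, integral_const, probReal_univ, one_smul] at h1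

section Functional

variable {U : Set (Vec n)} {ℓ : ℝ → Vec n × Vec n → ℝ}

lemma integrable_lagrangian (hU : IsOpen U) (hℓ : LocallyQuadEst U ℓ)
    (hc : ContinuousOn (fun p : ℝ × (Vec n × Vec n) => ℓ p.1 p.2) (Ioo 0 1 ×ˢ (U ×ˢ univ)))
    {u : W12 n} (hu : ∀ t ∈ Icc (0 : ℝ) 1, u t ∈ U) :
    Integrable (fun t => ℓ t (u t, der u t)) mu01 := by
  obtain ⟨C, hC, δ, hδ, h⟩ := hℓ.exists_uniform (W12.continuousOn u) hu
  refine Integrable.mono' (g := fun t => C * weight u 0 t ^ 2)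
    ((memLp_weight u 0).integrable_sq.const_mul C) ?_ ?_
  · refine aestronglyMeasurable_comp (isOpen_Ioo.prod (hU.prod isOpen_univ)) hc
      (aemeasurable_id.prodMk (aemeasurable_jet u)) ?_
    filter_upwards [ae_mu01_Ioo] with t ht
    exact ⟨ht, hu t (Ioo_subset_Icc_self ht), mem_univ _⟩
  · filter_upwards [ae_mu01_Ioo] with t ht
    refine ((h t ht).bound _ (Metric.mem_ball_self hδ) _).trans ?_
    have : 1 + ‖der u t‖ ≤ weight u 0 t := by simp [weight]
    gcongr

lemma integrable_fderiv (hU : IsOpen U) (hℓ : LocallyQuadEst U ℓ)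
    (hc : ContinuousOn (fun p : ℝ × (Vec n × Vec n) => fderiv ℝ (ℓ p.1) p.2)
      (Ioo 0 1 ×ˢ (U ×ˢ univ)))
    {u : W12 n} (hu : ∀ t ∈ Icc (0 : ℝ) 1, u t ∈ U) (η : W12 n) :
    Integrable (fun t => fderiv ℝ (ℓ t) (u t, der u t) (η t, der η t)) mu01 := by
  obtain ⟨C, hC, δ, hδ, h⟩ := hℓ.exists_uniform (W12.continuousOn u) hu
  refine Integrable.mono' (g := fun t => C * (weight u 0 t * wnorm (weight u 0) η t))
    (((memLp_weight u 0).integrable_mul (memLp_wnorm (memLp_weight u 0) η)).const_mul C) ?_ ?_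
  · refine aestronglyMeasurable_comp (X := (ℝ × (Vec n × Vec n)) × (Vec n × Vec n))
      (G := fun p => fderiv ℝ (ℓ p.1.1) p.1.2 p.2)
      (Ω := (Ioo (0 : ℝ) 1 ×ˢ (U ×ˢ univ)) ×ˢ univ) ((isOpen_Ioo.prod (hU.prod isOpen_univ)).prod isOpen_univ) ?_
      ((aemeasurable_id.prodMk (aemeasurable_jet u)).prodMk (aemeasurable_jet η)) ?_
    · exact (hc.comp continuousOn_fst (fun p hp => hp.1)).clm_apply continuousOn_snd
    · filter_upwards [ae_mu01_Ioo] with t ht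
      exact ⟨⟨ht, hu t (Ioo_subset_Icc_self ht), mem_univ _⟩, mem_univ _⟩
  · filter_upwards [ae_mu01_Ioo] with t ht
    refine ((h t ht).bound_fderiv _ (Metric.mem_ball_self hδ) _ _ _).trans ?_
    have : 1 + ‖der u t‖ ≤ weight u 0 t := by simp [weight]
    have h0 := weight_nonneg u 0 t
    rw [mul_assoc]
    simp only [wnorm]
    gcongr

/-- The integrand is dominated by `C` times the product of two `L²` functions, the weight `1 + |u'|`
and the weighted norm of `η`; Cauchy-Schwarz bounds the formal differential. -/
lemma exists_fderiv (hU : IsOpen U) (hℓ : LocallyQuadEst U ℓ)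
    (hc : ContinuousOn (fun p : ℝ × (Vec n × Vec n) => fderiv ℝ (ℓ p.1) p.2)
      (Ioo 0 1 ×ˢ (U ×ˢ univ)))
    {u : W12 n} (hu : ∀ t ∈ Icc (0 : ℝ) 1, u t ∈ U) :
    ∃ A : W12 n →L[ℝ] ℝ, ∀ η, A η =
      ∫ t, fderiv ℝ (ℓ t) (u t, der u t) (η t, der η t) ∂mu01 := by
  obtain ⟨C, hC, δ, hδ, h⟩ := hℓ.exists_uniform (W12.continuousOn u) hu
  have hint := integrable_fderiv hU hℓ hc hu
  let A : W12 n →ₗ[ℝ] ℝ :=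
    { toFun := fun η => ∫ t, fderiv ℝ (ℓ t) (u t, der u t) (η t, der η t) ∂mu01
      map_add' := fun η ξ => by
        rw [← integral_add (hint η) (hint ξ)]
        apply integral_congr_ae
        filter_upwards [ae_restrict_mem measurableSet_Icc, Lp.coeFn_add (der η) (der ξ)]
          with t ht h1
        rw [rep_add _ _ ht, der_add, h1, Pi.add_apply, ← map_add, Prod.mk_add_mk]
      map_smul' := fun c η => by
        rw [RingHom.id_apply, smul_eq_mul, ← integral_const_mul]
        apply integral_congr_ae
        filter_upwards [ae_restrict_mem measurableSet_Icc, Lp.coeFn_smul c (der η)] with t ht h1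
        rw [rep_smul _ _ ht, der_smul, h1, Pi.smul_apply, ← smul_eq_mul, ← map_smul,
          Prod.smul_mk] }
  refine ⟨A.mkContinuous (C * (Real.sqrt (∫ t, weight u 0 t ^ 2 ∂mu01) *
    Real.sqrt (8 * ∫ t, weight u 0 t ^ 2 ∂mu01 + 2))) fun η => ?_, fun η => rfl⟩
  calc ‖A η‖ ≤ ∫ t, ‖fderiv ℝ (ℓ t) (u t, der u t) (η t, der η t)‖ ∂mu01 :=
        norm_integral_le_integral_norm _
    _ ≤ ∫ t, C * (weight u 0 t * wnorm (weight u 0) η t) ∂mu01 := by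
        apply integral_mono_ae (hint η).norm
          (((memLp_weight u 0).integrable_mul (memLp_wnorm (memLp_weight u 0) η)).const_mul C)
        filter_upwards [ae_mu01_Ioo] with t ht
        refine ((h t ht).bound_fderiv _ (Metric.mem_ball_self hδ) _ _ _).trans ?_
        have : 1 + ‖der u t‖ ≤ weight u 0 t := by simp [weight]
        have h0 := weight_nonneg u 0 t
        rw [mul_assoc]
        simp only [wnorm, Pi.mul_apply]
        gcongr
    _ ≤ _ := by
        rw [integral_const_mul, mul_assoc]
        refine mul_le_mul_of_nonneg_left ?_ hC.le
        exact integral_mul_wnorm_le (memLp_weight u 0) (weight_nonneg u 0) (memLp_weight u 0)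
          (weight_nonneg u 0) η

/-- The pointwise Taylor estimate is integrated. Its weight `1 + 2|u'| + |η'|` is `weight (2 • u)
η`, which explains the `4‖u'‖²`; `‖η‖ < 1` bounds the contribution of `η'`, and `‖η‖ < δ / 2` keeps
`u + η` in the tube of radius `δ` by the Sobolev inequality. -/
lemma integral_remainder_le (hU : IsOpen U) (hℓ : LocallyQuadEst U ℓ)
    (hc : ContinuousOn (fun p : ℝ × (Vec n × Vec n) => ℓ p.1 p.2) (Ioo 0 1 ×ˢ (U ×ˢ univ)))
    (hc' : ContinuousOn (fun p : ℝ × (Vec n × Vec n) => fderiv ℝ (ℓ p.1) p.2)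
      (Ioo 0 1 ×ˢ (U ×ˢ univ)))
    {u η : W12 n} (hu : ∀ t ∈ Icc (0 : ℝ) 1, u t ∈ U)
    (h1 : ∀ t ∈ Icc (0 : ℝ) 1, (u + η) t ∈ U) {C δ : ℝ} (hC : 0 < C) (hδ : 0 < δ)
    (h : ∀ t ∈ Ioo (0 : ℝ) 1, QuadEst C (Metric.ball (u t) δ) (ℓ t))
    (h2 : ‖η‖ < 1) (h3 : ‖η‖ < δ / 2) :
    |(∫ t, ℓ t ((u + η) t, der (u + η) t) ∂mu01) - (∫ t, ℓ t (u t, der u t) ∂mu01) -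
      ∫ t, fderiv ℝ (ℓ t) (u t, der u t) (η t, der η t) ∂mu01| ≤
      C * (8 * (3 * (1 + 4 * ‖der u‖ ^ 2 + 1)) + 2) * ‖η‖ ^ 2 := by
  have i1 := integrable_lagrangian hU hℓ hc h1
  have i2 := integrable_lagrangian hU hℓ hc hu
  have i3 := integrable_fderiv hU hℓ hc' hu η
  have i4 : Integrable (fun t => ℓ t ((u + η) t, der (u + η) t) - ℓ t (u t, der u t)) mu01 :=
    i1.sub i2
  rw [← integral_sub i1 i2, ← integral_sub i4 i3]
  have hw := memLp_wnorm (memLp_weight ((2 : ℝ) • u) η) η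
  refine abs_integral_le_integral_abs.trans ?_
  refine (integral_mono_ae (E := ℝ) (i4.sub i3).abs
    (hw.integrable_sq.const_mul C) ?_).trans ?_
  · filter_upwards [ae_mu01_Ioo, Lp.coeFn_add (der u) (der η),
      Lp.coeFn_smul (2 : ℝ) (der u)] with t ht h4 h5
    have hta := rep_add u η (Ioo_subset_Icc_self ht)
    have hη : ‖η t‖ < δ := (norm_rep_le η (Ioo_subset_Icc_self ht)).trans_lt (by linarith)
    have := (h t ht).taylor hC.le (convex_ball _ _) (a := η t) (der u t) (der η t)
      (Metric.mem_ball_self hδ) (by simpa using hη)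
    rw [Pi.sub_apply, hta, der_add, h4, Pi.add_apply]
    refine this.trans_eq ?_
    simp only [wnorm, weight, der_smul, h5, Pi.smul_apply, norm_smul, Real.norm_ofNat]
  · rw [integral_const_mul, mul_assoc]
    refine mul_le_mul_of_nonneg_left ?_ hC.le
    refine (integral_wnorm_sq_le (memLp_weight _ _) η).trans ?_
    have h6 := integral_weight_sq_le ((2 : ℝ) • u) η
    rw [der_smul, norm_smul, Real.norm_ofNat] at h6
    have h7 : ‖der η‖ ^ 2 ≤ 1 :=
      pow_le_one₀ (norm_nonneg _) ((norm_der_le η).trans h2.le)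
    refine mul_le_mul_of_nonneg_right ?_ (sq_nonneg _)
    linarith

/-- The Lipschitz estimate bounds the integrand by the product of the weighted norms of `w - u` and
of `η`, for the common weight `1 + |u'| + |w'|`; Cauchy-Schwarz concludes. -/
lemma integral_fderiv_sub_le (hU : IsOpen U) (hℓ : LocallyQuadEst U ℓ)
    (hc' : ContinuousOn (fun p : ℝ × (Vec n × Vec n) => fderiv ℝ (ℓ p.1) p.2)
      (Ioo 0 1 ×ˢ (U ×ˢ univ)))
    {u w : W12 n} (hu : ∀ t ∈ Icc (0 : ℝ) 1, u t ∈ U)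
    (h1 : ∀ t ∈ Icc (0 : ℝ) 1, w t ∈ U) {C δ : ℝ} (hC : 0 < C) (hδ : 0 < δ)
    (h : ∀ t ∈ Ioo (0 : ℝ) 1, QuadEst C (Metric.ball (u t) δ) (ℓ t))
    (h2 : ‖w - u‖ < 1) (h3 : ‖w - u‖ < δ / 2) (η : W12 n) :
    |(∫ t, fderiv ℝ (ℓ t) (w t, der w t) (η t, der η t) ∂mu01) -
      ∫ t, fderiv ℝ (ℓ t) (u t, der u t) (η t, der η t) ∂mu01| ≤
      C * (8 * (3 * (1 + ‖der u‖ ^ 2 + (‖u‖ + 1) ^ 2)) + 2) * ‖w - u‖ * ‖η‖ := by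
  have i1 := integrable_fderiv hU hℓ hc' h1 η
  have i2 := integrable_fderiv hU hℓ hc' hu η
  rw [← integral_sub i1 i2]
  have hρ := memLp_weight u w
  have hw1 := memLp_wnorm hρ (w - u)
  have hw2 := memLp_wnorm hρ η
  have i3 : Integrable (fun t => C * (wnorm (weight u w) (w - u) t * wnorm (weight u w) η t))
      mu01 := (hw1.integrable_mul hw2).const_mul C
  refine abs_integral_le_integral_abs.trans ?_
  refine (integral_mono_ae (E := ℝ) (i1.sub i2).abs i3 ?_).trans ?_
  · filter_upwards [ae_mu01_Ioo, Lp.coeFn_sub (der w) (der u)] with t ht h4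
    have hts := rep_sub w u (Ioo_subset_Icc_self ht)
    have hη : ‖w t - u t‖ < δ := by
      rw [← hts]
      exact (norm_rep_le _ (Ioo_subset_Icc_self ht)).trans_lt (by linarith)
    have := (h t ht).lip_fderiv (u t) (Metric.mem_ball_self hδ) (w t)
      (by rwa [mem_ball_iff_norm]) (der u t) (der w t) (η t) (der η t)
    rw [sub_apply] at this
    refine this.trans_eq ?_
    simp only [wnorm, weight, der_sub, h4, hts, Pi.sub_apply]
    ring
  · rw [integral_const_mul, mul_assoc C, mul_assoc C]
    refine mul_le_mul_of_nonneg_left ?_ hC.le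
    refine (integral_mul_wnorm_le hρ (weight_nonneg _ _) hw1
      (wnorm_nonneg (weight_nonneg _ _) _) η).trans ?_
    refine mul_le_mul_of_nonneg_right ?_ (norm_nonneg _)
    have h6 := Real.sqrt_le_sqrt (integral_wnorm_sq_le hρ (w - u))
    rw [Real.sqrt_mul' _ (by positivity), Real.sqrt_sq (norm_nonneg _)] at h6
    have h7 := integral_weight_sq_le u w
    have h8 : ‖der w‖ ≤ ‖u‖ + 1 := by
      have := norm_der_le w
      have := norm_sub_norm_le w u
      linarith
    have h9 : ‖der w‖ ^ 2 ≤ (‖u‖ + 1) ^ 2 := pow_le_pow_left₀ (norm_nonneg _) h8 2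
    have h10 : (0 : ℝ) ≤ 8 * ∫ t, weight u w t ^ 2 ∂mu01 + 2 := by positivity
    -- Each of the two factors contributes the same square root, so their product is rational in the
    -- energies.
    have h11 := mul_le_mul_of_nonneg_right h6
      (Real.sqrt_nonneg (8 * ∫ t, weight u w t ^ 2 ∂mu01 + 2))
    rw [mul_right_comm, Real.mul_self_sqrt h10] at h11
    refine h11.trans (mul_le_mul_of_nonneg_right ?_ (norm_nonneg _))
    linarith

/-- The functional `u ↦ ∫₀¹ ℓ(t, u, u') dt` is of class `C¹`, and its differential is given by
differentiation under the integral sign. -/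
theorem contDiffOn_integral (hU : IsOpen U) (hℓ : LocallyQuadEst U ℓ)
    (hc : ContinuousOn (fun p : ℝ × (Vec n × Vec n) => ℓ p.1 p.2) (Ioo 0 1 ×ˢ (U ×ˢ univ)))
    (hc' : ContinuousOn (fun p : ℝ × (Vec n × Vec n) => fderiv ℝ (ℓ p.1) p.2)
      (Ioo 0 1 ×ˢ (U ×ˢ univ))) :
    ContDiffOn ℝ 1 (fun u : W12 n => ∫ t, ℓ t (u t, der u t) ∂mu01)
      {u | ∀ t ∈ Icc (0 : ℝ) 1, u t ∈ U} ∧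
    ∀ u : W12 n, (∀ t ∈ Icc (0 : ℝ) 1, u t ∈ U) → ∀ η,
      fderiv ℝ (fun u : W12 n => ∫ t, ℓ t (u t, der u t) ∂mu01) u η =
        ∫ t, fderiv ℝ (ℓ t) (u t, der u t) (η t, der η t) ∂mu01 := by
  have hex := fun (u : W12 n) (hu : ∀ t ∈ Icc (0 : ℝ) 1, u t ∈ U) => exists_fderiv hU hℓ hc' hu
  choose! A hA using hex
  have hop := isOpen_setOf_mapsTo hU
  obtain ⟨h1, h2⟩ := contDiffOn_one_of_quadratic
    (f := fun u : W12 n => ∫ t, ℓ t (u t, der u t) ∂mu01) (A := A) hop (by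
      intro u hu
      obtain ⟨C, hC, δ, hδ, h⟩ := hℓ.exists_uniform (W12.continuousOn u) hu
      refine ⟨C * (8 * (3 * (1 + 4 * ‖der u‖ ^ 2 + 1)) + 2), min 1 (δ / 2), by positivity,
        fun η h2 h1 => ?_⟩
      rw [hA u hu]
      exact integral_remainder_le hU hℓ hc hc' hu h1 hC hδ h (h2.trans_le (min_le_left _ _))
        (h2.trans_le (min_le_right _ _))) (by
      intro u hu
      obtain ⟨C, hC, δ, hδ, h⟩ := hℓ.exists_uniform (W12.continuousOn u) hu
      refine ⟨C * (8 * (3 * (1 + ‖der u‖ ^ 2 + (‖u‖ + 1) ^ 2)) + 2), by positivity,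
        min 1 (δ / 2), by positivity, fun w h1 h2 η => ?_⟩
      rw [hA u hu, hA w h1]
      exact integral_fderiv_sub_le hU hℓ hc' hu h1 hC hδ h (h2.trans_le (min_le_left _ _))
        (h2.trans_le (min_le_right _ _)) η)
  exact ⟨h1, fun u hu η => by rw [(h2 u hu).fderiv, hA u hu]⟩

end Functional

end W12

/-! ### The tangent bundle and the Lagrangian in a chart -/

section Charts

variable {n : ℕ} {M : Type*} [TopologicalSpace M] [ChartedSpace (Vec n) M]

/-- All the tangent spaces are by definition `ℝⁿ`. Vectors over base points that are only
propositionally equal are therefore compared as elements of `Vec n`, here and in `inner_congr`. -/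
lemma totalSpace_mk_eq {x y : M} (h : x = y) {v : TangentSpace (𝓡 n) x}
    {w : TangentSpace (𝓡 n) y} (hvw : (v : Vec n) = (w : Vec n)) :
    (⟨x, v⟩ : TangentBundle (𝓡 n) M) = ⟨y, w⟩ := by
  subst h
  exact congrArg _ hvw

lemma mem_extChartAt_target_nhds (q₀ : M) {x : Vec n} (hx : x ∈ (extChartAt (𝓡 n) q₀).target) :
    (extChartAt (𝓡 n) q₀).target ∈ 𝓝 x :=
  (isOpen_extChartAt_target q₀).mem_nhds hx

variable [IsManifold (𝓡 n) ∞ M]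

lemma mdifferentiableAt_extChartAt_symm (q₀ : M) {x : Vec n}
    (hx : x ∈ (extChartAt (𝓡 n) q₀).target) :
    MDifferentiableAt 𝓘(ℝ, Vec n) (𝓡 n) (extChartAt (𝓡 n) q₀).symm x :=
  (((contMDiffOn_extChartAt_symm (n := ∞) q₀) x hx).contMDiffAt
    (mem_extChartAt_target_nhds q₀ hx)).mdifferentiableAt (by simp)

/-- The velocity of a map into `M`, in local coordinates. -/
lemma mk_mfderiv_eq_coordVec {E : Type*} [NormedAddCommGroup E] [NormedSpace ℝ E] {c : E → M}
    {p : E} (hc : MDifferentiableAt 𝓘(ℝ, E) (𝓡 n) c p) (q₀ : M)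
    (hp : c p ∈ (extChartAt (𝓡 n) q₀).source) (X : E) :
    (⟨c p, mfderiv 𝓘(ℝ, E) (𝓡 n) c p X⟩ : TangentBundle (𝓡 n) M) =
      ⟨(extChartAt (𝓡 n) q₀).symm (extChartAt (𝓡 n) q₀ (c p)),
        coordVec q₀ (extChartAt (𝓡 n) q₀ (c p))
          (fderiv ℝ (fun p => extChartAt (𝓡 n) q₀ (c p)) p X)⟩ := by
  refine totalSpace_mk_eq ((extChartAt (𝓡 n) q₀).left_inv hp).symm ?_
  have hsrc : (extChartAt (𝓡 n) q₀).source ∈ 𝓝 (c p) :=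
    (isOpen_extChartAt_source q₀).mem_nhds hp
  have hev : c =ᶠ[𝓝 p] (extChartAt (𝓡 n) q₀).symm ∘ fun p => extChartAt (𝓡 n) q₀ (c p) := by
    filter_upwards [hc.continuousAt hsrc] with y hy
    exact ((extChartAt (𝓡 n) q₀).left_inv hy).symm
  have h1 : MDifferentiableAt 𝓘(ℝ, E) 𝓘(ℝ, Vec n) (fun p => extChartAt (𝓡 n) q₀ (c p)) p :=
    MDifferentiableAt.comp p ((contMDiffAt_extChartAt' (n := ∞)
      (by rwa [extChartAt_source] at hp)).mdifferentiableAt (by simp)) hc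
  have h2 := mdifferentiableAt_extChartAt_symm q₀ ((extChartAt (𝓡 n) q₀).map_source hp)
  rw [hev.mfderiv_eq, mfderiv_comp p h2 h1, mfderiv_eq_fderiv]
  rfl

/-- The map is the tangent map of the inverse chart, after the identification of the tangent bundle
of the model space with a product. -/
lemma contMDiffOn_coordVec (q₀ : M) :
    ContMDiffOn 𝓘(ℝ, Vec n × Vec n) (𝓡 n).tangent ∞
      (fun p : Vec n × Vec n => (⟨(extChartAt (𝓡 n) q₀).symm p.1, coordVec q₀ p.1 p.2⟩ :
        TangentBundle (𝓡 n) M)) ((extChartAt (𝓡 n) q₀).target ×ˢ univ) := by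
  have h1 := (contMDiffOn_extChartAt_symm (n := ∞) (I := 𝓡 n) q₀).contMDiffOn_tangentMapWithin
    (m := ∞) (by simp) (isOpen_extChartAt_target q₀).uniqueMDiffOn
  have h2 : ContMDiff 𝓘(ℝ, Vec n × Vec n) (𝓘(ℝ, Vec n)).tangent ∞
      (fun p : Vec n × Vec n => (⟨p.1, p.2⟩ : TangentBundle 𝓘(ℝ, Vec n) (Vec n))) := by
    have := contMDiff_tangentBundleModelSpaceHomeomorph_symm (n := ∞) (I := 𝓘(ℝ, Vec n))
    convert! this using 1
    simp [ModelWithCorners.tangent, modelWithCornersSelf_prod]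
  refine (h1.comp h2.contMDiffOn (fun p hp => hp.1)).congr fun p hp => ?_
  simp only [Function.comp, tangentMapWithin]
  refine totalSpace_mk_eq rfl ?_
  rw [mfderivWithin_of_isOpen (isOpen_extChartAt_target q₀) hp.1]
  rfl

lemma two_le_infty : (2 : WithTop ℕ∞) ≤ (∞ : WithTop ℕ∞) :=
  WithTop.coe_le_coe.2 (le_top : (2 : ℕ∞) ≤ ⊤)

lemma contDiffOn_localLagrangian {L : ℝ × TangentBundle (𝓡 n) M → ℝ}
    (hL : ContMDiffOn (𝓘(ℝ, ℝ).prod (𝓡 n).tangent) 𝓘(ℝ, ℝ) 2 L (Icc (0 : ℝ) 1 ×ˢ univ)) (q₀ : M) :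
    ContDiffOn ℝ 2 (fun p : ℝ × (Vec n × Vec n) => localLagrangian L q₀ p.1 p.2.1 p.2.2)
      (Icc (0 : ℝ) 1 ×ˢ ((extChartAt (𝓡 n) q₀).target ×ˢ univ)) := by
  have h1 : ContMDiffOn 𝓘(ℝ, ℝ × (Vec n × Vec n)) (𝓘(ℝ, ℝ).prod (𝓡 n).tangent) 2
      (fun p : ℝ × (Vec n × Vec n) => (p.1, (⟨(extChartAt (𝓡 n) q₀).symm p.2.1,
        coordVec q₀ p.2.1 p.2.2⟩ : TangentBundle (𝓡 n) M)))
      (Icc (0 : ℝ) 1 ×ˢ ((extChartAt (𝓡 n) q₀).target ×ˢ univ)) := by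
    refine ContMDiffOn.prodMk (contMDiff_iff_contDiff.2 contDiff_fst).contMDiffOn ?_
    exact ((contMDiffOn_coordVec q₀).of_le two_le_infty).comp
      (contMDiff_iff_contDiff.2 contDiff_snd).contMDiffOn (fun p hp => hp.2)
  exact (hL.comp h1 fun p hp => ⟨hp.1, mem_univ _⟩).contDiffOn

end Charts

/-- A shortcut for the search of the norm on bilinear maps. -/
abbrev normedAddCommGroupBilin (E F : Type*) [NormedAddCommGroup E] [NormedSpace ℝ E]
    [NormedAddCommGroup F] [NormedSpace ℝ F] : NormedAddCommGroup (E →L[ℝ] E →L[ℝ] F) :=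
  ContinuousLinearMap.toNormedAddCommGroup

attribute [local instance] normedAddCommGroupBilin

/-! ### The Riemannian metric in a chart -/

section Charts

variable {n : ℕ} {M : Type*} [TopologicalSpace M] [ChartedSpace (Vec n) M]
  [IsManifold (𝓡 n) ∞ M]

/-- The Riemannian metric in the coordinates of the chart at `q₀`. -/
def chartMetric (g : RMetric n M) (q₀ : M) (x : Vec n) : Vec n →L[ℝ] Vec n →L[ℝ] ℝ :=
  let B : Vec n →L[ℝ] Vec n →L[ℝ] ℝ := g.inner ((extChartAt (𝓡 n) q₀).symm x)
  let A : Vec n →L[ℝ] Vec n := mfderiv 𝓘(ℝ, Vec n) (𝓡 n) (extChartAt (𝓡 n) q₀).symm x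
  B.bilinearComp A A

lemma chartMetric_apply (g : RMetric n M) (q₀ : M) (x v w : Vec n) :
    chartMetric g q₀ x v w =
      g.inner ((extChartAt (𝓡 n) q₀).symm x) (coordVec q₀ x v) (coordVec q₀ x w) := rfl

lemma chartMetric_symm (g : RMetric n M) (q₀ : M) (x v w : Vec n) :
    chartMetric g q₀ x v w = chartMetric g q₀ x w v := by
  rw [chartMetric_apply, chartMetric_apply]
  exact g.symm _ _ _

/-- In finite dimension smoothness of a bilinear form is tested on fixed vectors; there it is the
smooth section `g.inner` evaluated on two smooth coordinate fields. -/
lemma contDiffOn_chartMetric (g : RMetric n M) (q₀ : M) :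
    ContDiffOn ℝ ∞ (chartMetric g q₀) (extChartAt (𝓡 n) q₀).target := by
  rw [contDiffOn_clm_apply]
  intro v
  rw [contDiffOn_clm_apply]
  intro w
  have hs : ∀ v : Vec n, ContMDiffOn 𝓘(ℝ, Vec n) (𝓡 n).tangent ∞
      (fun x : Vec n => (⟨(extChartAt (𝓡 n) q₀).symm x, coordVec q₀ x v⟩ :
        TangentBundle (𝓡 n) M)) (extChartAt (𝓡 n) q₀).target := by
    intro v
    refine (contMDiffOn_coordVec q₀).comp (t := (extChartAt (𝓡 n) q₀).target ×ˢ univ)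
      (f := fun x : Vec n => (x, v)) ?_ fun x hx => ⟨hx, mem_univ _⟩
    exact (contMDiff_iff_contDiff.2 (contDiff_id.prodMk contDiff_const)).contMDiffOn
  have := ContMDiffOn.clm_bundle_apply₂ (F₁ := Vec n) (F₂ := Vec n) (F₃ := ℝ) (n := ∞)
    (E₁ := fun q : M => TangentSpace (𝓡 n) q) (E₂ := fun q : M => TangentSpace (𝓡 n) q)
    (E₃ := Bundle.Trivial M ℝ)
    (b := fun x : Vec n => (extChartAt (𝓡 n) q₀).symm x)
    (v := fun x => coordVec q₀ x v) (w := fun x => coordVec q₀ x w)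
    (ψ := fun x => g.inner ((extChartAt (𝓡 n) q₀).symm x))
    (s := (extChartAt (𝓡 n) q₀).target)
    (g.contMDiff.comp_contMDiffOn (contMDiffOn_extChartAt_symm q₀)) (hs v) (hs w)
  intro x hx
  have h := this x hx
  simp only [contMDiffWithinAt_totalSpace] at h
  exact h.2.contDiffWithinAt

/-- The differential of the chart is a left inverse. -/
lemma injective_coordVec (q₀ : M) {x : Vec n} (hx : x ∈ (extChartAt (𝓡 n) q₀).target) {v : Vec n}
    (h : coordVec q₀ x v = 0) : v = 0 := by
  have h1 := mfderiv_extChartAt_comp_mfderivWithin_extChartAt_symm (I := 𝓡 n) hx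
  have h2 := DFunLike.congr_fun h1 v
  have h3 : mfderivWithin 𝓘(ℝ, Vec n) (𝓡 n) (extChartAt (𝓡 n) q₀).symm (range (𝓡 n)) x v
      = coordVec q₀ x v := by
    rw [modelWithCornersSelf_coe, range_id, mfderivWithin_univ]
    rfl
  have h4 := congrArg (mfderiv (𝓡 n) 𝓘(ℝ, Vec n) (extChartAt (𝓡 n) q₀)
    ((extChartAt (𝓡 n) q₀).symm x)) (h3.trans h)
  rw [map_zero] at h4
  exact h2.symm.trans h4

lemma chartMetric_pos (g : RMetric n M) (q₀ : M) {x v : Vec n}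
    (hx : x ∈ (extChartAt (𝓡 n) q₀).target) (hv : v ≠ 0) : 0 < chartMetric g q₀ x v v := by
  rw [chartMetric_apply]
  exact g.pos _ _ fun h => hv (injective_coordVec q₀ hx h)

lemma chartMetric_nonneg (g : RMetric n M) (q₀ : M) {x : Vec n}
    (hx : x ∈ (extChartAt (𝓡 n) q₀).target) (v : Vec n) : 0 ≤ chartMetric g q₀ x v v := by
  by_cases hv : v = 0
  · simp [hv]
  · exact (chartMetric_pos g q₀ hx hv).le

/-- The constant is the minimum of the quadratic form on the unit sphere, and homogeneity does the
rest. If the sphere is empty the space is trivial. -/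
lemma exists_coercive {E : Type*} [NormedAddCommGroup E] [NormedSpace ℝ E] [FiniteDimensional ℝ E]
    (B : E →L[ℝ] E →L[ℝ] ℝ) (hB : ∀ v, v ≠ 0 → 0 < B v v) :
    ∃ c > 0, ∀ v, c * ‖v‖ ^ 2 ≤ B v v := by
  have : ProperSpace E := FiniteDimensional.proper_real E
  rcases (Metric.sphere (0 : E) 1).eq_empty_or_nonempty with h0 | h0
  · refine ⟨1, one_pos, fun v => ?_⟩
    have : v = 0 := by
      by_contra hv
      have : ‖v‖⁻¹ • v ∈ Metric.sphere (0 : E) 1 := by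
        rw [mem_sphere_zero_iff_norm, norm_smul, norm_inv, norm_norm,
          inv_mul_cancel₀ (norm_ne_zero_iff.2 hv)]
      rw [h0] at this
      exact this
    simp [this]
  · have hc : Continuous fun v => B v v := by fun_prop
    obtain ⟨v₀, hv₀, hmin⟩ := (isCompact_sphere (0 : E) 1).exists_isMinOn h0 hc.continuousOn
    have hv₀' : v₀ ≠ 0 := by
      rintro rfl
      simp at hv₀
    refine ⟨B v₀ v₀, hB v₀ hv₀', fun v => ?_⟩
    by_cases hv : v = 0
    · simp [hv]
    · have hs : ‖v‖⁻¹ • v ∈ Metric.sphere (0 : E) 1 := by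
        rw [mem_sphere_zero_iff_norm, norm_smul, norm_inv, norm_norm,
          inv_mul_cancel₀ (norm_ne_zero_iff.2 hv)]
      have h1 : B v₀ v₀ ≤ B (‖v‖⁻¹ • v) (‖v‖⁻¹ • v) := hmin hs
      simp only [map_smul, smul_apply, smul_eq_mul] at h1
      have h2 : 0 < ‖v‖ := norm_pos_iff.2 hv
      have h3 := mul_le_mul_of_nonneg_right h1 (sq_nonneg ‖v‖)
      refine h3.trans_eq ?_
      field_simp

/-- A perturbation of operator norm at most half the coercivity constant costs at most half of it.
-/
lemma exists_bounds_of_continuousAt {X E : Type*} [TopologicalSpace X] [NormedAddCommGroup E]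
    [NormedSpace ℝ E] [FiniteDimensional ℝ E] {G : X → E →L[ℝ] E →L[ℝ] ℝ} {x₀ : X}
    (hG : ContinuousAt G x₀) (hpos : ∀ v, v ≠ 0 → 0 < G x₀ v v) :
    ∃ c > 0, ∃ C > 0, ∀ᶠ x in 𝓝 x₀,
      ∀ v, c * ‖v‖ ^ 2 ≤ G x v v ∧ G x v v ≤ C * ‖v‖ ^ 2 := by
  obtain ⟨c, hc, hB⟩ := exists_coercive (G x₀) hpos
  refine ⟨c / 2, by positivity, ‖G x₀‖ + c / 2, by positivity, ?_⟩
  filter_upwards [hG (Metric.ball_mem_nhds _ (half_pos hc))] with x hx v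
  have h1 : ‖G x - G x₀‖ ≤ c / 2 := (mem_ball_iff_norm.1 hx).le
  have h2 := (G x - G x₀).le_opNorm₂ v v
  have h3 := (G x₀).le_opNorm₂ v v
  rw [Real.norm_eq_abs] at h2 h3
  have h4 := abs_le.1 h2
  have h5 := abs_le.1 h3
  have h6 := hB v
  have h7 := mul_le_mul_of_nonneg_right h1 (mul_self_nonneg ‖v‖)
  simp only [sub_apply] at h4
  constructor <;> nlinarith

lemma exists_chartMetric_bounds (g : RMetric n M) (q₀ : M) :
    ∃ c > 0, ∃ C > 0, ∀ᶠ x in 𝓝 (extChartAt (𝓡 n) q₀ q₀),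
      ∀ v, c * ‖v‖ ^ 2 ≤ chartMetric g q₀ x v v ∧ chartMetric g q₀ x v v ≤ C * ‖v‖ ^ 2 :=
  exists_bounds_of_continuousAt ((contDiffOn_chartMetric g q₀).continuousOn.continuousAt
    (mem_extChartAt_target_nhds q₀ (mem_extChartAt_target q₀)))
    fun _ hv => chartMetric_pos g q₀ (mem_extChartAt_target q₀) hv

end Charts

/-! ### From second derivatives to growth estimates -/

section Estimates

variable {n : ℕ}

section

variable {E F G : Type*} [NormedAddCommGroup E] [NormedSpace ℝ E] [NormedAddCommGroup F]
  [NormedSpace ℝ F] [NormedAddCommGroup G] [NormedSpace ℝ G]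

lemma hasFDerivAt_partial_fst {f : E × F → G} {x : E} {v : F} (hf : DifferentiableAt ℝ f (x, v)) :
    HasFDerivAt (fun y => f (y, v))
      ((fderiv ℝ f (x, v)).comp (ContinuousLinearMap.inl ℝ E F)) x :=
  hf.hasFDerivAt.comp x (hasFDerivAt_prodMk_left x v)

lemma hasFDerivAt_partial_snd {f : E × F → G} {x : E} {v : F} (hf : DifferentiableAt ℝ f (x, v)) :
    HasFDerivAt (fun w => f (x, w))
      ((fderiv ℝ f (x, v)).comp (ContinuousLinearMap.inr ℝ E F)) v :=
  hf.hasFDerivAt.comp v (hasFDerivAt_prodMk_right x v)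

lemma fderiv_apply_eq_partial {f : E × F → G} {x : E} {v : F} (hf : DifferentiableAt ℝ f (x, v))
    (a : E) (b : F) : fderiv ℝ f (x, v) (a, b) =
      fderiv ℝ (fun y => f (y, v)) x a + fderiv ℝ (fun w => f (x, w)) v b := by
  rw [(hasFDerivAt_partial_fst hf).fderiv, (hasFDerivAt_partial_snd hf).fderiv]
  simp [← map_add]

lemma norm_fderiv_partial_fst_le {f : E × F → G} {x : E} {v : F}
    (hf : DifferentiableAt ℝ f (x, v)) :
    ‖fderiv ℝ (fun y => f (y, v)) x‖ ≤ ‖fderiv ℝ f (x, v)‖ := by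
  rw [(hasFDerivAt_partial_fst hf).fderiv]
  refine ContinuousLinearMap.opNorm_le_bound _ (norm_nonneg _) fun a => ?_
  simpa using (fderiv ℝ f (x, v)).le_opNorm (a, 0)

lemma norm_fderiv_partial_snd_le {f : E × F → G} {x : E} {v : F}
    (hf : DifferentiableAt ℝ f (x, v)) :
    ‖fderiv ℝ (fun w => f (x, w)) v‖ ≤ ‖fderiv ℝ f (x, v)‖ := by
  rw [(hasFDerivAt_partial_snd hf).fderiv]
  refine ContinuousLinearMap.opNorm_le_bound _ (norm_nonneg _) fun a => ?_
  simpa using (fderiv ℝ f (x, v)).le_opNorm (0, a)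

end

/-- Bounds on the second derivatives imply the quadratic growth estimates. -/
lemma quadEst_of_second_derivatives {f : Vec n × Vec n → ℝ} {B : Set (Vec n)} (hBo : IsOpen B)
    (hBc : Convex ℝ B) {K : ℝ} (hK : 0 ≤ K) (hf : ∀ x ∈ B, ∀ v, ContDiffAt ℝ 2 f (x, v))
    (hvv : ∀ x ∈ B, ∀ v, ‖fderiv ℝ (fun v' => fderiv ℝ (fun w => f (x, w)) v') v‖ ≤ K)
    (hqv : ∀ x ∈ B, ∀ v,
      ‖fderiv ℝ (fun x' => fderiv ℝ (fun w => f (x', w)) v) x‖ ≤ K * (1 + ‖v‖))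
    (hqq : ∀ x ∈ B, ∀ v,
      ‖fderiv ℝ (fun x' => fderiv ℝ (fun y => f (y, v)) x') x‖ ≤ K * (1 + ‖v‖) ^ 2)
    (h0 : ∀ x ∈ B, |f (x, 0)| ≤ K) (hd0 : ∀ x ∈ B, ‖fderiv ℝ f (x, 0)‖ ≤ K) :
    QuadEst K B f := by
  have hd : ∀ x ∈ B, ∀ v, DifferentiableAt ℝ f (x, v) := fun x hx v =>
    (hf x hx v).differentiableAt (by simp)
  have hdd : ∀ x ∈ B, ∀ v, DifferentiableAt ℝ (fderiv ℝ f) (x, v) := fun x hx v =>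
    ((hf x hx v).fderiv_right (m := 1) (by norm_num)).differentiableAt (by simp)
  have hvd : ∀ x ∈ B, ∀ v, DifferentiableAt ℝ (fun v' => fderiv ℝ (fun w => f (x, w)) v') v := by
    intro x hx v
    have : (fun v' => fderiv ℝ (fun w => f (x, w)) v') =
        fun v' => (fderiv ℝ f (x, v')).comp (ContinuousLinearMap.inr ℝ (Vec n) (Vec n)) := by
      ext1 v'
      exact (hasFDerivAt_partial_snd (hd x hx v')).fderiv
    rw [this]
    exact ((hasFDerivAt_partial_snd (hdd x hx v)).differentiableAt).clm_comp
      (differentiableAt_const _)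
  have hqd : ∀ x ∈ B, ∀ v, DifferentiableAt ℝ (fun x' => fderiv ℝ (fun w => f (x', w)) v) x := by
    intro x hx v
    have h1 : DifferentiableAt ℝ (fun x' => (fderiv ℝ f (x', v)).comp
        (ContinuousLinearMap.inr ℝ (Vec n) (Vec n))) x :=
      ((hasFDerivAt_partial_fst (hdd x hx v)).differentiableAt).clm_comp (differentiableAt_const _)
    refine h1.congr_of_eventuallyEq ?_
    filter_upwards [hBo.mem_nhds hx] with y hy
    exact (hasFDerivAt_partial_snd (hd y hy v)).fderiv
  have hqqd : ∀ x ∈ B, ∀ v, DifferentiableAt ℝ (fun x' => fderiv ℝ (fun y => f (y, v)) x') x := by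
    intro x hx v
    have h1 : DifferentiableAt ℝ (fun x' => (fderiv ℝ f (x', v)).comp
        (ContinuousLinearMap.inl ℝ (Vec n) (Vec n))) x :=
      ((hasFDerivAt_partial_fst (hdd x hx v)).differentiableAt).clm_comp (differentiableAt_const _)
    refine h1.congr_of_eventuallyEq ?_
    filter_upwards [hBo.mem_nhds hx] with y hy
    exact (hasFDerivAt_partial_fst (hd y hy v)).fderiv
  -- Each bound on a second partial derivative is integrated along a segment in the corresponding
  -- variable; `B` is convex and the velocities are unrestricted.
  have e1 : ∀ x ∈ B, ∀ v v',
      ‖fderiv ℝ (fun w => f (x, w)) v' - fderiv ℝ (fun w => f (x, w)) v‖ ≤ K * ‖v' - v‖ := by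
    intro x hx v v'
    exact Convex.norm_image_sub_le_of_norm_fderiv_le (fun v _ => hvd x hx v)
      (fun v _ => hvv x hx v) convex_univ (mem_univ v) (mem_univ v')
  have e2 : ∀ x ∈ B, ∀ x' ∈ B, ∀ v,
      ‖fderiv ℝ (fun w => f (x', w)) v - fderiv ℝ (fun w => f (x, w)) v‖ ≤
        K * (1 + ‖v‖) * ‖x' - x‖ := by
    intro x hx x' hx' v
    exact Convex.norm_image_sub_le_of_norm_fderiv_le (fun x hx => hqd x hx v)
      (fun x hx => hqv x hx v) hBc hx hx'
  have e3 : ∀ x ∈ B, ∀ v, ‖fderiv ℝ (fun w => f (x, w)) v‖ ≤ K * (1 + ‖v‖) := by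
    intro x hx v
    have h1 := e1 x hx 0 v
    have h2 := (norm_fderiv_partial_snd_le (hd x hx 0)).trans (hd0 x hx)
    have h3 := norm_sub_norm_le (fderiv ℝ (fun w => f (x, w)) v) (fderiv ℝ (fun w => f (x, w)) 0)
    rw [sub_zero] at h1
    linarith
  have e4 : ∀ x ∈ B, ∀ x' ∈ B, ∀ v,
      ‖fderiv ℝ (fun y => f (y, v)) x' - fderiv ℝ (fun y => f (y, v)) x‖ ≤
        K * (1 + ‖v‖) ^ 2 * ‖x' - x‖ := by
    intro x hx x' hx' v
    exact Convex.norm_image_sub_le_of_norm_fderiv_le (fun x hx => hqqd x hx v)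
      (fun x hx => hqq x hx v) hBc hx hx'
  have hline : ∀ v v' : Vec n, ∀ s ∈ Icc (0 : ℝ) 1, 1 + ‖v + s • (v' - v)‖ ≤ 1 + ‖v‖ + ‖v'‖ := by
    intro v v' s hs
    have : v + s • (v' - v) = (1 - s) • v + s • v' := by module
    rw [this]
    have h1 := norm_add_le ((1 - s) • v) (s • v')
    rw [norm_smul, norm_smul, Real.norm_of_nonneg hs.1,
      Real.norm_of_nonneg (sub_nonneg.2 hs.2)] at h1
    nlinarith [norm_nonneg v, norm_nonneg v', hs.1, hs.2]
  have hlineD : ∀ x ∈ B, ∀ (v v' : Vec n) (s : ℝ),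
      HasDerivAt (fun s : ℝ => f (x, v + s • (v' - v)))
        (fderiv ℝ (fun w => f (x, w)) (v + s • (v' - v)) (v' - v)) s := by
    intro x hx v v' s
    have h1 := (hasFDerivAt_partial_snd (hd x hx (v + s • (v' - v)))).differentiableAt.hasFDerivAt
    have h2 : HasDerivAt (fun s : ℝ => v + s • (v' - v)) (v' - v) s := by
      simpa using ((hasDerivAt_id s).smul_const (v' - v)).const_add v
    exact h1.comp_hasDerivAt s h2
  -- The assumption controls only the `q`-derivative of `∂_v f`, while the `v`-increments of `∂_q f`
  -- are needed. The function `y ↦ f(y, v') - f(y, v)` is Lipschitz at `x`, because its increment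
  -- comes from integrating `∂_v f(y, ·) - ∂_v f(x, ·)` along the segment from `v` to `v'`, where
  -- `e2` applies; a Lipschitz constant at `x` bounds the derivative there.
  have e5 : ∀ x ∈ B, ∀ v v',
      ‖fderiv ℝ (fun y => f (y, v')) x - fderiv ℝ (fun y => f (y, v)) x‖ ≤
        K * (1 + ‖v‖ + ‖v'‖) * ‖v' - v‖ := by
    intro x hx v v'
    have hsub := (hasFDerivAt_partial_fst (hd x hx v')).differentiableAt.hasFDerivAt.sub
      (hasFDerivAt_partial_fst (hd x hx v)).differentiableAt.hasFDerivAt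
    refine hsub.le_of_lip' (by positivity) ?_
    filter_upwards [hBo.mem_nhds hx] with y hy
    have := norm_image_sub_le_of_norm_deriv_le_segment_01'
      (f := fun s : ℝ => f (y, v + s • (v' - v)) - f (x, v + s • (v' - v)))
      (C := K * (1 + ‖v‖ + ‖v'‖) * ‖v' - v‖ * ‖y - x‖)
      (fun s _ => ((hlineD y hy v v' s).sub (hlineD x hx v v' s)).hasDerivWithinAt) (by
        intro s hs
        rw [← sub_apply]
        refine (ContinuousLinearMap.le_opNorm _ _).trans ?_
        have h1 := e2 x hx y hy (v + s • (v' - v))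
        have h2 := hline v v' s (Ico_subset_Icc_self hs)
        calc _ ≤ (K * (1 + ‖v‖ + ‖v'‖) * ‖y - x‖) * ‖v' - v‖ := by
              gcongr
              exact h1.trans (by gcongr)
          _ = _ := by ring)
    simp only [one_smul, zero_smul, add_zero, add_sub_cancel] at this
    refine le_trans (le_of_eq ?_) this
    simp only [Pi.sub_apply]
    congr 1
    ring
  have e6 : ∀ x ∈ B, ∀ v, ‖fderiv ℝ (fun y => f (y, v)) x‖ ≤ K * (1 + ‖v‖) ^ 2 := by
    intro x hx v
    have h1 := e5 x hx 0 v
    have h2 := (norm_fderiv_partial_fst_le (hd x hx 0)).trans (hd0 x hx)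
    have h3 := norm_sub_norm_le (fderiv ℝ (fun y => f (y, v)) x) (fderiv ℝ (fun y => f (y, 0)) x)
    rw [sub_zero, norm_zero, add_zero] at h1
    nlinarith [norm_nonneg v, mul_nonneg hK (norm_nonneg v)]
  refine ⟨hd, ?_, ?_, ?_⟩
  · intro x hx v
    have := norm_image_sub_le_of_norm_deriv_le_segment_01'
      (f := fun s : ℝ => f (x, 0 + s • (v - 0))) (C := K * (1 + ‖v‖) * ‖v‖)
      (fun s _ => (hlineD x hx 0 v s).hasDerivWithinAt) (by
        intro s hs
        refine (ContinuousLinearMap.le_opNorm _ _).trans ?_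
        have h2 := hline 0 v s (Ico_subset_Icc_self hs)
        rw [norm_zero, add_zero] at h2
        rw [sub_zero] at h2 ⊢
        gcongr
        exact (e3 x hx _).trans (by gcongr))
    simp only [one_smul, zero_smul, add_zero, sub_zero, zero_add, Real.norm_eq_abs] at this
    have h1 := h0 x hx
    have h2 := abs_sub_abs_le_abs_sub (f (x, v)) (f (x, 0))
    nlinarith [norm_nonneg v, mul_nonneg hK (norm_nonneg v)]
  · intro x hx v a b
    rw [fderiv_apply_eq_partial (hd x hx v)]
    have h1 := (fderiv ℝ (fun y => f (y, v)) x).le_of_opNorm_le (e6 x hx v) a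
    have h2 := (fderiv ℝ (fun w => f (x, w)) v).le_of_opNorm_le (e3 x hx v) b
    rw [Real.norm_eq_abs] at h1 h2
    refine (abs_add_le _ _).trans ((add_le_add h1 h2).trans_eq ?_)
    ring
  · intro x hx x' hx' v v' a b
    rw [sub_apply, fderiv_apply_eq_partial (hd x hx v), fderiv_apply_eq_partial (hd x' hx' v')]
    -- For the position derivative the intermediate point is `(x, v')`; for the velocity derivative
    -- below it is `(x', v)`.
    have h1 : ‖fderiv ℝ (fun y => f (y, v')) x' - fderiv ℝ (fun y => f (y, v)) x‖ ≤
        K * ((1 + ‖v‖ + ‖v'‖) * ‖x' - x‖ + ‖v' - v‖) * (1 + ‖v‖ + ‖v'‖) := by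
      have h2 := norm_sub_le_norm_sub_add_norm_sub (fderiv ℝ (fun y => f (y, v')) x')
        (fderiv ℝ (fun y => f (y, v')) x) (fderiv ℝ (fun y => f (y, v)) x)
      have h3 := e4 x hx x' hx' v'
      have h4 := e5 x hx v v'
      have h5 : K * (1 + ‖v'‖) ^ 2 * ‖x' - x‖ ≤ K * (1 + ‖v‖ + ‖v'‖) ^ 2 * ‖x' - x‖ := by
        gcongr
        linarith [norm_nonneg v]
      linarith
    have h2 : ‖fderiv ℝ (fun w => f (x', w)) v' - fderiv ℝ (fun w => f (x, w)) v‖ ≤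
        K * ((1 + ‖v‖ + ‖v'‖) * ‖x' - x‖ + ‖v' - v‖) := by
      have h2 := norm_sub_le_norm_sub_add_norm_sub (fderiv ℝ (fun w => f (x', w)) v')
        (fderiv ℝ (fun w => f (x', w)) v) (fderiv ℝ (fun w => f (x, w)) v)
      have h3 := e1 x' hx' v v'
      have h4 := e2 x hx x' hx' v
      have h5 : K * (1 + ‖v‖) * ‖x' - x‖ ≤ K * (1 + ‖v‖ + ‖v'‖) * ‖x' - x‖ :=
        mul_le_mul_of_nonneg_right (mul_le_mul_of_nonneg_left (by linarith [norm_nonneg v']) hK)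
          (norm_nonneg _)
      linarith
    have h3 := ContinuousLinearMap.le_of_opNorm_le _ h1 a
    have h4 := ContinuousLinearMap.le_of_opNorm_le _ h2 b
    rw [Real.norm_eq_abs, sub_apply] at h3 h4
    have h5 := abs_add_le (fderiv ℝ (fun y => f (y, v')) x' a - fderiv ℝ (fun y => f (y, v)) x a)
      (fderiv ℝ (fun w => f (x', w)) v' b - fderiv ℝ (fun w => f (x, w)) v b)
    rw [show fderiv ℝ (fun y => f (y, v')) x' a + fderiv ℝ (fun w => f (x', w)) v' b -
      (fderiv ℝ (fun y => f (y, v)) x a + fderiv ℝ (fun w => f (x, w)) v b) =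
      (fderiv ℝ (fun y => f (y, v')) x' a - fderiv ℝ (fun y => f (y, v)) x a) +
      (fderiv ℝ (fun w => f (x', w)) v' b - fderiv ℝ (fun w => f (x, w)) v b) by ring]
    refine h5.trans ((add_le_add h3 h4).trans_eq ?_)
    ring

end Estimates

/-! ### Growth estimates under changes of variables -/

section Transfer

variable {n : ℕ}

lemma QuadEst.congr {C : ℝ} {S : Set (Vec n)} {f f' : Vec n × Vec n → ℝ} (h : QuadEst C S f)
    (hS : IsOpen S) (hff : ∀ q ∈ S, ∀ v, f' (q, v) = f (q, v)) : QuadEst C S f' := by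
  have hev : ∀ q ∈ S, ∀ v, f' =ᶠ[𝓝 (q, v)] f := by
    intro q hq v
    filter_upwards [(hS.prod isOpen_univ).mem_nhds (⟨hq, mem_univ v⟩ : (q, v) ∈ S ×ˢ univ)]
      with p hp
    exact hff p.1 hp.1 p.2
  refine ⟨fun q hq v => (h.diff q hq v).congr_of_eventuallyEq (hev q hq v), fun q hq v => ?_,
    fun q hq v a b => ?_, fun q hq q' hq' v v' a b => ?_⟩
  · rw [hff q hq v]; exact h.bound q hq v
  · rw [(hev q hq v).fderiv_eq]; exact h.bound_fderiv q hq v a b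
  · rw [(hev q hq v).fderiv_eq, (hev q' hq' v').fderiv_eq]
    exact h.lip_fderiv q hq q' hq' v v' a b

set_option maxHeartbeats 1600000 in
/-- Quadratic growth estimates are preserved by changes of variables
`(q, v) ↦ (ψ(q), A(q)(1, v))` such that `∂_q ψ(q) = A(q)(0, ·)`. -/
lemma QuadEst.comp {K R : ℝ} (hK : 0 ≤ K) (hR : 1 ≤ R) {B S : Set (Vec n)}
    {f : Vec n × Vec n → ℝ} (h : QuadEst K B f) {ψ : Vec n → Vec n}
    {A : Vec n → ℝ × Vec n →L[ℝ] Vec n} {D : Vec n → Vec n →L[ℝ] ℝ × Vec n →L[ℝ] Vec n}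
    (hSc : Convex ℝ S) (hψB : ∀ q ∈ S, ψ q ∈ B)
    (hψ : ∀ q ∈ S, HasFDerivAt ψ ((A q).comp (ContinuousLinearMap.inr ℝ ℝ (Vec n))) q)
    (hA : ∀ q ∈ S, HasFDerivAt A (D q) q) (hAR : ∀ q ∈ S, ‖A q‖ ≤ R) (hDR : ∀ q ∈ S, ‖D q‖ ≤ R)
    (hDL : ∀ q ∈ S, ∀ q' ∈ S, ‖D q' - D q‖ ≤ R * ‖q' - q‖) :
    QuadEst (22 * K * R ^ 4) S (fun z => f (ψ z.1, A z.1 (1, z.2))) := by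
  have hR0 : 0 ≤ R := zero_le_one.trans hR
  have hAL : ∀ q ∈ S, ∀ q' ∈ S, ‖A q' - A q‖ ≤ R * ‖q' - q‖ := fun q hq q' hq' =>
    hSc.norm_image_sub_le_of_norm_hasFDerivWithin_le
      (fun q hq => (hA q hq).hasFDerivWithinAt) hDR hq hq'
  have h1v : ∀ v : Vec n, ‖((1 : ℝ), v)‖ ≤ 1 + ‖v‖ := fun v => by
    rw [Prod.norm_mk, norm_one]
    exact max_le (by linarith [norm_nonneg v]) (by linarith)
  have h0v : ∀ v : Vec n, ‖((0 : ℝ), v)‖ = ‖v‖ := fun v => by simp [Prod.norm_mk]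
  have hw : ∀ q ∈ S, ∀ v, ‖A q (1, v)‖ ≤ R * (1 + ‖v‖) := fun q hq v =>
    ((A q).le_of_opNorm_le (hAR q hq) _).trans (by gcongr; exact h1v v)
  have hψL : ∀ q ∈ S, ∀ q' ∈ S, ‖ψ q' - ψ q‖ ≤ R * ‖q' - q‖ := by
    refine fun q hq q' hq' => hSc.norm_image_sub_le_of_norm_hasFDerivWithin_le
      (fun q hq => (hψ q hq).hasFDerivWithinAt) (fun q hq => ?_) hq hq'
    refine ContinuousLinearMap.opNorm_le_bound _ hR0 fun a => ?_
    have := (A q).le_of_opNorm_le (hAR q hq) (0, a)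
    rw [h0v] at this
    simpa using this
  -- The velocity component `A(q)(1, v)` is affine in `v`. Its dependence on `q` contributes
  -- `D(q)(a)(1, v)`, of size `(1 + ‖v‖)‖a‖`, which is exactly the weight allowed in the estimates.
  have hT : ∀ q ∈ S, ∀ v, HasFDerivAt (fun z : Vec n × Vec n => (ψ z.1, A z.1 (1, z.2)))
      ((((A q).comp (ContinuousLinearMap.inr ℝ ℝ (Vec n))).comp
        (ContinuousLinearMap.fst ℝ (Vec n) (Vec n))).prod
        (((A q).comp ((0 : Vec n × Vec n →L[ℝ] ℝ).prod
          (ContinuousLinearMap.snd ℝ (Vec n) (Vec n)))) +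
          ((D q).comp (ContinuousLinearMap.fst ℝ (Vec n) (Vec n))).flip (1, v))) (q, v) := by
    intro q hq v
    refine HasFDerivAt.prodMk ?_ ?_
    · exact HasFDerivAt.comp (q, v) (g := ψ) (hψ q hq) hasFDerivAt_fst
    · exact (HasFDerivAt.comp (q, v) (g := A) (hA q hq) hasFDerivAt_fst).clm_apply
        ((hasFDerivAt_const (1 : ℝ) (q, v)).prodMk hasFDerivAt_snd)
  have hfd : ∀ q ∈ S, ∀ v a b, fderiv ℝ (fun z : Vec n × Vec n => f (ψ z.1, A z.1 (1, z.2)))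
      (q, v) (a, b) = fderiv ℝ f (ψ q, A q (1, v)) (A q (0, a), A q (0, b) + D q a (1, v)) := by
    intro q hq v a b
    have := ((h.diff (ψ q) (hψB q hq) (A q (1, v))).hasFDerivAt.comp (q, v) (hT q hq v)).fderiv
    change fderiv ℝ (f ∘ fun z : Vec n × Vec n => (ψ z.1, A z.1 (1, z.2))) (q, v) (a, b) = _
    rw [this]
    rfl
  have hb1 : ∀ q ∈ S, ∀ a, ‖A q (0, a)‖ ≤ R * ‖a‖ := fun q hq a => by
    have := (A q).le_of_opNorm_le (hAR q hq) (0, a)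
    rwa [h0v] at this
  have hb2 : ∀ q ∈ S, ∀ v a b, ‖A q (0, b) + D q a (1, v)‖ ≤ R * ((1 + ‖v‖) * ‖a‖ + ‖b‖) := by
    intro q hq v a b
    refine (norm_add_le _ _).trans ?_
    have h1 := (D q).le_of_opNorm₂_le_of_le (hDR q hq) (le_refl ‖a‖) (h1v v)
    have h2 := hb1 q hq b
    linarith
  refine ⟨fun q hq v => ?_, fun q hq v => ?_, fun q hq v a b => ?_, fun q hq q' hq' v v' a b => ?_⟩
  · exact ((h.diff (ψ q) (hψB q hq) (A q (1, v))).hasFDerivAt.comp (q, v)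
      (hT q hq v)).differentiableAt
  · refine (h.bound _ (hψB q hq) _).trans ?_
    have h1 : 1 + ‖A q (1, v)‖ ≤ 2 * R ^ 2 * (1 + ‖v‖) := by
      have := hw q hq v
      have h3 : R ≤ R ^ 2 := by nlinarith
      have h4 := mul_le_mul_of_nonneg_right h3 (by positivity : 0 ≤ 1 + ‖v‖)
      have h5 := mul_le_mul_of_nonneg_right (hR.trans h3) (by positivity : 0 ≤ 1 + ‖v‖)
      linarith [norm_nonneg v]
    calc K * (1 + ‖A q (1, v)‖) ^ 2 ≤ K * (2 * R ^ 2 * (1 + ‖v‖)) ^ 2 := by gcongr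
      _ = 4 * (K * R ^ 4 * (1 + ‖v‖) ^ 2) := by ring
      _ ≤ 22 * (K * R ^ 4 * (1 + ‖v‖) ^ 2) := by gcongr; norm_num
      _ = _ := by ring
  · rw [hfd q hq]
    refine (h.bound_fderiv _ (hψB q hq) _ _ _).trans ?_
    have h1 : 1 + ‖A q (1, v)‖ ≤ 2 * R * (1 + ‖v‖) := by
      have := hw q hq v
      nlinarith [norm_nonneg v]
    have h2 := hb1 q hq a
    have h3 := hb2 q hq v a b
    calc _ ≤ K * (2 * R * (1 + ‖v‖)) * ((2 * R * (1 + ‖v‖)) * (R * ‖a‖) +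
          R * R * ((1 + ‖v‖) * ‖a‖ + ‖b‖)) := by
            gcongr
            refine h3.trans ?_
            have : 0 ≤ R * ((1 + ‖v‖) * ‖a‖ + ‖b‖) := by positivity
            nlinarith
      _ = K * R ^ 3 * (6 * ((1 + ‖v‖) * ((1 + ‖v‖) * ‖a‖)) + 2 * ((1 + ‖v‖) * ‖b‖)) := by ring
      _ ≤ K * R ^ 4 * (22 * ((1 + ‖v‖) * ((1 + ‖v‖) * ‖a‖)) + 22 * ((1 + ‖v‖) * ‖b‖)) := by
            gcongr <;> norm_num
      _ = _ := by ring
  · rw [sub_apply, hfd q hq, hfd q' hq']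
    set ρ := 1 + ‖v‖ + ‖v'‖ with hρ
    have hv0 := norm_nonneg v
    have hv0' := norm_nonneg v'
    have hρ0 : 0 ≤ ρ := by positivity
    set w := A q (1, v) with hwdef
    set w' := A q' (1, v') with hwdef'
    have hw1 := hw q hq v
    have hw2 := hw q' hq' v'
    have hρw : 1 + ‖w‖ + ‖w'‖ ≤ 3 * R * ρ := by nlinarith
    have hw1' : 1 + ‖w‖ ≤ 2 * R * ρ := by nlinarith
    have hΔw : ‖w' - w‖ ≤ R * (ρ * ‖q' - q‖ + ‖v' - v‖) := by
      -- The constant entry `1` cancels in the second term, which is why only `v' - v` appears in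
      -- it.
      have e : w' - w = (A q' - A q) (1, v') + A q (0, v' - v) := by
        rw [hwdef, hwdef', sub_apply, ← sub_add_sub_cancel (A q' (1, v')) (A q (1, v')), ← map_sub]
        simp
      rw [e]
      refine (norm_add_le _ _).trans ?_
      have h1 := (A q' - A q).le_of_opNorm_le (hAL q hq q' hq') (1, v')
      have h2 := hb1 q hq (v' - v)
      have h3 : R * ‖q' - q‖ * ‖((1 : ℝ), v')‖ ≤ R * ‖q' - q‖ * ρ := by
        gcongr
        exact (h1v v').trans (by linarith)
      linarith
    have hX1 : ‖A q' (0, a) - A q (0, a)‖ ≤ R * (‖q' - q‖ * ‖a‖) := by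
      have := (A q' - A q).le_of_opNorm_le (hAL q hq q' hq') (0, a)
      rw [h0v, sub_apply] at this
      linarith
    have hX2 : ‖(A q' (0, b) + D q' a (1, v')) - (A q (0, b) + D q a (1, v))‖ ≤
        R * (ρ * ‖q' - q‖ * ‖a‖ + ‖a‖ * ‖v' - v‖ + ‖q' - q‖ * ‖b‖) := by
      have e : (A q' (0, b) + D q' a (1, v')) - (A q (0, b) + D q a (1, v)) =
          (A q' - A q) (0, b) + ((D q' - D q) a (1, v') + D q a (0, v' - v)) := by
        have : D q a (0, v' - v) = D q a (1, v') - D q a (1, v) := by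
          rw [← map_sub]; simp
        rw [this]
        simp only [sub_apply]
        abel
      rw [e]
      refine (norm_add_le _ _).trans ?_
      have h1 := (A q' - A q).le_of_opNorm_le (hAL q hq q' hq') (0, b)
      have h2 := norm_add_le ((D q' - D q) a (1, v')) (D q a (0, v' - v))
      have h3 := (D q' - D q).le_of_opNorm₂_le_of_le (hDL q hq q' hq') (le_refl ‖a‖) (h1v v')
      have h4 := (D q).le_of_opNorm₂_le_of_le (hDR q hq) (le_refl ‖a‖) (h0v (v' - v)).le
      rw [h0v] at h1
      have h5 : R * ‖q' - q‖ * ‖a‖ * (1 + ‖v'‖) ≤ R * ‖q' - q‖ * ‖a‖ * ρ := by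
        gcongr
        linarith
      linarith
    -- The difference of the differentials is tested on the new direction, and the old differential
    -- on the difference of the directions. The first term costs `4 · 4 = 16`, the second `6`; their
    -- sum is the constant `22`, which is more than the other two estimates require.
    have hsplit : fderiv ℝ f (ψ q', w') (A q' (0, a), A q' (0, b) + D q' a (1, v')) -
        fderiv ℝ f (ψ q, w) (A q (0, a), A q (0, b) + D q a (1, v)) =
        (fderiv ℝ f (ψ q', w') - fderiv ℝ f (ψ q, w))
          (A q' (0, a), A q' (0, b) + D q' a (1, v')) +
        fderiv ℝ f (ψ q, w) (A q' (0, a) - A q (0, a),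
          (A q' (0, b) + D q' a (1, v')) - (A q (0, b) + D q a (1, v))) := by
      rw [sub_apply, ← Prod.mk_sub_mk, map_sub]
      ring
    rw [hsplit]
    refine (abs_add_le _ _).trans ?_
    have hY1 := hb1 q' hq' a
    have hY2 : ‖A q' (0, b) + D q' a (1, v')‖ ≤ R * (ρ * ‖a‖ + ‖b‖) := by
      refine (hb2 q' hq' v' a b).trans ?_
      gcongr
      linarith
    have t1 : |(fderiv ℝ f (ψ q', w') - fderiv ℝ f (ψ q, w))
          (A q' (0, a), A q' (0, b) + D q' a (1, v'))| ≤
        16 * (K * R ^ 4 * ((ρ * ‖q' - q‖ + ‖v' - v‖) * (ρ * ‖a‖ + ‖b‖))) := by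
      refine (h.lip_fderiv _ (hψB q hq) _ (hψB q' hq') w w' _ _).trans ?_
      have u1 : (1 + ‖w‖ + ‖w'‖) * ‖ψ q' - ψ q‖ + ‖w' - w‖ ≤
          4 * R ^ 2 * (ρ * ‖q' - q‖ + ‖v' - v‖) := by
        have h1 := mul_le_mul hρw (hψL q hq q' hq') (norm_nonneg _) (by positivity)
        have h2 : 0 ≤ ρ * ‖q' - q‖ := by positivity
        have h3 : R ≤ R ^ 2 := by nlinarith
        have h4 := mul_le_mul_of_nonneg_right h3 h2
        have h5 := mul_le_mul_of_nonneg_right h3 (norm_nonneg (v' - v))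
        have h6 := mul_nonneg (sq_nonneg R) (norm_nonneg (v' - v))
        have h7 : 3 * R * ρ * (R * ‖q' - q‖) = 3 * (R ^ 2 * (ρ * ‖q' - q‖)) := by ring
        linarith
      have u2 : (1 + ‖w‖ + ‖w'‖) * ‖A q' (0, a)‖ + ‖A q' (0, b) + D q' a (1, v')‖ ≤
          4 * R ^ 2 * (ρ * ‖a‖ + ‖b‖) := by
        have h1 := mul_le_mul hρw hY1 (norm_nonneg _) (by positivity)
        have h2 : 0 ≤ ρ * ‖a‖ := by positivity
        have h3 : R ≤ R ^ 2 := by nlinarith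
        have h4 := mul_le_mul_of_nonneg_right h3 h2
        have h5 := mul_le_mul_of_nonneg_right h3 (norm_nonneg b)
        have h6 := mul_nonneg (sq_nonneg R) (norm_nonneg b)
        have h7 : 3 * R * ρ * (R * ‖a‖) = 3 * (R ^ 2 * (ρ * ‖a‖)) := by ring
        linarith
      calc _ ≤ K * (4 * R ^ 2 * (ρ * ‖q' - q‖ + ‖v' - v‖)) * (4 * R ^ 2 * (ρ * ‖a‖ + ‖b‖)) := by
            gcongr
        _ = _ := by ring
    have t2 : |fderiv ℝ f (ψ q, w) (A q' (0, a) - A q (0, a),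
          (A q' (0, b) + D q' a (1, v')) - (A q (0, b) + D q a (1, v)))| ≤
        6 * (K * R ^ 4 * ((ρ * ‖q' - q‖ + ‖v' - v‖) * (ρ * ‖a‖ + ‖b‖))) := by
      refine (h.bound_fderiv _ (hψB q hq) w _ _).trans ?_
      calc _ ≤ K * (2 * R * ρ) * ((2 * R * ρ) * (R * (‖q' - q‖ * ‖a‖)) + R * R *
            (ρ * ‖q' - q‖ * ‖a‖ + ‖a‖ * ‖v' - v‖ + ‖q' - q‖ * ‖b‖)) := by
            gcongr
            refine hX2.trans ?_
            have : 0 ≤ R * (ρ * ‖q' - q‖ * ‖a‖ + ‖a‖ * ‖v' - v‖ + ‖q' - q‖ * ‖b‖) := by positivity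
            nlinarith
        _ = K * R ^ 3 * (6 * (ρ * ‖q' - q‖ * (ρ * ‖a‖)) + 2 * (ρ * ‖q' - q‖ * ‖b‖) +
            2 * (‖v' - v‖ * (ρ * ‖a‖)) + 0 * (‖v' - v‖ * ‖b‖)) := by ring
        _ ≤ K * R ^ 4 * (6 * (ρ * ‖q' - q‖ * (ρ * ‖a‖)) + 6 * (ρ * ‖q' - q‖ * ‖b‖) +
            6 * (‖v' - v‖ * (ρ * ‖a‖)) + 6 * (‖v' - v‖ * ‖b‖)) := by
            gcongr <;> norm_num
        _ = _ := by ring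
    calc _ ≤ _ := add_le_add t1 t2
      _ = _ := by ring

end Transfer

/-! ### Strong convexity in the velocities -/

section Convex

variable {n : ℕ}

/-- Quadratic growth estimates together with strong convexity in the velocities, in terms of first
derivatives. -/
structure ConvexQuadEst (C : ℝ) (S : Set (Vec n)) (ℓ : Vec n × Vec n → ℝ) : Prop
    extends QuadEst C S ℓ where
  monotone : ∀ q ∈ S, ∀ v v', 0 ≤ (fderiv ℝ ℓ (q, v) - fderiv ℝ ℓ (q, v')) (0, v - v')
  strict : ∀ q ∈ S, ∀ v v',
    ‖v - v'‖ ^ 2 ≤ C * (fderiv ℝ ℓ (q, v) - fderiv ℝ ℓ (q, v')) (0, v - v')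

/-- Enlarging `C` in `strict` requires its second factor to be nonnegative whatever the sign of `C`;
this is the purpose of the field `monotone`. -/
lemma ConvexQuadEst.mono {C C' : ℝ} {S S' : Set (Vec n)} {ℓ : Vec n × Vec n → ℝ}
    (h : ConvexQuadEst C S ℓ) (hC : C ≤ C') (hS : S' ⊆ S) : ConvexQuadEst C' S' ℓ where
  toQuadEst := h.toQuadEst.mono hC hS
  monotone q hq v v' := h.monotone q (hS hq) v v'
  strict q hq v v' := (h.strict q (hS hq) v v').trans
    (mul_le_mul_of_nonneg_right hC (h.monotone q (hS hq) v v'))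

lemma ConvexQuadEst.congr {C : ℝ} {S : Set (Vec n)} {f f' : Vec n × Vec n → ℝ}
    (h : ConvexQuadEst C S f) (hS : IsOpen S) (hff : ∀ q ∈ S, ∀ v, f' (q, v) = f (q, v)) :
    ConvexQuadEst C S f' := by
  have hev : ∀ q ∈ S, ∀ v, fderiv ℝ f' (q, v) = fderiv ℝ f (q, v) := by
    intro q hq v
    refine Filter.EventuallyEq.fderiv_eq ?_
    filter_upwards [(hS.prod isOpen_univ).mem_nhds (⟨hq, mem_univ v⟩ : (q, v) ∈ S ×ˢ univ)]
      with p hp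
    exact hff p.1 hp.1 p.2
  refine ⟨h.toQuadEst.congr hS hff, fun q hq v v' => ?_, fun q hq v v' => ?_⟩
  · rw [hev q hq, hev q hq]; exact h.monotone q hq v v'
  · rw [hev q hq, hev q hq]; exact h.strict q hq v v'

/-- Along the ray `s ↦ s v`, strong monotonicity of the derivative makes `ℓ(q, s v) - s ∂_vℓ(q, 0) v
- s² ‖v‖² / (2K)` nondecreasing. Comparing `s = 0` with `s = 1` bounds `ℓ` below by a quadratic
polynomial in `‖v‖`, and its linear term is absorbed. The constant depends on `C` alone, hence is
uniform in time and position. -/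
lemma ConvexQuadEst.exists_coercive (C : ℝ) : ∃ C' > 0, ∀ (S : Set (Vec n))
    (ℓ : Vec n × Vec n → ℝ), ConvexQuadEst C S ℓ → ∀ q ∈ S, ∀ v,
      ‖v‖ ^ 2 ≤ C' * (ℓ (q, v) + C') := by
  set K : ℝ := max C 1 with hKdef
  have hK1 : 1 ≤ K := le_max_right _ _
  have hK0 : 0 < K := by linarith
  -- One constant playing both roles: it dominates the factor `4K` and the additive term `K + K³`
  -- found in `h10`.
  refine ⟨4 * K + K + K ^ 3, by positivity, fun S ℓ h q hq v => ?_⟩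
  replace h := h.mono (le_max_left C 1) Subset.rfl
  rw [← hKdef] at h
  have hder : ∀ s : ℝ, HasDerivAt (fun s : ℝ => ℓ (q, s • v)) (fderiv ℝ ℓ (q, s • v) (0, v)) s := by
    intro s
    have h1 : HasDerivAt (fun s : ℝ => (q, s • v)) ((0 : Vec n), v) s := by
      have := ((hasDerivAt_id s).smul_const v)
      rw [one_smul] at this
      exact (hasDerivAt_const s q).prodMk this
    exact (h.diff q hq (s • v)).hasFDerivAt.comp_hasDerivAt s h1
  have hder2 : ∀ s : ℝ, HasDerivAt
      (fun s : ℝ => ℓ (q, s • v) - s * fderiv ℝ ℓ (q, 0) (0, v) - s ^ 2 * (‖v‖ ^ 2 / (2 * K)))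
      (fderiv ℝ ℓ (q, s • v) (0, v) - fderiv ℝ ℓ (q, 0) (0, v) - s * (‖v‖ ^ 2 / K)) s := by
    intro s
    have h2 := ((hder s).sub ((hasDerivAt_id s).mul_const (fderiv ℝ ℓ (q, 0) (0, v)))).sub
      ((hasDerivAt_pow 2 s).mul_const (‖v‖ ^ 2 / (2 * K)))
    refine h2.congr_deriv ?_
    push_cast
    rw [pow_one, one_mul]
    field_simp
  have hmono := monotoneOn_of_deriv_nonneg (convex_Icc (0 : ℝ) 1)
    (fun s _ => (hder2 s).continuousAt.continuousWithinAt)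
    (fun s _ => (hder2 s).differentiableAt.differentiableWithinAt) (by
      intro s hs
      rw [interior_Icc] at hs
      rw [(hder2 s).deriv]
      have h3 := h.strict q hq (s • v) 0
      have e : ((0 : Vec n), s • v) = s • ((0 : Vec n), v) := by simp
      rw [sub_zero, e, map_smul, norm_smul, Real.norm_eq_abs, mul_pow, sq_abs, smul_eq_mul,
        sub_apply] at h3
      have h4 : s * ‖v‖ ^ 2 ≤ K * (fderiv ℝ ℓ (q, s • v) (0, v) - fderiv ℝ ℓ (q, 0) (0, v)) := by
        refine le_of_mul_le_mul_left ?_ hs.1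
        linarith
      have h5 : s * (‖v‖ ^ 2 / K) ≤ fderiv ℝ ℓ (q, s • v) (0, v) - fderiv ℝ ℓ (q, 0) (0, v) := by
        rw [mul_div_assoc', div_le_iff₀ hK0]
        linarith
      linarith)
  have h6 := hmono (left_mem_Icc.2 zero_le_one) (right_mem_Icc.2 zero_le_one) zero_le_one
  simp only [zero_smul, one_smul, zero_mul, one_mul, sub_zero, one_pow, ne_eq, OfNat.ofNat_ne_zero,
    not_false_eq_true, zero_pow] at h6
  have h7 := (abs_le.1 (h.bound q hq 0)).1
  have h8 := (abs_le.1 (h.bound_fderiv q hq 0 0 v)).1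
  simp only [norm_zero, add_zero, one_pow, mul_one, mul_zero, zero_add] at h7 h8
  have h9 : ‖v‖ ^ 2 ≤ 2 * K * (ℓ (q, v) + K * ‖v‖ + K) := by
    rw [← div_le_iff₀' (by positivity)]
    linarith
  -- The linear term is absorbed by `2K²‖v‖ ≤ ‖v‖² / 2 + 2K⁴`.
  have h10 : ‖v‖ ^ 2 ≤ 4 * K * (ℓ (q, v) + (K + K ^ 3)) := by
    nlinarith [sq_nonneg (‖v‖ - 2 * K ^ 2)]
  have h11 : 0 ≤ ℓ (q, v) + (K + K ^ 3) :=
    nonneg_of_mul_nonneg_right ((sq_nonneg _).trans h10) (by positivity)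
  refine h10.trans (mul_le_mul ?_ ?_ h11 (by positivity))
  · have : 0 < K ^ 3 := by positivity
    linarith
  · linarith

/-- Convex quadratic growth estimates are preserved by changes of variables
`(q, v) ↦ (ψ(q), A(q)(1, v))` such that `∂_q ψ(q) = A(q)(0, ·)` is invertible. -/
lemma ConvexQuadEst.comp {K R : ℝ} (hK : 0 ≤ K) (hR : 1 ≤ R) {B S : Set (Vec n)}
    {f : Vec n × Vec n → ℝ} (h : ConvexQuadEst K B f) {ψ : Vec n → Vec n}
    {A : Vec n → ℝ × Vec n →L[ℝ] Vec n} {D : Vec n → Vec n →L[ℝ] ℝ × Vec n →L[ℝ] Vec n}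
    (hSc : Convex ℝ S) (hψB : ∀ q ∈ S, ψ q ∈ B)
    (hψ : ∀ q ∈ S, HasFDerivAt ψ ((A q).comp (ContinuousLinearMap.inr ℝ ℝ (Vec n))) q)
    (hA : ∀ q ∈ S, HasFDerivAt A (D q) q) (hAR : ∀ q ∈ S, ‖A q‖ ≤ R) (hDR : ∀ q ∈ S, ‖D q‖ ≤ R)
    (hDL : ∀ q ∈ S, ∀ q' ∈ S, ‖D q' - D q‖ ≤ R * ‖q' - q‖)
    (hinj : ∀ q ∈ S, ∀ b, ‖b‖ ≤ R * ‖A q (0, b)‖) :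
    ConvexQuadEst (22 * K * R ^ 4) S (fun z => f (ψ z.1, A z.1 (1, z.2))) := by
  have hfd : ∀ q ∈ S, ∀ v b, fderiv ℝ (fun z : Vec n × Vec n => f (ψ z.1, A z.1 (1, z.2)))
      (q, v) (0, b) = fderiv ℝ f (ψ q, A q (1, v)) (0, A q (0, b)) := by
    intro q hq v b
    have hd := (h.toQuadEst.comp hK hR hSc hψB hψ hA hAR hDR hDL).diff q hq v
    have h1 : HasFDerivAt (fun w : Vec n => (q, w)) (ContinuousLinearMap.inr ℝ (Vec n) (Vec n)) v :=
      hasFDerivAt_prodMk_right q v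
    have h2 : HasFDerivAt (fun w : Vec n => (ψ q, A q (1, w)))
        ((0 : Vec n →L[ℝ] Vec n).prod ((A q).comp (ContinuousLinearMap.inr ℝ ℝ (Vec n)))) v :=
      (hasFDerivAt_const _ _).prodMk ((A q).hasFDerivAt.comp v (hasFDerivAt_prodMk_right 1 v))
    have h3 := (HasFDerivAt.comp v (g := fun z : Vec n × Vec n => f (ψ z.1, A z.1 (1, z.2)))
      (f := fun w => (q, w)) hd.hasFDerivAt h1).unique
      (HasFDerivAt.comp v (g := f) (h.diff (ψ q) (hψB q hq) (A q (1, v))).hasFDerivAt h2)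
    exact DFunLike.congr_fun h3 b
  -- At a fixed position the change of velocity is affine, so the monotonicity expression is that of
  -- `f` at the transformed velocities; the bound `hinj` then recovers `v - v'` from their
  -- difference.
  have hX : ∀ q ∈ S, ∀ v v', (fderiv ℝ (fun z : Vec n × Vec n => f (ψ z.1, A z.1 (1, z.2))) (q, v) -
      fderiv ℝ (fun z : Vec n × Vec n => f (ψ z.1, A z.1 (1, z.2))) (q, v')) (0, v - v') =
      (fderiv ℝ f (ψ q, A q (1, v)) - fderiv ℝ f (ψ q, A q (1, v')))
        (0, A q (1, v) - A q (1, v')) := by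
    intro q hq v v'
    rw [sub_apply, hfd q hq, hfd q hq, ← sub_apply, ← map_sub]
    simp
  refine ⟨h.toQuadEst.comp hK hR hSc hψB hψ hA hAR hDR hDL, fun q hq v v' => ?_,
    fun q hq v v' => ?_⟩
  · rw [hX q hq]
    exact h.monotone _ (hψB q hq) _ _
  · rw [hX q hq]
    have h1 := h.strict _ (hψB q hq) (A q (1, v)) (A q (1, v'))
    have h2 := hinj q hq (v - v')
    have e : A q (0, v - v') = A q (1, v) - A q (1, v') := by rw [← map_sub]; simp
    rw [e] at h2
    have h3 := h.monotone _ (hψB q hq) (A q (1, v)) (A q (1, v'))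
    set X := (fderiv ℝ f (ψ q, A q (1, v)) - fderiv ℝ f (ψ q, A q (1, v')))
        (0, A q (1, v) - A q (1, v'))
    calc ‖v - v'‖ ^ 2 ≤ (R * ‖A q (1, v) - A q (1, v')‖) ^ 2 := by gcongr
      _ = R ^ 2 * ‖A q (1, v) - A q (1, v')‖ ^ 2 := by ring
      _ ≤ R ^ 2 * (K * X) := by gcongr
      _ = 1 * K * R ^ 2 * X := by ring
      _ ≤ 22 * K * R ^ 4 * X := by gcongr <;> norm_num

end Convex

/-! ### Bounds up to the boundary times, and the Lagrangian in a chart of `M` -/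

section Bounds

variable {E F : Type*} [NormedAddCommGroup E] [NormedSpace ℝ E] [NormedAddCommGroup F]
  [NormedSpace ℝ F]

lemma fderivWithin_eventuallyEq_of_mem_interior {S : Set E} {f : E → F} {p : E}
    (hp : p ∈ interior S) : fderivWithin ℝ f S =ᶠ[𝓝 p] fderiv ℝ f := by
  filter_upwards [isOpen_interior.mem_nhds hp] with p' hp'
  exact fderivWithin_of_mem_nhds (mem_interior_iff_mem_nhds.1 hp')

/-- A function which is `C¹` up to the boundary is bounded together with its derivative. -/
lemma exists_bound_fderiv {S : Set E} (hS : UniqueDiffOn ℝ S) {f : E → F} {p₀ : E} (hp : p₀ ∈ S)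
    (hf : ContDiffWithinAt ℝ 1 f S p₀) :
    ∃ C, ∀ᶠ p in 𝓝[S] p₀, ‖f p‖ ≤ C ∧ (p ∈ interior S → ‖fderiv ℝ f p‖ ≤ C) := by
  have h1 : ContinuousWithinAt (fderivWithin ℝ f S) S p₀ :=
    (hf.fderivWithin_right hS (m := 0) (by simp) hp).continuousWithinAt
  refine ⟨max (‖f p₀‖ + 1) (‖fderivWithin ℝ f S p₀‖ + 1), ?_⟩
  filter_upwards [hf.continuousWithinAt.norm.eventually_lt_const (lt_add_one _),
    h1.norm.eventually_lt_const (lt_add_one _)] with p h2 h3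
  refine ⟨h2.le.trans (le_max_left _ _), fun h4 => ?_⟩
  rw [← (fderivWithin_eventuallyEq_of_mem_interior h4).self_of_nhds]
  exact h3.le.trans (le_max_right _ _)

end Bounds

section Local

variable {n : ℕ} {M : Type*} [TopologicalSpace M] [ChartedSpace (Vec n) M]
  [IsManifold (𝓡 n) ∞ M]

lemma contDiffAt_localLagrangian {L : ℝ × TangentBundle (𝓡 n) M → ℝ}
    (hL : ContMDiffOn (𝓘(ℝ, ℝ).prod (𝓡 n).tangent) 𝓘(ℝ, ℝ) 2 L (Icc (0 : ℝ) 1 ×ˢ univ)) (q₀ : M)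
    {t : ℝ} (ht : t ∈ Ioo (0 : ℝ) 1) {x : Vec n} (hx : x ∈ (extChartAt (𝓡 n) q₀).target)
    (v : Vec n) :
    ContDiffAt ℝ 2 (fun p : ℝ × (Vec n × Vec n) => localLagrangian L q₀ p.1 p.2.1 p.2.2)
      (t, (x, v)) :=
  (contDiffOn_localLagrangian hL q₀).contDiffAt
    (prod_mem_nhds (Icc_mem_nhds ht.1 ht.2)
      (prod_mem_nhds (mem_extChartAt_target_nhds q₀ hx) univ_mem))

lemma contDiffAt_localLagrangian_slice {L : ℝ × TangentBundle (𝓡 n) M → ℝ}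
    (hL : ContMDiffOn (𝓘(ℝ, ℝ).prod (𝓡 n).tangent) 𝓘(ℝ, ℝ) 2 L (Icc (0 : ℝ) 1 ×ˢ univ)) (q₀ : M)
    {t : ℝ} (ht : t ∈ Ioo (0 : ℝ) 1) {x : Vec n} (hx : x ∈ (extChartAt (𝓡 n) q₀).target)
    (v : Vec n) :
    ContDiffAt ℝ 2 (fun z : Vec n × Vec n => localLagrangian L q₀ t z.1 z.2) (x, v) :=
  ContDiffAt.comp (x, v) (g := fun p : ℝ × (Vec n × Vec n) => localLagrangian L q₀ p.1 p.2.1 p.2.2)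
    (contDiffAt_localLagrangian hL q₀ ht hx v) (contDiffAt_const.prodMk contDiffAt_id)

/-- Uniform convexity in local coordinates, in terms of first derivatives. -/
lemma chartMetric_le_fderiv_sub {g : RMetric n M} {L : ℝ × TangentBundle (𝓡 n) M → ℝ}
    (hL : ContMDiffOn (𝓘(ℝ, ℝ).prod (𝓡 n).tangent) 𝓘(ℝ, ℝ) 2 L (Icc (0 : ℝ) 1 ×ˢ univ)) (q₀ : M)
    {ℓ₀ : ℝ} (hℓ : ∀ t ∈ Icc (0 : ℝ) 1, ∀ (q : M) (v w : TangentSpace (𝓡 n) q),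
      ℓ₀ * g.inner q w w ≤ iteratedDeriv 2 (fun s : ℝ => L (t, ⟨q, v + s • w⟩)) 0)
    {t : ℝ} (ht : t ∈ Ioo (0 : ℝ) 1) {x : Vec n} (hx : x ∈ (extChartAt (𝓡 n) q₀).target)
    (v v' : Vec n) :
    ℓ₀ * chartMetric g q₀ x (v - v') (v - v') ≤
      (fderiv ℝ (fun z : Vec n × Vec n => localLagrangian L q₀ t z.1 z.2) (x, v) -
        fderiv ℝ (fun z : Vec n × Vec n => localLagrangian L q₀ t z.1 z.2) (x, v')) (0, v - v') := by
  set f := fun z : Vec n × Vec n => localLagrangian L q₀ t z.1 z.2 with hf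
  set w := v - v' with hw
  let φ : ℝ → ℝ := fun s => f (x, v' + s • w)
  have hc : ∀ s : ℝ, HasDerivAt (fun s : ℝ => (x, v' + s • w)) ((0 : Vec n), w) s := by
    intro s
    have := ((hasDerivAt_id s).smul_const w).const_add v'
    rw [one_smul] at this
    exact (hasDerivAt_const s x).prodMk this
  have hφ2 : ContDiff ℝ 2 φ := by
    rw [contDiff_iff_contDiffAt]
    intro s
    exact ContDiffAt.comp s (g := f) (contDiffAt_localLagrangian_slice hL q₀ ht hx _)
      (contDiffAt_const.prodMk (contDiffAt_const.add (contDiffAt_id.smul contDiffAt_const)))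
  have hφ' : ∀ s, HasDerivAt φ (fderiv ℝ f (x, v' + s • w) (0, w)) s := fun s =>
    HasFDerivAt.comp_hasDerivAt (l := f) s ((contDiffAt_localLagrangian_slice hL q₀ ht hx
      (v' + s • w)).differentiableAt (by simp)).hasFDerivAt (hc s)
  have hd1 : deriv φ = fun s => fderiv ℝ f (x, v' + s • w) (0, w) := funext fun s => (hφ' s).deriv
  have hd2 : ∀ s, ℓ₀ * chartMetric g q₀ x w w ≤ deriv (deriv φ) s := by
    intro s
    have h1 := hℓ t (Ioo_subset_Icc_self ht) ((extChartAt (𝓡 n) q₀).symm x)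
      (coordVec q₀ x (v' + s • w)) (coordVec q₀ x w)
    rw [chartMetric_apply]
    refine h1.trans_eq ?_
    -- The second derivative at `0` of the line starting from `v' + s w` is the second derivative of
    -- `φ` at `s`, by translation.
    have h2 : (fun r : ℝ => L (t, ⟨(extChartAt (𝓡 n) q₀).symm x,
        coordVec q₀ x (v' + s • w) + r • coordVec q₀ x w⟩)) = fun r => φ (r + s) := by
      funext r
      have : coordVec q₀ x (v' + s • w) + r • coordVec q₀ x w = coordVec q₀ x (v' + (r + s) • w) := by
        let A : Vec n →L[ℝ] Vec n := mfderiv 𝓘(ℝ, Vec n) (𝓡 n) (extChartAt (𝓡 n) q₀).symm x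
        have e : A (v' + s • w) + r • A w = A (v' + (r + s) • w) := by
          rw [add_smul, map_add, map_add, map_add, map_smul, map_smul]
          abel
        exact e
      rw [this]
      rfl
    rw [h2, iteratedDeriv_succ, iteratedDeriv_one]
    have h3 : deriv (fun r => φ (r + s)) = fun r => deriv φ (r + s) :=
      funext fun r => deriv_comp_add_const φ s r
    rw [h3, deriv_comp_add_const, zero_add]
  have hdiff : Differentiable ℝ (deriv φ) :=
    (hφ2.iterate_deriv' 1 1).differentiable (by simp)
  -- The mean value theorem for `φ'` on `[0,1]`: the increment `φ'(1) - φ'(0)` is the expression in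
  -- the statement.
  obtain ⟨ξ, -, hξ⟩ := exists_deriv_eq_slope (deriv φ) zero_lt_one
    hdiff.continuous.continuousOn hdiff.differentiableOn
  have h4 := hd2 ξ
  rw [hξ, hd1] at h4
  simpa [hw] using h4

lemma coordLength_eq (g : RMetric n M) (q₀ : M) (x v : Vec n) :
    coordLength g q₀ x v = Real.sqrt (chartMetric g q₀ x v v) := by
  rw [chartMetric_apply, coordLength]

/-- In the coordinates given by a chart of `M`, the Lagrangian satisfies uniform convex quadratic
growth estimates. -/
theorem exists_convexQuadEst_localLagrangian {g : RMetric n M} {L : ℝ × TangentBundle (𝓡 n) M → ℝ}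
    (hL : ContMDiffOn (𝓘(ℝ, ℝ).prod (𝓡 n).tangent) 𝓘(ℝ, ℝ) 2 L (Icc (0 : ℝ) 1 ×ˢ univ))
    (hL1 : IsUniformlyConvex g L) (hL2 : HasQuadraticBounds g L) (q₀ : M) {t₀ : ℝ}
    (ht₀ : t₀ ∈ Icc (0 : ℝ) 1) :
    ∃ K ≥ 0, ∃ r > 0, Metric.ball (extChartAt (𝓡 n) q₀ q₀) r ⊆ (extChartAt (𝓡 n) q₀).target ∧
      ∀ t ∈ Ioo (0 : ℝ) 1, |t - t₀| < r →
      ConvexQuadEst K (Metric.ball (extChartAt (𝓡 n) q₀ q₀) r)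
        (fun z => localLagrangian L q₀ t z.1 z.2) := by
  obtain ⟨ℓ₀, hℓ₀, hconv⟩ := hL1
  obtain ⟨ℓ₁, hℓ₁, hbd⟩ := hL2 q₀
  obtain ⟨c, hc, C, hC, hG⟩ := exists_chartMetric_bounds g q₀
  set x₀ := extChartAt (𝓡 n) q₀ q₀ with hx₀
  have hx₀t : x₀ ∈ (extChartAt (𝓡 n) q₀).target := mem_extChartAt_target q₀
  set S : Set (ℝ × (Vec n × Vec n)) := Icc (0 : ℝ) 1 ×ˢ ((extChartAt (𝓡 n) q₀).target ×ˢ univ)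
    with hS
  have hop : IsOpen ((extChartAt (𝓡 n) q₀).target ×ˢ (univ : Set (Vec n))) :=
    (isOpen_extChartAt_target q₀).prod isOpen_univ
  have hSu : UniqueDiffOn ℝ S := (uniqueDiffOn_Icc zero_lt_one).prod hop.uniqueDiffOn
  have hmem : (t₀, (x₀, (0 : Vec n))) ∈ S := ⟨ht₀, hx₀t, mem_univ _⟩
  obtain ⟨C₁, hC₁⟩ := exists_bound_fderiv hSu hmem
    ((contDiffOn_localLagrangian hL q₀ _ hmem).of_le one_le_two)
  rw [eventually_nhdsWithin_iff, Metric.eventually_nhds_iff_ball] at hC₁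
  obtain ⟨r₁, hr₁, hC₁⟩ := hC₁
  obtain ⟨r₂, hr₂, hbd⟩ := Metric.eventually_nhds_iff_ball.1 (hbd.and (hG.and
    (mem_extChartAt_target_nhds q₀ hx₀t)))
  set c₁ := Real.sqrt C
  have hc₁ : 0 ≤ c₁ := Real.sqrt_nonneg _
  -- The first entry serves the bounds on second derivatives once `|v|_q` is replaced by `c₁‖v‖`,
  -- the second bounds the Lagrangian and its differential at zero velocity, and the third is the
  -- inverse of the convexity constant.
  set K := max (max (ℓ₁ * (1 + c₁) ^ 2) C₁) (1 / (ℓ₀ * c)) with hK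
  have hK1 : ℓ₁ * (1 + c₁) ^ 2 ≤ K := (le_max_left _ _).trans (le_max_left _ _)
  have hK2 : C₁ ≤ K := (le_max_right _ _).trans (le_max_left _ _)
  have hK3 : 1 / (ℓ₀ * c) ≤ K := le_max_right _ _
  have hK0 : 0 ≤ K := le_trans (by positivity) hK3
  refine ⟨K, hK0, min r₁ r₂, by positivity, fun x hx => ?_, fun t ht htr => ?_⟩
  · exact (hbd x (Metric.ball_subset_ball (min_le_right _ _) hx)).2.2
  have hB2 : ∀ x ∈ Metric.ball x₀ (min r₁ r₂), x ∈ Metric.ball x₀ r₂ := fun x hx =>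
    Metric.ball_subset_ball (min_le_right _ _) hx
  have hlen : ∀ x ∈ Metric.ball x₀ (min r₁ r₂), ∀ v, coordLength g q₀ x v ≤ c₁ * ‖v‖ := by
    intro x hx v
    rw [coordLength_eq]
    refine (Real.sqrt_le_sqrt ((hbd x (hB2 x hx)).2.1 v).2).trans_eq ?_
    rw [Real.sqrt_mul hC.le, Real.sqrt_sq (norm_nonneg v)]
  have hlen0 : ∀ x v, 0 ≤ coordLength g q₀ x v := fun x v => Real.sqrt_nonneg _
  have hnear : ∀ x ∈ Metric.ball x₀ (min r₁ r₂), (t, (x, (0 : Vec n))) ∈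
      Metric.ball (t₀, (x₀, (0 : Vec n))) r₁ := by
    intro x hx
    rw [Metric.mem_ball, Prod.dist_eq, Prod.dist_eq, dist_self, Real.dist_eq]
    refine max_lt (htr.trans_le (min_le_left _ _)) (max_lt ?_ hr₁)
    exact (Metric.mem_ball.1 hx).trans_le (min_le_left _ _)
  have hint : ∀ x ∈ Metric.ball x₀ (min r₁ r₂), (t, (x, (0 : Vec n))) ∈ interior S := by
    intro x hx
    rw [hS, interior_prod_eq, hop.interior_eq, interior_Icc]
    exact ⟨ht, (hbd x (hB2 x hx)).2.2, mem_univ _⟩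
  refine ⟨quadEst_of_second_derivatives Metric.isOpen_ball (convex_ball _ _) hK0
    (fun x hx v => contDiffAt_localLagrangian_slice hL q₀ ht (hbd x (hB2 x hx)).2.2 v)
    (fun x hx v => ?_) (fun x hx v => ?_) (fun x hx v => ?_) (fun x hx => ?_) (fun x hx => ?_),
    fun x hx v v' => ?_, fun x hx v v' => ?_⟩
  · refine ((hbd x (hB2 x hx)).1 t (Ioo_subset_Icc_self ht) v).1.trans (le_trans ?_ hK1)
    have : 1 ≤ (1 + c₁) ^ 2 := by nlinarith
    nlinarith
  · refine ((hbd x (hB2 x hx)).1 t (Ioo_subset_Icc_self ht) v).2.1.trans ?_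
    calc ℓ₁ * (1 + coordLength g q₀ x v) ≤ ℓ₁ * ((1 + c₁) ^ 2 * (1 + ‖v‖)) := by
          gcongr
          have := hlen x hx v
          nlinarith [norm_nonneg v, mul_nonneg hc₁ (norm_nonneg v),
            mul_nonneg (sq_nonneg c₁) (norm_nonneg v)]
      _ = ℓ₁ * (1 + c₁) ^ 2 * (1 + ‖v‖) := by ring
      _ ≤ _ := by gcongr
  · refine ((hbd x (hB2 x hx)).1 t (Ioo_subset_Icc_self ht) v).2.2.trans ?_
    calc ℓ₁ * (1 + coordLength g q₀ x v ^ 2) ≤ ℓ₁ * (1 + (c₁ * ‖v‖) ^ 2) := by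
          gcongr
          · exact hlen0 x v
          · exact hlen x hx v
      _ ≤ ℓ₁ * ((1 + c₁) ^ 2 * (1 + ‖v‖) ^ 2) := by
          gcongr
          rw [← mul_pow]
          nlinarith [norm_nonneg v, mul_nonneg hc₁ (norm_nonneg v)]
      _ = ℓ₁ * (1 + c₁) ^ 2 * (1 + ‖v‖) ^ 2 := by ring
      _ ≤ _ := by gcongr
  · exact ((hC₁ _ (hnear x hx) (interior_subset (hint x hx))).1).trans hK2
  · have h1 := ((hC₁ _ (hnear x hx) (interior_subset (hint x hx))).2 (hint x hx)).trans hK2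
    have h2 : HasFDerivAt (fun z : Vec n × Vec n => (t, z))
        (ContinuousLinearMap.inr ℝ ℝ (Vec n × Vec n)) (x, (0 : Vec n)) :=
      hasFDerivAt_prodMk_right t _
    have h3 := ((contDiffAt_localLagrangian hL q₀ ht (hbd x (hB2 x hx)).2.2 0).differentiableAt
      (by simp)).hasFDerivAt
    have h4 := (HasFDerivAt.comp (x, (0 : Vec n)) (f := fun z : Vec n × Vec n => (t, z)) h3 h2).fderiv
    change ‖fderiv ℝ ((fun p : ℝ × (Vec n × Vec n) => localLagrangian L q₀ p.1 p.2.1 p.2.2) ∘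
      fun z : Vec n × Vec n => (t, z)) (x, 0)‖ ≤ K
    rw [h4]
    refine ContinuousLinearMap.opNorm_le_bound _ hK0 fun z => ?_
    refine (ContinuousLinearMap.le_of_opNorm_le _ h1 _).trans_eq ?_
    simp [Prod.norm_mk]
  · refine le_trans ?_ (chartMetric_le_fderiv_sub hL q₀ hconv ht (hbd x (hB2 x hx)).2.2 v v')
    exact mul_nonneg hℓ₀.le (chartMetric_nonneg g q₀ (hbd x (hB2 x hx)).2.2 _)
  · have h1 := chartMetric_le_fderiv_sub hL q₀ hconv ht (hbd x (hB2 x hx)).2.2 v v'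
    have h2 := ((hbd x (hB2 x hx)).2.1 (v - v')).1
    have h3 := mul_le_mul_of_nonneg_left h2 hℓ₀.le
    have h4 := h3.trans h1
    have h5 : ‖v - v'‖ ^ 2 ≤ 1 / (ℓ₀ * c) *
        (fderiv ℝ (fun z : Vec n × Vec n => localLagrangian L q₀ t z.1 z.2) (x, v) -
        fderiv ℝ (fun z : Vec n × Vec n => localLagrangian L q₀ t z.1 z.2) (x, v')) (0, v - v') := by
      rw [one_div, ← div_eq_inv_mul, le_div_iff₀ (by positivity)]
      refine le_trans (le_of_eq ?_) h4
      ring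
    refine h5.trans (mul_le_mul_of_nonneg_right hK3 (le_trans ?_ h4))
    positivity

end Local

lemma eq_of_totalSpace_mk_eq {n : ℕ} {M : Type*} [TopologicalSpace M] [ChartedSpace (Vec n) M]
    {x y : M} {v : TangentSpace (𝓡 n) x} {w : TangentSpace (𝓡 n) y}
    (h : (⟨x, v⟩ : TangentBundle (𝓡 n) M) = ⟨y, w⟩) : (v : Vec n) = (w : Vec n) := by
  have h1 := TotalSpace.mk.inj h
  exact eq_of_heq h1.2

/-- Injectivity of linear maps is stable under perturbations, with uniform constants. -/
lemma exists_bound_of_injective {X E F : Type*} [TopologicalSpace X] [NormedAddCommGroup E]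
    [NormedSpace ℝ E] [FiniteDimensional ℝ E] [NormedAddCommGroup F] [NormedSpace ℝ F] {S : Set X}
    {A : X → E →L[ℝ] F} {x₀ : X} (hA : ContinuousWithinAt A S x₀)
    (hinj : ∀ b, A x₀ b = 0 → b = 0) :
    ∃ R, 1 ≤ R ∧ ∀ᶠ x in 𝓝[S] x₀, ∀ b, ‖b‖ ≤ R * ‖A x b‖ := by
  obtain ⟨K, hK, hKA⟩ := LinearMap.exists_antilipschitzWith (A x₀ : E →ₗ[ℝ] F)
    (LinearMap.ker_eq_bot'.2 hinj)
  have h1 : ∀ b, ‖b‖ ≤ K * ‖A x₀ b‖ := fun b => by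
    simpa using hKA.le_mul_dist b 0
  have hK' : (0 : ℝ) < K := hK
  refine ⟨max 1 (2 * K), le_max_left _ _, ?_⟩
  -- With this threshold the perturbation absorbs half of `‖b‖`, which is why the final constant is
  -- `2K`.
  have h2 : ∀ᶠ x in 𝓝[S] x₀, ‖A x - A x₀‖ < 1 / (2 * K) := by
    have : Tendsto (fun x => ‖A x - A x₀‖) (𝓝[S] x₀) (𝓝 ‖A x₀ - A x₀‖) :=
      (hA.sub (continuousWithinAt_const (b := A x₀))).norm
    rw [sub_self, norm_zero] at this
    exact this.eventually_lt_const (by positivity)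
  filter_upwards [h2] with x hx b
  have h3 := (A x - A x₀).le_of_opNorm_le hx.le b
  have h4 : ‖A x₀ b‖ ≤ ‖A x b‖ + ‖(A x - A x₀) b‖ := by
    have : A x₀ b = A x b - (A x - A x₀) b := by simp
    rw [this]
    exact norm_sub_le _ _
  have h5 : ‖b‖ ≤ 2 * K * ‖A x b‖ := by
    have h6 := (h1 b).trans (mul_le_mul_of_nonneg_left (h4.trans (add_le_add_right h3 _)) hK'.le)
    have h7 : (K : ℝ) * (‖A x b‖ + 1 / (2 * K) * ‖b‖) = K * ‖A x b‖ + ‖b‖ / 2 := by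
      field_simp
    linarith
  exact h5.trans (by gcongr; exact le_max_right _ _)

/-! ### The Lagrangian in a time dependent coordinate system -/

namespace PathChart

variable {n : ℕ} {M : Type*} [TopologicalSpace M] [ChartedSpace (Vec n) M]

/-- The map `(t, q) ↦ φ(t, q)`. -/
def hat (κ : PathChart n M) (p : ℝ × Vec n) : M := κ.φ p.1 p.2

lemma contMDiffOn_hat (κ : PathChart n M) :
    ContMDiffOn 𝓘(ℝ, ℝ × Vec n) (𝓡 n) ∞ κ.hat (Icc (0 : ℝ) 1 ×ˢ κ.U) := by
  have := κ.smooth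
  rw [← modelWithCornersSelf_prod, chartedSpaceSelf_prod] at this
  exact this

lemma uniqueDiffOn (κ : PathChart n M) : UniqueDiffOn ℝ (Icc (0 : ℝ) 1 ×ˢ κ.U) :=
  (uniqueDiffOn_Icc zero_lt_one).prod κ.isOpen_U.uniqueDiffOn

lemma domain_mem_nhds (κ : PathChart n M) {t : ℝ} (ht : t ∈ Ioo (0 : ℝ) 1) {q : Vec n}
    (hq : q ∈ κ.U) : Icc (0 : ℝ) 1 ×ˢ κ.U ∈ 𝓝 (t, q) :=
  prod_mem_nhds (Icc_mem_nhds ht.1 ht.2) (κ.isOpen_U.mem_nhds hq)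

lemma contMDiffAt_hat (κ : PathChart n M) {t : ℝ} (ht : t ∈ Ioo (0 : ℝ) 1) {q : Vec n}
    (hq : q ∈ κ.U) : ContMDiffAt 𝓘(ℝ, ℝ × Vec n) (𝓡 n) ∞ κ.hat (t, q) :=
  κ.contMDiffOn_hat.contMDiffAt (κ.domain_mem_nhds ht hq)

lemma mdifferentiableAt_hat (κ : PathChart n M) {t : ℝ} (ht : t ∈ Ioo (0 : ℝ) 1) {q : Vec n}
    (hq : q ∈ κ.U) : MDifferentiableAt 𝓘(ℝ, ℝ × Vec n) (𝓡 n) κ.hat (t, q) :=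
  (κ.contMDiffAt_hat ht hq).mdifferentiableAt (by simp)

lemma mdifferentiableAt_φ (κ : PathChart n M) {t : ℝ} (ht : t ∈ Icc (0 : ℝ) 1) {q : Vec n}
    (hq : q ∈ κ.U) : MDifferentiableAt 𝓘(ℝ, Vec n) (𝓡 n) (κ.φ t) q := by
  have h1 : ContMDiffOn 𝓘(ℝ, Vec n) (𝓡 n) ∞ (κ.hat ∘ fun q => (t, q)) κ.U :=
    κ.contMDiffOn_hat.comp (contMDiff_iff_contDiff.2
      (contDiff_const.prodMk contDiff_id)).contMDiffOn fun q hq => ⟨ht, hq⟩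
  exact (h1.contMDiffAt (κ.isOpen_U.mem_nhds hq)).mdifferentiableAt (by simp)

/-- The map `(t, q) ↦ φ(t, q)` in the chart of `M` at `q₁`. -/
def rep (κ : PathChart n M) (q₁ : M) (p : ℝ × Vec n) : Vec n := extChartAt (𝓡 n) q₁ (κ.hat p)

variable [IsManifold (𝓡 n) ∞ M]

lemma contDiffWithinAt_rep (κ : PathChart n M) {q₁ : M} {p : ℝ × Vec n}
    (hp : p ∈ Icc (0 : ℝ) 1 ×ˢ κ.U) (hq : κ.hat p ∈ (extChartAt (𝓡 n) q₁).source) :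
    ContDiffWithinAt ℝ ∞ (κ.rep q₁) (Icc (0 : ℝ) 1 ×ˢ κ.U) p := by
  rw [extChartAt_source] at hq
  have h1 : ContMDiffAt (𝓡 n) 𝓘(ℝ, Vec n) ∞ (extChartAt (𝓡 n) q₁) (κ.hat p) :=
    contMDiffAt_extChartAt' hq
  exact (h1.comp_contMDiffWithinAt p (κ.contMDiffOn_hat p hp)).contDiffWithinAt

lemma contDiffAt_rep (κ : PathChart n M) {q₁ : M} {t : ℝ} (ht : t ∈ Ioo (0 : ℝ) 1) {q : Vec n}
    (hq : q ∈ κ.U) (hs : κ.hat (t, q) ∈ (extChartAt (𝓡 n) q₁).source) :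
    ContDiffAt ℝ ∞ (κ.rep q₁) (t, q) :=
  (κ.contDiffWithinAt_rep ⟨Ioo_subset_Icc_self ht, hq⟩ hs).contDiffAt (κ.domain_mem_nhds ht hq)

/-- The spatial derivative of `κ.rep q₁` is injective. -/
lemma injective_fderivWithin_rep (κ : PathChart n M) {q₁ : M} {t : ℝ} (ht : t ∈ Icc (0 : ℝ) 1)
    {q : Vec n} (hq : q ∈ κ.U) (hs : κ.hat (t, q) ∈ (extChartAt (𝓡 n) q₁).source) {b : Vec n}
    (hb : fderivWithin ℝ (κ.rep q₁) (Icc (0 : ℝ) 1 ×ˢ κ.U) (t, q) (0, b) = 0) : b = 0 := by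
  have h1 : HasFDerivWithinAt (fun q => κ.rep q₁ (t, q))
      ((fderivWithin ℝ (κ.rep q₁) (Icc (0 : ℝ) 1 ×ˢ κ.U) (t, q)).comp
        (ContinuousLinearMap.inr ℝ ℝ (Vec n))) κ.U q :=
    (((κ.contDiffWithinAt_rep ⟨ht, hq⟩ hs).differentiableWithinAt
      (by simp)).hasFDerivWithinAt).comp q
      (hasFDerivAt_prodMk_right t q).hasFDerivWithinAt fun q hq => ⟨ht, hq⟩
  have h2 := (h1.hasFDerivAt (κ.isOpen_U.mem_nhds hq)).fderiv
  have h3 := eq_of_totalSpace_mk_eq (mk_mfderiv_eq_coordVec (κ.mdifferentiableAt_φ ht hq) q₁ hs b)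
  change fderiv ℝ (fun p => extChartAt (𝓡 n) q₁ (κ.φ t p)) q = _ at h2
  have h4 : fderiv ℝ (fun p => extChartAt (𝓡 n) q₁ (κ.φ t p)) q b = 0 := by
    rw [h2]; exact hb
  rw [h4] at h3
  refine (κ.bijective_mfderiv t ht q hq).1 (Eq.trans h3 ?_)
  exact (map_zero (mfderiv 𝓘(ℝ, Vec n) (𝓡 n) (extChartAt (𝓡 n) q₁).symm _)).trans
    (map_zero (mfderiv 𝓘(ℝ, Vec n) (𝓡 n) (κ.φ t) q)).symm

/-- The Lagrangian in the coordinates given by `κ`. -/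
def lagr (κ : PathChart n M) (L : ℝ × TangentBundle (𝓡 n) M → ℝ) (t : ℝ) (z : Vec n × Vec n) : ℝ :=
  L (t, ⟨κ.hat (t, z.1), mfderiv 𝓘(ℝ, ℝ × Vec n) (𝓡 n) κ.hat (t, z.1) (1, z.2)⟩)

lemma lagr_eq (κ : PathChart n M) (L : ℝ × TangentBundle (𝓡 n) M → ℝ) {q₁ : M} {t : ℝ}
    (ht : t ∈ Ioo (0 : ℝ) 1) {q : Vec n} (hq : q ∈ κ.U)
    (hs : κ.hat (t, q) ∈ (extChartAt (𝓡 n) q₁).source) (v : Vec n) :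
    κ.lagr L t (q, v) =
      localLagrangian L q₁ t (κ.rep q₁ (t, q)) (fderiv ℝ (κ.rep q₁) (t, q) (1, v)) := by
  rw [lagr, mk_mfderiv_eq_coordVec (κ.mdifferentiableAt_hat ht hq) q₁ hs]
  rfl

/-- In the chart of `M` at `φ(t₀, q₀)`, the map `κ.rep` is a change of variables as in
`ConvexQuadEst.comp`, with velocity `D(κ.rep)(1, v)`. It is smooth up to the boundary times and its
spatial differential is injective, so all the constants required are uniform near `(t₀, q₀)`. -/
theorem exists_convexQuadEst_lagr (κ : PathChart n M) {g : RMetric n M}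
    {L : ℝ × TangentBundle (𝓡 n) M → ℝ}
    (hL : ContMDiffOn (𝓘(ℝ, ℝ).prod (𝓡 n).tangent) 𝓘(ℝ, ℝ) 2 L (Icc (0 : ℝ) 1 ×ˢ univ))
    (hL1 : IsUniformlyConvex g L) (hL2 : HasQuadraticBounds g L) {t₀ : ℝ}
    (ht₀ : t₀ ∈ Icc (0 : ℝ) 1) {q₀ : Vec n} (hq₀ : q₀ ∈ κ.U) :
    ∃ C, ∃ r > 0, ∀ t ∈ Ioo (0 : ℝ) 1, |t - t₀| < r →
      ConvexQuadEst C (Metric.ball q₀ r) (κ.lagr L t) := by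
  set q₁ := κ.hat (t₀, q₀) with hq₁
  set S := Icc (0 : ℝ) 1 ×ˢ κ.U with hS
  have hmem : (t₀, q₀) ∈ S := ⟨ht₀, hq₀⟩
  have hSu : UniqueDiffOn ℝ S := κ.uniqueDiffOn
  have hsrc : κ.hat (t₀, q₀) ∈ (extChartAt (𝓡 n) q₁).source := mem_extChartAt_source q₁
  obtain ⟨K, hK, r₀, hr₀, hball, hest⟩ :=
    exists_convexQuadEst_localLagrangian hL hL1 hL2 q₁ ht₀
  have c0 := κ.contDiffWithinAt_rep hmem hsrc
  set f1 := fderivWithin ℝ (κ.rep q₁) S with hf1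
  have c1 : ContDiffWithinAt ℝ ∞ f1 S (t₀, q₀) := c0.fderivWithin_right hSu (by simp) hmem
  set f2 := fderivWithin ℝ f1 S with hf2
  have c2 : ContDiffWithinAt ℝ ∞ f2 S (t₀, q₀) := c1.fderivWithin_right hSu (by simp) hmem
  have h1le : (1 : WithTop ℕ∞) ≤ (∞ : WithTop ℕ∞) := one_le_two.trans two_le_infty
  -- Three derivatives are needed: the first two bound `A` and `D` in `ConvexQuadEst.comp`, and the
  -- third gives the Lipschitz constant of `D`.
  obtain ⟨C₁, hC₁⟩ := exists_bound_fderiv hSu hmem (c0.of_le h1le)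
  obtain ⟨C₂, hC₂⟩ := exists_bound_fderiv hSu hmem (c1.of_le h1le)
  obtain ⟨C₃, hC₃⟩ := exists_bound_fderiv hSu hmem (c2.of_le h1le)
  obtain ⟨R₀, hR₀, hinj⟩ := exists_bound_of_injective
    (A := fun p => (f1 p).comp (ContinuousLinearMap.inr ℝ ℝ (Vec n)))
    (c1.continuousWithinAt.clm_comp continuousWithinAt_const)
    (fun b hb => κ.injective_fderivWithin_rep ht₀ hq₀ hsrc hb)
  have hev : ∀ᶠ p in 𝓝[S] (t₀, q₀), κ.hat p ∈ (extChartAt (𝓡 n) q₁).source ∧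
      κ.rep q₁ p ∈ Metric.ball (extChartAt (𝓡 n) q₁ q₁) r₀ := by
    refine ((κ.contMDiffOn_hat _ hmem).continuousWithinAt.eventually
      (extChartAt_source_mem_nhds (I := 𝓡 n) q₁)).and ?_
    exact c0.continuousWithinAt.eventually (Metric.ball_mem_nhds _ hr₀)
  obtain ⟨r₁, hr₁, hr₁U⟩ := Metric.isOpen_iff.1 κ.isOpen_U q₀ hq₀
  obtain ⟨r₂, hr₂, hall⟩ := Metric.eventually_nhds_iff_ball.1
    (eventually_nhdsWithin_iff.1 (hC₁.and (hC₂.and (hC₃.and (hinj.and hev)))))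
  set R := max R₀ (max C₁ (max C₂ C₃)) with hR
  have hR1 : 1 ≤ R := hR₀.trans (le_max_left _ _)
  refine ⟨22 * K * R ^ 4, min r₀ (min r₁ r₂), by positivity, fun t ht htr => ?_⟩
  set B := Metric.ball q₀ (min r₀ (min r₁ r₂)) with hB
  have hBU : ∀ q ∈ B, q ∈ κ.U := fun q hq => hr₁U
    (Metric.ball_subset_ball ((min_le_right _ _).trans (min_le_left _ _)) hq)
  have hint : ∀ q ∈ B, (t, q) ∈ interior S := fun q hq =>
    mem_interior_iff_mem_nhds.2 (κ.domain_mem_nhds ht (hBU q hq))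
  have hin : ∀ q ∈ B, (t, q) ∈ Metric.ball (t₀, q₀) r₂ := by
    intro q hq
    rw [Metric.mem_ball, Prod.dist_eq, Real.dist_eq]
    have : min r₀ (min r₁ r₂) ≤ r₂ := (min_le_right _ _).trans (min_le_right _ _)
    exact max_lt (htr.trans_le this) ((Metric.mem_ball.1 hq).trans_le this)
  have hfacts := fun q hq => hall (t, q) (hin q hq) (interior_subset (hint q hq))
  have hcd : ∀ q ∈ B, ContDiffAt ℝ ∞ (κ.rep q₁) (t, q) := fun q hq =>
    κ.contDiffAt_rep ht (hBU q hq) (hfacts q hq).2.2.2.2.1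
  have hcd1 : ∀ q ∈ B, ContDiffAt ℝ ∞ (fderiv ℝ (κ.rep q₁)) (t, q) := fun q hq =>
    (hcd q hq).fderiv_right (by simp)
  have hcd2 : ∀ q ∈ B, ContDiffAt ℝ ∞ (fderiv ℝ (fderiv ℝ (κ.rep q₁))) (t, q) := fun q hq =>
    (hcd1 q hq).fderiv_right (by simp)
  have he1 : ∀ q ∈ B, f1 =ᶠ[𝓝 (t, q)] fderiv ℝ (κ.rep q₁) := fun q hq =>
    fderivWithin_eventuallyEq_of_mem_interior (hint q hq)
  have he2 : ∀ q ∈ B, f2 =ᶠ[𝓝 (t, q)] fderiv ℝ (fderiv ℝ (κ.rep q₁)) := fun q hq =>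
    (fderivWithin_eventuallyEq_of_mem_interior (hint q hq)).trans (he1 q hq).fderiv
  have hd1 : ∀ q ∈ B, ‖fderiv ℝ (κ.rep q₁) (t, q)‖ ≤ R := fun q hq =>
    ((hfacts q hq).1.2 (hint q hq)).trans ((le_max_left _ _).trans (le_max_right _ _))
  have hd2 : ∀ q ∈ B, ‖fderiv ℝ (fderiv ℝ (κ.rep q₁)) (t, q)‖ ≤ R := fun q hq => by
    rw [← (he1 q hq).fderiv_eq]
    exact ((hfacts q hq).2.1.2 (hint q hq)).trans
      ((le_max_left _ _).trans ((le_max_right _ _).trans (le_max_right _ _)))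
  have hd3 : ∀ q ∈ B, ‖fderiv ℝ (fderiv ℝ (fderiv ℝ (κ.rep q₁))) (t, q)‖ ≤ R := fun q hq => by
    rw [← (he2 q hq).fderiv_eq]
    exact ((hfacts q hq).2.2.1.2 (hint q hq)).trans
      ((le_max_right _ _).trans ((le_max_right _ _).trans (le_max_right _ _)))
  have hslice : ∀ q : Vec n, HasFDerivAt (fun q : Vec n => (t, q))
      (ContinuousLinearMap.inr ℝ ℝ (Vec n)) q := fun q => hasFDerivAt_prodMk_right t q
  have hinr : ‖ContinuousLinearMap.inr ℝ ℝ (Vec n)‖ ≤ 1 :=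
    ContinuousLinearMap.opNorm_le_bound _ zero_le_one fun b => by simp [Prod.norm_mk]
  have hcomp : ConvexQuadEst (22 * K * R ^ 4) B
      (fun z => localLagrangian L q₁ t (κ.rep q₁ (t, z.1)) (fderiv ℝ (κ.rep q₁) (t, z.1) (1, z.2))) :=
    ConvexQuadEst.comp hK hR1
      (hest t ht (htr.trans_le (min_le_left _ _))) (S := B) (ψ := fun q => κ.rep q₁ (t, q))
      (A := fun q => fderiv ℝ (κ.rep q₁) (t, q))
      (D := fun q => (fderiv ℝ (fderiv ℝ (κ.rep q₁)) (t, q)).comp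
        (ContinuousLinearMap.inr ℝ ℝ (Vec n)))
      (convex_ball _ _) (fun q hq => (hfacts q hq).2.2.2.2.2)
      (fun q hq => HasFDerivAt.comp q ((hcd q hq).differentiableAt (by simp)).hasFDerivAt (hslice q))
      (fun q hq => HasFDerivAt.comp q ((hcd1 q hq).differentiableAt (by simp)).hasFDerivAt
        (hslice q))
      hd1
      (fun q hq => (ContinuousLinearMap.opNorm_comp_le _ _).trans
        ((mul_le_of_le_one_right (norm_nonneg _) hinr).trans (hd2 q hq)))
      (fun q hq q' hq' => by
        have h1 := (convex_ball q₀ (min r₀ (min r₁ r₂))).norm_image_sub_le_of_norm_hasFDerivWithin_le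
          (f := fun q => fderiv ℝ (fderiv ℝ (κ.rep q₁)) (t, q)) (C := R)
          (fun q hq => (HasFDerivAt.comp q ((hcd2 q hq).differentiableAt (by simp)).hasFDerivAt
            (hslice q)).hasFDerivWithinAt)
          (fun q hq => (ContinuousLinearMap.opNorm_comp_le _ _).trans
            ((mul_le_of_le_one_right (norm_nonneg _) hinr).trans (hd3 q hq))) hq hq'
        rw [← ContinuousLinearMap.sub_comp]
        exact (ContinuousLinearMap.opNorm_comp_le _ _).trans
          ((mul_le_of_le_one_right (norm_nonneg _) hinr).trans h1))
      (fun q hq b => by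
        have h1 := (hfacts q hq).2.2.2.1 b
        rw [(he1 q hq).self_of_nhds] at h1
        refine h1.trans ?_
        gcongr
        · exact le_max_left _ _
        · rfl)
  exact hcomp.congr Metric.isOpen_ball fun q hq v =>
    κ.lagr_eq L ht (hBU q hq) (hfacts q hq).2.2.2.2.1 v

lemma contDiffAt_lagr (κ : PathChart n M) {L : ℝ × TangentBundle (𝓡 n) M → ℝ}
    (hL : ContMDiffOn (𝓘(ℝ, ℝ).prod (𝓡 n).tangent) 𝓘(ℝ, ℝ) 2 L (Icc (0 : ℝ) 1 ×ˢ univ)) {t : ℝ}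
    (ht : t ∈ Ioo (0 : ℝ) 1) {q : Vec n} (hq : q ∈ κ.U) (v : Vec n) :
    ContDiffAt ℝ 2 (fun p : ℝ × (Vec n × Vec n) => κ.lagr L p.1 p.2) (t, (q, v)) := by
  set q₁ := κ.hat (t, q) with hq₁
  have hsrc : κ.hat (t, q) ∈ (extChartAt (𝓡 n) q₁).source := mem_extChartAt_source q₁
  have hc := κ.contDiffAt_rep ht hq hsrc
  have hc1 : ContDiffAt ℝ ∞ (fderiv ℝ (κ.rep q₁)) (t, q) := hc.fderiv_right (by simp)
  have hpr : ContDiffAt ℝ 2 (fun p : ℝ × (Vec n × Vec n) => (p.1, p.2.1)) (t, (q, v)) := by fun_prop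
  have h1 : ContDiffAt ℝ 2 (fun p : ℝ × (Vec n × Vec n) => (p.1, (κ.rep q₁ (p.1, p.2.1),
      fderiv ℝ (κ.rep q₁) (p.1, p.2.1) (1, p.2.2)))) (t, (q, v)) := by
    refine contDiffAt_fst.prodMk (ContDiffAt.prodMk ?_ (ContDiffAt.clm_apply ?_ ?_))
    · exact ContDiffAt.comp (t, (q, v)) (g := κ.rep q₁) (hc.of_le two_le_infty) hpr
    · exact (hc1.of_le two_le_infty).comp (t, (q, v)) hpr
    · exact contDiffAt_const.prodMk contDiffAt_snd.snd
  have h2 := (contDiffAt_localLagrangian hL q₁ ht ((extChartAt (𝓡 n) q₁).map_source hsrc)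
    (fderiv ℝ (κ.rep q₁) (t, q) (1, v))).comp (t, (q, v)) h1
  refine h2.congr_of_eventuallyEq ?_
  have h3 : ∀ᶠ p : ℝ × (Vec n × Vec n) in 𝓝 (t, (q, v)), (p.1 ∈ Ioo (0 : ℝ) 1 ∧ p.2.1 ∈ κ.U) ∧
      κ.hat (p.1, p.2.1) ∈ (extChartAt (𝓡 n) q₁).source := by
    refine Filter.Eventually.and ?_ ?_
    · exact (continuousAt_fst.eventually_mem (Ioo_mem_nhds ht.1 ht.2)).and
        (continuousAt_snd.fst.eventually_mem (κ.isOpen_U.mem_nhds hq))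
    · exact (ContinuousAt.comp (x := (t, (q, v))) (g := κ.hat)
        (κ.contMDiffAt_hat ht hq).continuousAt hpr.continuousAt).eventually_mem
        (extChartAt_source_mem_nhds (I := 𝓡 n) q₁)
  filter_upwards [h3] with p hp
  exact κ.lagr_eq L hp.1.1 hp.1.2 hp.2 p.2.2

lemma continuousOn_lagr (κ : PathChart n M) {L : ℝ × TangentBundle (𝓡 n) M → ℝ}
    (hL : ContMDiffOn (𝓘(ℝ, ℝ).prod (𝓡 n).tangent) 𝓘(ℝ, ℝ) 2 L (Icc (0 : ℝ) 1 ×ˢ univ)) :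
    ContinuousOn (fun p : ℝ × (Vec n × Vec n) => κ.lagr L p.1 p.2) (Ioo 0 1 ×ˢ (κ.U ×ˢ univ)) :=
  fun p hp => (κ.contDiffAt_lagr hL hp.1 hp.2.1 p.2.2).continuousAt.continuousWithinAt

lemma continuousOn_fderiv_lagr (κ : PathChart n M) {L : ℝ × TangentBundle (𝓡 n) M → ℝ}
    (hL : ContMDiffOn (𝓘(ℝ, ℝ).prod (𝓡 n).tangent) 𝓘(ℝ, ℝ) 2 L (Icc (0 : ℝ) 1 ×ˢ univ)) :
    ContinuousOn (fun p : ℝ × (Vec n × Vec n) => fderiv ℝ (κ.lagr L p.1) p.2)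
      (Ioo 0 1 ×ˢ (κ.U ×ˢ univ)) := by
  have h1 : ContinuousOn (fun p : ℝ × (Vec n × Vec n) =>
      (fderiv ℝ (fun p : ℝ × (Vec n × Vec n) => κ.lagr L p.1 p.2) p).comp
        (ContinuousLinearMap.inr ℝ ℝ (Vec n × Vec n))) (Ioo 0 1 ×ˢ (κ.U ×ˢ univ)) := by
    refine ContinuousOn.clm_comp (fun p hp => ?_) continuousOn_const
    exact ((κ.contDiffAt_lagr hL hp.1 hp.2.1 p.2.2).fderiv_right (m := 1)
      (by norm_num)).continuousAt.continuousWithinAt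
  refine h1.congr fun p hp => ?_
  exact (HasFDerivAt.comp p.2 (g := fun p : ℝ × (Vec n × Vec n) => κ.lagr L p.1 p.2)
    (f := fun z => (p.1, z)) ((κ.contDiffAt_lagr hL hp.1 hp.2.1 p.2.2).differentiableAt
      (by simp)).hasFDerivAt (hasFDerivAt_prodMk_right p.1 p.2)).fderiv

end PathChart

/-! ### The action in the coordinates `φ_*` -/

section Velocity

variable {n : ℕ} {M : Type*} [TopologicalSpace M] [ChartedSpace (Vec n) M]
  [IsManifold (𝓡 n) ∞ M]

lemma mk_velocity_congr {c c' : ℝ → M} {t : ℝ} (h : c =ᶠ[𝓝 t] c') :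
    (⟨c t, velocity c t⟩ : TangentBundle (𝓡 n) M) = ⟨c' t, velocity c' t⟩ := by
  refine totalSpace_mk_eq h.eq_of_nhds ?_
  have := h.mfderiv_eq (I := 𝓘(ℝ, ℝ)) (I' := 𝓡 n)
  exact congrArg (fun A : ℝ →L[ℝ] Vec n => A 1) this

lemma actionIntegrand_congr (L : ℝ × TangentBundle (𝓡 n) M → ℝ) {c c' : ℝ → M} {t : ℝ}
    (h : c =ᶠ[𝓝 t] c') : actionIntegrand L c t = actionIntegrand L c' t := by
  rw [actionIntegrand, actionIntegrand, mk_velocity_congr h]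

/-- At an interior time the velocity depends only on the values of the curve in `[0,1]`; the
extension of a curve to `ℝ` is therefore immaterial. -/
lemma action_congr (L : ℝ × TangentBundle (𝓡 n) M → ℝ) {c c' : ℝ → M}
    (h : ∀ t ∈ Icc (0 : ℝ) 1, c t = c' t) : action L c = action L c' := by
  rw [action, action, intervalIntegral_eq_mu01, intervalIntegral_eq_mu01]
  refine integral_congr_ae ?_
  filter_upwards [ae_mu01_Ioo] with t ht
  refine actionIntegrand_congr L ?_
  filter_upwards [Icc_mem_nhds ht.1 ht.2] with s hs using h s hs

end Velocity

namespace PathChart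

variable {n : ℕ} {M : Type*} [TopologicalSpace M] [ChartedSpace (Vec n) M]

lemma velocity_curve (κ : PathChart n M) {u : W12 n} (hu : u ∈ κ.dom) {t : ℝ}
    (ht : t ∈ Ioo (0 : ℝ) 1) {v : Vec n} (hv : HasDerivAt u v t) :
    MDifferentiableAt 𝓘(ℝ, ℝ) (𝓡 n) (κ.curve u) t ∧
    (velocity (κ.curve u) t : Vec n) =
      mfderiv 𝓘(ℝ, ℝ × Vec n) (𝓡 n) κ.hat (t, u t) (1, v) := by
  have hd := κ.mdifferentiableAt_hat ht (hu t (Ioo_subset_Icc_self ht))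
  have h1 : HasFDerivAt (fun t => (t, u t))
      ((ContinuousLinearMap.id ℝ ℝ).prod (ContinuousLinearMap.toSpanSingleton ℝ v)) t :=
    (hasFDerivAt_id t).prodMk hv.hasFDerivAt
  have h2 := HasMFDerivAt.comp (I := 𝓘(ℝ, ℝ)) (I' := 𝓘(ℝ, ℝ × Vec n)) (I'' := 𝓡 n) t (g := κ.hat)
    (f := fun t => (t, u t)) hd.hasMFDerivAt h1.hasMFDerivAt
  refine ⟨h2.mdifferentiableAt, ?_⟩
  have h3 := h2.mfderiv
  rw [velocity]
  refine (congrArg (fun A : ℝ →L[ℝ] Vec n => A 1) h3).trans ?_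
  let B : ℝ × Vec n →L[ℝ] Vec n := mfderiv 𝓘(ℝ, ℝ × Vec n) (𝓡 n) κ.hat (t, u t)
  change B (1, (1 : ℝ) • v) = B (1, v)
  rw [one_smul]

variable [IsManifold (𝓡 n) ∞ M] {L : ℝ × TangentBundle (𝓡 n) M → ℝ}

lemma actionIntegrand_curve (κ : PathChart n M) (L : ℝ × TangentBundle (𝓡 n) M → ℝ) {u : W12 n}
    (hu : u ∈ κ.dom) :
    actionIntegrand L (κ.curve u) =ᵐ[mu01] fun t => κ.lagr L t (u t, W12.der u t) := by
  filter_upwards [ae_mu01_Ioo, W12.ae_hasDerivAt u] with t ht hd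
  rw [actionIntegrand, lagr]
  congr 2
  exact totalSpace_mk_eq rfl (κ.velocity_curve hu ht hd).2

lemma localAction_eq (κ : PathChart n M) (L : ℝ × TangentBundle (𝓡 n) M → ℝ) {u : W12 n}
    (hu : u ∈ κ.dom) : localAction L κ u = ∫ t, κ.lagr L t (u t, W12.der u t) ∂mu01 := by
  rw [localAction, action, intervalIntegral_eq_mu01]
  exact integral_congr_ae (κ.actionIntegrand_curve L hu)

lemma isOpen_dom (κ : PathChart n M) : IsOpen κ.dom := W12.isOpen_setOf_mapsTo κ.isOpen_U

lemma locallyQuadEst_lagr (κ : PathChart n M) {g : RMetric n M}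
    (hL : ContMDiffOn (𝓘(ℝ, ℝ).prod (𝓡 n).tangent) 𝓘(ℝ, ℝ) 2 L (Icc (0 : ℝ) 1 ×ˢ univ))
    (hL1 : IsUniformlyConvex g L) (hL2 : HasQuadraticBounds g L) :
    LocallyQuadEst κ.U (κ.lagr L) := by
  intro t₀ ht₀ q₀ hq₀
  obtain ⟨C, r, hr, h⟩ := κ.exists_convexQuadEst_lagr hL hL1 hL2 ht₀ hq₀
  exact ⟨C, r, hr, fun t ht htr => (h t ht htr).toQuadEst⟩

theorem contDiffOn_localAction (κ : PathChart n M) {g : RMetric n M}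
    (hL : ContMDiffOn (𝓘(ℝ, ℝ).prod (𝓡 n).tangent) 𝓘(ℝ, ℝ) 2 L (Icc (0 : ℝ) 1 ×ˢ univ))
    (hL1 : IsUniformlyConvex g L) (hL2 : HasQuadraticBounds g L) :
    ContDiffOn ℝ 1 (localAction L κ) κ.dom :=
  (W12.contDiffOn_integral κ.isOpen_U (κ.locallyQuadEst_lagr hL hL1 hL2) (κ.continuousOn_lagr hL)
    (κ.continuousOn_fderiv_lagr hL)).1.congr fun _ hu => κ.localAction_eq L hu

theorem fderiv_localAction (κ : PathChart n M) {g : RMetric n M}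
    (hL : ContMDiffOn (𝓘(ℝ, ℝ).prod (𝓡 n).tangent) 𝓘(ℝ, ℝ) 2 L (Icc (0 : ℝ) 1 ×ˢ univ))
    (hL1 : IsUniformlyConvex g L) (hL2 : HasQuadraticBounds g L) {u : W12 n} (hu : u ∈ κ.dom)
    (η : W12 n) :
    fderiv ℝ (localAction L κ) u η =
      ∫ t, fderiv ℝ (κ.lagr L t) (u t, W12.der u t) (η t, W12.der η t) ∂mu01 := by
  rw [← (W12.contDiffOn_integral κ.isOpen_U (κ.locallyQuadEst_lagr hL hL1 hL2)
    (κ.continuousOn_lagr hL) (κ.continuousOn_fderiv_lagr hL)).2 u hu η]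
  have : localAction L κ =ᶠ[𝓝 u] fun u : W12 n => ∫ t, κ.lagr L t (u t, W12.der u t) ∂mu01 := by
    filter_upwards [κ.isOpen_dom.mem_nhds hu] with w hw using κ.localAction_eq L hw
  rw [this.fderiv_eq]

lemma integrable_lagr (κ : PathChart n M) {g : RMetric n M}
    (hL : ContMDiffOn (𝓘(ℝ, ℝ).prod (𝓡 n).tangent) 𝓘(ℝ, ℝ) 2 L (Icc (0 : ℝ) 1 ×ˢ univ))
    (hL1 : IsUniformlyConvex g L) (hL2 : HasQuadraticBounds g L) {u : W12 n} (hu : u ∈ κ.dom) :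
    Integrable (fun t => κ.lagr L t (u t, W12.der u t)) mu01 :=
  W12.integrable_lagrangian κ.isOpen_U (κ.locallyQuadEst_lagr hL hL1 hL2)
    (κ.continuousOn_lagr hL) hu

lemma integrable_fderiv_lagr (κ : PathChart n M) {g : RMetric n M}
    (hL : ContMDiffOn (𝓘(ℝ, ℝ).prod (𝓡 n).tangent) 𝓘(ℝ, ℝ) 2 L (Icc (0 : ℝ) 1 ×ˢ univ))
    (hL1 : IsUniformlyConvex g L) (hL2 : HasQuadraticBounds g L) {u : W12 n} (hu : u ∈ κ.dom)
    (η : W12 n) :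
    Integrable (fun t => fderiv ℝ (κ.lagr L t) (u t, W12.der u t) (η t, W12.der η t)) mu01 :=
  W12.integrable_fderiv κ.isOpen_U (κ.locallyQuadEst_lagr hL hL1 hL2)
    (κ.continuousOn_fderiv_lagr hL) hu η

lemma ext_push (κ : PathChart n M) (u : κ.dom) {t : ℝ} (ht : t ∈ Icc (0 : ℝ) 1) :
    (κ.push u).ext t = κ.curve u.1 t := by
  rw [W12Curve.ext, projIcc_of_mem zero_le_one ht]
  rfl

lemma action_push (κ : PathChart n M) (L : ℝ × TangentBundle (𝓡 n) M → ℝ) (u : κ.dom) :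
    action L (κ.push u).ext = localAction L κ u.1 :=
  action_congr L fun _ ht => κ.ext_push u ht

lemma actionIntegrand_push (κ : PathChart n M) (L : ℝ × TangentBundle (𝓡 n) M → ℝ) (u : κ.dom) :
    actionIntegrand L (κ.push u).ext =ᵐ[mu01]
      fun t => κ.lagr L t (u.1 t, W12.der u.1 t) := by
  filter_upwards [ae_mu01_Ioo, κ.actionIntegrand_curve L u.2] with t ht h
  rw [← h]
  refine actionIntegrand_congr L ?_
  filter_upwards [Icc_mem_nhds ht.1 ht.2] with s hs using κ.ext_push u hs

end PathChart

/-! ### Smooth paths of linear maps with prescribed injectivity -/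

section Frames

/-- A smooth partition of unity glues local constants, as balls are convex. -/
lemma exists_contDiff_approx {F : Type*} [NormedAddCommGroup F] [NormedSpace ℝ F] {f : ℝ → F}
    (hf : Continuous f) {ε : ℝ} (hε : 0 < ε) :
    ∃ h : ℝ → F, ContDiff ℝ ∞ h ∧ ∀ t, ‖h t - f t‖ < ε := by
  obtain ⟨h, hh⟩ := exists_contMDiffMap_forall_mem_convex_of_local_const (n := (⊤ : ℕ∞)) 𝓘(ℝ, ℝ)
    (t := fun t => Metric.ball (f t) ε) (fun t => convex_ball _ _) (fun t => ⟨f t, by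
      filter_upwards [hf.continuousAt.eventually (Metric.ball_mem_nhds (f t) hε)] with s hs
      rwa [Metric.mem_ball, dist_comm]⟩)
  exact ⟨h, contMDiff_iff_contDiff.1 h.contMDiff, fun t => mem_ball_iff_norm.1 (hh t)⟩

variable {V W : Type*} [NormedAddCommGroup V] [NormedSpace ℝ V] [FiniteDimensional ℝ V]
  [NormedAddCommGroup W] [NormedSpace ℝ W] [FiniteDimensional ℝ W]

/-- A path of linear maps which are injective on a continuous family of subspaces, given locally by
frames, exists. -/
lemma exists_continuous_injective_path {J : ℝ → (W →L[ℝ] V) → Prop}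
    (hJ : ∀ t₀ ∈ Icc (0 : ℝ) 1, ∃ T : ℝ → V →L[ℝ] W, ∃ O ∈ 𝓝 t₀, ContinuousOn T O ∧
      ∀ t ∈ O, (∀ b, T t b = 0 → b = 0) ∧ ∀ P : W →L[ℝ] V, J t P ↔ ∀ b, P (T t b) = 0 → b = 0) :
    ∃ P : ℝ → W →L[ℝ] V, Continuous P ∧ ∀ t ∈ Icc (0 : ℝ) 1, J t (P t) := by
  have : CompleteSpace V := FiniteDimensional.complete ℝ V
  have key : ∀ t₀ : unitInterval, ∃ T : ℝ → V →L[ℝ] W, ∃ Λ : ℝ → W →L[ℝ] V, ∃ O : Set ℝ,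
      IsOpen O ∧ (t₀ : ℝ) ∈ O ∧ ContinuousOn T O ∧ ContinuousOn Λ O ∧
      ∀ t ∈ O, (∀ b, Λ t (T t b) = b) ∧ ∀ P : W →L[ℝ] V, J t P ↔ ∀ b, P (T t b) = 0 → b = 0 := by
    intro t₀
    obtain ⟨T, O, hO, hT, hTJ⟩ := hJ t₀ t₀.2
    obtain ⟨Λ₀, hΛ₀⟩ := LinearMap.exists_leftInverse_of_injective (T t₀ : V →ₗ[ℝ] W)
      (LinearMap.ker_eq_bot'.2 (hTJ _ (mem_of_mem_nhds hO)).1)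
    -- A left inverse at `t₀`. Near `t₀` the map `Λ₁ ∘ T(t)` stays invertible, and composing its
    -- inverse with `Λ₁` gives left inverses continuous in `t`.
    let Λ₁ : W →L[ℝ] V := LinearMap.toContinuousLinearMap Λ₀
    let O' : Set ℝ := interior O ∩ {t | IsUnit (Λ₁.comp (T t))}
    have hcT : ContinuousOn (fun t => Λ₁.comp (T t)) (interior O) :=
      continuousOn_const.clm_comp (hT.mono interior_subset)
    refine ⟨T, fun t => (Ring.inverse (Λ₁.comp (T t))).comp Λ₁, O', ?_, ⟨mem_interior_iff_mem_nhds.2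
      hO, ?_⟩, hT.mono fun t ht => interior_subset ht.1, ?_, fun t ht => ⟨fun b => ?_,
      (hTJ t (interior_subset ht.1)).2⟩⟩
    · exact hcT.isOpen_inter_preimage isOpen_interior Units.isOpen
    · have : Λ₁.comp (T t₀) = 1 := by
        ext b
        exact LinearMap.congr_fun hΛ₀ b
      change IsUnit (Λ₁.comp (T t₀))
      rw [this]
      exact isUnit_one
    · refine ContinuousOn.clm_comp (fun t ht => ?_) continuousOn_const
      obtain ⟨x, hx⟩ := ht.2
      have h1 := NormedRing.inverse_continuousAt x
      rw [hx] at h1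
      exact ContinuousAt.comp_continuousWithinAt (f := fun t => Λ₁.comp (T t)) (x := t) h1
        ((hcT t ht.1).mono inter_subset_left)
    · have := Ring.inverse_mul_cancel _ ht.2
      exact DFunLike.congr_fun this b
  choose T Λ O hO hmem hT hΛ hTΛ using key
  obtain ⟨τ, hτ0, hτm, ⟨N, hN⟩, hτ⟩ := exists_monotone_Icc_subset_open_cover_unitInterval
    (c := fun i : unitInterval => ((↑) : unitInterval → ℝ) ⁻¹' O i)
    (fun i => (hO i).preimage continuous_subtype_val)
    (fun t _ => mem_iUnion.2 ⟨t, hmem t⟩)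
  have ind : ∀ k, ∃ P : ℝ → W →L[ℝ] V, Continuous P ∧ ∀ t ∈ Icc (0 : ℝ) (τ k), J t (P t) := by
    intro k
    induction k with
    | zero =>
      -- Only the time `0` matters here, and a left inverse of `T(0)` is injective on its image.
      refine ⟨fun _ => Λ 0 0, continuous_const, fun t ht => ?_⟩
      rw [hτ0] at ht
      obtain rfl : t = 0 := le_antisymm ht.2 ht.1
      obtain ⟨h1, h2⟩ := hTΛ 0 0 (hmem 0)
      rw [h2]
      intro b hb
      rw [← h1 b, hb]
    | succ k ih =>
      obtain ⟨P, hP, hPJ⟩ := ih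
      obtain ⟨i, hi⟩ := hτ k
      have hle : (τ k : ℝ) ≤ τ (k + 1) := hτm (Nat.le_succ k)
      have hsub : ∀ t ∈ Icc (τ k : ℝ) (τ (k + 1)), t ∈ O i := by
        intro t ht
        exact hi (a := ⟨t, (τ k).2.1.trans ht.1, ht.2.trans (τ (k + 1)).2.2⟩) ⟨ht.1, ht.2⟩
      set s : ℝ := (τ k : ℝ) with hs
      have hsO : s ∈ O i := hsub s ⟨le_rfl, hle⟩
      -- The correction is designed so that `P'(t) ∘ T(t) = P(s) ∘ T(s)` for all `t` in the piece:
      -- seen in the frame `T` the map is constant, so injectivity propagates from `s`. It also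
      -- satisfies `P'(s) = P(s)`, so the two paths glue continuously.
      let P' : ℝ → W →L[ℝ] V := fun t => P s + ((P s).comp (T i s) - (P s).comp (T i t)).comp (Λ i t)
      have hP' : ContinuousOn P' (Icc s (τ (k + 1))) := by
        refine ContinuousOn.add continuousOn_const (ContinuousOn.clm_comp (ContinuousOn.sub
          continuousOn_const (continuousOn_const.clm_comp ((hT i).mono hsub))) ((hΛ i).mono hsub))
      have hP's : P' s = P s := by simp [P']
      have hPT : ∀ t ∈ O i, ∀ b, P' t (T i t b) = P s (T i s b) := by
        intro t ht b
        simp [P', (hTΛ i t ht).1 b]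
      let pr : ℝ → ℝ := fun t => (projIcc s (τ (k + 1) : ℝ) hle t : ℝ)
      have hpr : Continuous pr := continuous_subtype_val.comp continuous_projIcc
      refine ⟨fun t => if t ≤ s then P t else P' (pr t), ?_, fun t ht => ?_⟩
      · refine Continuous.if_le hP (hP'.comp_continuous hpr fun t => (projIcc s _ hle t).2)
          continuous_id continuous_const fun t ht => ?_
        have ht' : t = s := ht
        have : pr s = s := by simp [pr, projIcc_left]
        rw [ht', this, hP's]
      · by_cases hts : t ≤ s
        · simp only [hts, if_true]
          exact hPJ t ⟨ht.1, hts⟩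
        · simp only [hts, if_false]
          have htI : t ∈ Icc s (τ (k + 1) : ℝ) := ⟨(not_le.1 hts).le, ht.2⟩
          have : pr t = t := by simp [pr, projIcc_of_mem hle htI]
          rw [this, (hTΛ i t (hsub t htI)).2]
          intro b hb
          rw [hPT t (hsub t htI)] at hb
          exact ((hTΛ i s hsO).2 (P s)).1 (hPJ s ⟨(τ k).2.1, le_rfl⟩) b hb
  obtain ⟨P, hP, hPJ⟩ := ind N
  refine ⟨P, hP, fun t ht => hPJ t ?_⟩
  rw [hN N le_rfl]
  exact ht

/-- Injectivity on the image of a frame is an open condition, with a uniform margin `ε` over the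
compact interval; a smooth path within `ε` of the continuous one still satisfies it. -/
lemma exists_contDiff_injective_path {J : ℝ → (W →L[ℝ] V) → Prop}
    (hJ : ∀ t₀ ∈ Icc (0 : ℝ) 1, ∃ T : ℝ → V →L[ℝ] W, ∃ O ∈ 𝓝 t₀, ContinuousOn T O ∧
      ∀ t ∈ O, (∀ b, T t b = 0 → b = 0) ∧ ∀ P : W →L[ℝ] V, J t P ↔ ∀ b, P (T t b) = 0 → b = 0) :
    ∃ P : ℝ → W →L[ℝ] V, ContDiff ℝ ∞ P ∧ ∀ t ∈ Icc (0 : ℝ) 1, J t (P t) := by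
  obtain ⟨P, hP, hPJ⟩ := exists_continuous_injective_path hJ
  have key : ∃ ε > 0, ∀ t ∈ Icc (0 : ℝ) 1, ∀ P', ‖P' - P t‖ < ε → J t P' := by
    refine isCompact_Icc.induction_on (p := fun s => ∃ ε > 0, ∀ t ∈ s, ∀ P', ‖P' - P t‖ < ε → J t P')
      ⟨1, one_pos, by simp⟩ ?_ ?_ ?_
    · rintro s s' hss ⟨ε, hε, h⟩
      exact ⟨ε, hε, fun t ht => h t (hss ht)⟩
    · rintro s s' ⟨ε, hε, h⟩ ⟨ε', hε', h'⟩
      refine ⟨min ε ε', by positivity, fun t ht P' hP' => ?_⟩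
      rcases ht with ht | ht
      · exact h t ht P' (hP'.trans_le (min_le_left _ _))
      · exact h' t ht P' (hP'.trans_le (min_le_right _ _))
    · intro t₀ ht₀
      obtain ⟨T, O, hO, hT, hTJ⟩ := hJ t₀ ht₀
      have hc : ContinuousWithinAt (fun x : ℝ × (W →L[ℝ] V) => (P x.1 + x.2).comp (T x.1)) univ
          (t₀, 0) := by
        rw [continuousWithinAt_univ]
        refine ContinuousAt.clm_comp ?_ ?_
        · exact ((hP.comp continuous_fst).add continuous_snd).continuousAt
        · exact ContinuousAt.comp (x := (t₀, (0 : W →L[ℝ] V))) (g := T) (hT.continuousAt hO)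
            continuousAt_fst
      obtain ⟨R, hR, hev⟩ := exists_bound_of_injective hc (fun b hb =>
        ((hTJ t₀ (mem_of_mem_nhds hO)).2 _).1 (hPJ t₀ ht₀) b (by simpa using hb))
      rw [nhdsWithin_univ, nhds_prod_eq] at hev
      obtain ⟨p, hp, p', hp', hpp⟩ := Filter.eventually_prod_iff.1 hev
      obtain ⟨ε, hε, hball⟩ := Metric.eventually_nhds_iff_ball.1 hp'
      refine ⟨{t | p t} ∩ O, mem_nhdsWithin_of_mem_nhds (inter_mem hp hO), ε, hε,
        fun t ht P' hP' => ?_⟩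
      rw [(hTJ t ht.2).2]
      intro b hb
      have h1 := hpp ht.1 (hball (P' - P t) (by simpa using hP')) b
      simp only [add_sub_cancel, ContinuousLinearMap.comp_apply, hb, norm_zero, mul_zero] at h1
      exact norm_le_zero_iff.1 h1
  obtain ⟨ε, hε, hJε⟩ := key
  obtain ⟨h, hh, hhP⟩ := exists_contDiff_approx hP hε
  exact ⟨h, hh, fun t ht => hJε t ht _ (hhP t)⟩

end Frames

/-! ### Moving frames along curves -/

section Frames

variable {n m : ℕ} {M : Type*} [TopologicalSpace M] [ChartedSpace (Vec n) M]

/-- The linear map `P` is injective on the image of the tangent space at `q` by the differential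
of `e`. -/
def FrameAt (e : M → Vec m) (q : M) (P : Vec m →L[ℝ] Vec n) : Prop :=
  ∀ b : TangentSpace (𝓡 n) q, P (mfderiv (𝓡 n) 𝓘(ℝ, Vec m) e q b) = 0 → b = 0

variable [IsManifold (𝓡 n) ∞ M]

lemma surjective_coordVec (q₀ : M) {x : Vec n} (hx : x ∈ (extChartAt (𝓡 n) q₀).target)
    (w : TangentSpace (𝓡 n) ((extChartAt (𝓡 n) q₀).symm x)) : ∃ v, coordVec q₀ x v = w := by
  let A : Vec n →L[ℝ] Vec n := mfderiv 𝓘(ℝ, Vec n) (𝓡 n) (extChartAt (𝓡 n) q₀).symm x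
  have h1 : Function.Injective (A : Vec n →ₗ[ℝ] Vec n) :=
    LinearMap.ker_eq_bot.1 (LinearMap.ker_eq_bot'.2 fun v hv => injective_coordVec q₀ hx hv)
  exact LinearMap.injective_iff_surjective.1 h1 w

lemma contDiffAt_comp_extChartAt_symm {F : Type*} [NormedAddCommGroup F] [NormedSpace ℝ F]
    {e : M → F} (he : ContMDiff (𝓡 n) 𝓘(ℝ, F) ∞ e) (q₀ : M) {x : Vec n}
    (hx : x ∈ (extChartAt (𝓡 n) q₀).target) :
    ContDiffAt ℝ ∞ (e ∘ (extChartAt (𝓡 n) q₀).symm) x :=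
  (he.contMDiffAt.comp x (((contMDiffOn_extChartAt_symm (n := ∞) q₀) x hx).contMDiffAt
    (mem_extChartAt_target_nhds q₀ hx))).contDiffAt

lemma fderiv_comp_extChartAt_symm {F : Type*} [NormedAddCommGroup F] [NormedSpace ℝ F]
    {e : M → F} (he : ContMDiff (𝓡 n) 𝓘(ℝ, F) ∞ e) (q₀ : M) {x : Vec n}
    (hx : x ∈ (extChartAt (𝓡 n) q₀).target) (v : Vec n) :
    fderiv ℝ (e ∘ (extChartAt (𝓡 n) q₀).symm) x v =
      mfderiv (𝓡 n) 𝓘(ℝ, F) e ((extChartAt (𝓡 n) q₀).symm x) (coordVec q₀ x v) := by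
  have h1 := mfderiv_comp x (I := 𝓘(ℝ, Vec n)) (I' := 𝓡 n) (I'' := 𝓘(ℝ, F))
    (he.mdifferentiableAt (by simp)) (mdifferentiableAt_extChartAt_symm q₀ hx)
  rw [mfderiv_eq_fderiv] at h1
  exact DFunLike.congr_fun h1 v

/-- In a chart the condition concerns linear maps on the fixed space `ℝⁿ` that depend continuously
on the base point, so perturbation arguments apply. -/
lemma frameAt_iff {e : M → Vec m} (he : ContMDiff (𝓡 n) 𝓘(ℝ, Vec m) ∞ e) (q₀ : M) {q : M}
    (hq : q ∈ (extChartAt (𝓡 n) q₀).source) (P : Vec m →L[ℝ] Vec n) :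
    FrameAt e q P ↔ ∀ b, P (fderiv ℝ (e ∘ (extChartAt (𝓡 n) q₀).symm)
      (extChartAt (𝓡 n) q₀ q) b) = 0 → b = 0 := by
  have hx := (extChartAt (𝓡 n) q₀).map_source hq
  nth_rewrite 1 [← (extChartAt (𝓡 n) q₀).left_inv hq]
  constructor
  · intro h b hb
    rw [fderiv_comp_extChartAt_symm he q₀ hx] at hb
    exact injective_coordVec q₀ hx (h _ hb)
  · intro h b hb
    obtain ⟨v, rfl⟩ := surjective_coordVec q₀ hx b
    rw [← fderiv_comp_extChartAt_symm he q₀ hx] at hb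
    rw [h v hb]
    exact map_zero (mfderiv 𝓘(ℝ, Vec n) (𝓡 n) (extChartAt (𝓡 n) q₀).symm _)

lemma continuousAt_fderiv_comp_symm {e : M → Vec m} (he : ContMDiff (𝓡 n) 𝓘(ℝ, Vec m) ∞ e)
    (q₀ : M) {q : M} (hq : q ∈ (extChartAt (𝓡 n) q₀).source) :
    ContinuousAt (fun q => fderiv ℝ (e ∘ (extChartAt (𝓡 n) q₀).symm) (extChartAt (𝓡 n) q₀ q)) q := by
  have h1 : ContinuousAt (fderiv ℝ (e ∘ (extChartAt (𝓡 n) q₀).symm)) (extChartAt (𝓡 n) q₀ q) :=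
    ((contDiffAt_comp_extChartAt_symm he q₀ ((extChartAt (𝓡 n) q₀).map_source hq)).fderiv_right
      (m := 0) (by simp)).continuousAt
  exact ContinuousAt.comp (f := extChartAt (𝓡 n) q₀) (x := q) h1 (continuousAt_extChartAt' hq)

/-- Along every curve in an embedded manifold there is a smooth moving frame. -/
lemma exists_moving_frame {e : M → Vec m} (he : ContMDiff (𝓡 n) 𝓘(ℝ, Vec m) ∞ e)
    (hei : ∀ x, Function.Injective (mfderiv (𝓡 n) 𝓘(ℝ, Vec m) e x)) {γ : ℝ → M}
    (hγ : Continuous γ) :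
    ∃ P : ℝ → Vec m →L[ℝ] Vec n, ContDiff ℝ ∞ P ∧ ∀ t ∈ Icc (0 : ℝ) 1, FrameAt e (γ t) (P t) := by
  refine exists_contDiff_injective_path (J := fun t P => FrameAt e (γ t) P) fun t₀ _ => ?_
  set q₀ := γ t₀
  -- Near `t₀` the frame of the tangent spaces along `γ` is the coordinate frame of the chart at
  -- `γ(t₀)`, carried to the ambient space by `e`.
  refine ⟨fun t => fderiv ℝ (e ∘ (extChartAt (𝓡 n) q₀).symm) (extChartAt (𝓡 n) q₀ (γ t)),
    γ ⁻¹' (extChartAt (𝓡 n) q₀).source,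
    hγ.continuousAt.preimage_mem_nhds (extChartAt_source_mem_nhds q₀), fun t ht => ?_,
    fun t ht => ⟨fun b hb => ?_, frameAt_iff he q₀ ht⟩⟩
  · exact (ContinuousAt.comp (f := γ) (x := t) (continuousAt_fderiv_comp_symm he q₀ ht)
      hγ.continuousAt).continuousWithinAt
  · have hx := (extChartAt (𝓡 n) q₀).map_source ht
    rw [fderiv_comp_extChartAt_symm he q₀ hx] at hb
    refine injective_coordVec q₀ hx (hei _ (hb.trans ?_))
    exact (map_zero (mfderiv (𝓡 n) 𝓘(ℝ, Vec m) e _)).symm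

/-- In the chart at `q₀` the composed linear map is continuous in `(t, q)`, and injectivity is
stable by `exists_bound_of_injective`. -/
lemma isOpen_frameAt {e : M → Vec m} (he : ContMDiff (𝓡 n) 𝓘(ℝ, Vec m) ∞ e)
    {P : ℝ → Vec m →L[ℝ] Vec n} (hP : Continuous P) :
    IsOpen {p : ℝ × M | FrameAt e p.2 (P p.1)} := by
  rw [isOpen_iff_mem_nhds]
  rintro ⟨t₀, q₀⟩ h0
  have hc : ContinuousWithinAt (fun p : ℝ × M => (P p.1).comp
      (fderiv ℝ (e ∘ (extChartAt (𝓡 n) q₀).symm) (extChartAt (𝓡 n) q₀ p.2))) univ (t₀, q₀) := by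
    rw [continuousWithinAt_univ]
    refine ContinuousAt.clm_comp (hP.comp continuous_fst).continuousAt ?_
    exact ContinuousAt.comp (x := (t₀, q₀)) (f := Prod.snd)
      (g := fun q => fderiv ℝ (e ∘ (extChartAt (𝓡 n) q₀).symm) (extChartAt (𝓡 n) q₀ q))
      (continuousAt_fderiv_comp_symm he q₀ (mem_extChartAt_source q₀)) continuousAt_snd
  obtain ⟨R, hR, hev⟩ := exists_bound_of_injective hc
    ((frameAt_iff he q₀ (mem_extChartAt_source q₀) (P t₀)).1 h0)
  rw [nhdsWithin_univ] at hev
  have h2 : ∀ᶠ p : ℝ × M in 𝓝 (t₀, q₀), p.2 ∈ (extChartAt (𝓡 n) q₀).source :=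
    continuousAt_snd.eventually (extChartAt_source_mem_nhds (I := 𝓡 n) q₀)
  filter_upwards [hev, h2] with p h3 h4
  rw [frameAt_iff he q₀ h4]
  intro b hb
  have h5 := h3 b
  rw [ContinuousLinearMap.comp_apply, hb, norm_zero, mul_zero] at h5
  exact norm_le_zero_iff.1 h5

/-- The inverse function theorem for `(t, x) ↦ (t, P(t) e(x))`. -/
lemma exists_local_inverse {e : M → Vec m} (he : ContMDiff (𝓡 n) 𝓘(ℝ, Vec m) ∞ e)
    {P : ℝ → Vec m →L[ℝ] Vec n} (hP : ContDiff ℝ ∞ P) {t₀ : ℝ} {q₀ : M}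
    (h0 : FrameAt e q₀ (P t₀)) :
    ∃ σ : ℝ × Vec n → M, ContMDiffAt 𝓘(ℝ, ℝ × Vec n) (𝓡 n) ∞ σ (t₀, P t₀ (e q₀)) ∧
      (∀ᶠ z in 𝓝 (t₀, P t₀ (e q₀)), P z.1 (e (σ z)) = z.2) ∧
      ∀ᶠ p : ℝ × M in 𝓝 (t₀, q₀), σ (p.1, P p.1 (e p.2)) = p.2 := by
  set c := extChartAt (𝓡 n) q₀ with hc
  have hq : q₀ ∈ c.source := mem_extChartAt_source q₀
  have hx : c q₀ ∈ c.target := mem_extChartAt_target q₀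
  let Φ : ℝ × Vec n → ℝ × Vec n := fun z => (z.1, P z.1 ((e ∘ c.symm) z.2))
  have he' := contDiffAt_comp_extChartAt_symm he q₀ hx
  have hΦ : ContDiffAt ℝ ∞ Φ (t₀, c q₀) := by
    refine contDiffAt_fst.prodMk (ContDiffAt.clm_apply ?_ ?_)
    · exact (hP.comp contDiff_fst).contDiffAt
    · exact ContDiffAt.comp (t₀, c q₀) (g := e ∘ c.symm) (f := Prod.snd) he' contDiffAt_snd
  have hd := (hΦ.differentiableAt (by simp)).hasFDerivAt
  set A := fderiv ℝ Φ (t₀, c q₀) with hA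
  have hA1 : ∀ z, (A z).1 = z.1 := by
    intro z
    have h1 : HasFDerivAt (fun z : ℝ × Vec n => z.1)
      ((ContinuousLinearMap.fst ℝ ℝ (Vec n)).comp A) (t₀, c q₀) :=
      HasFDerivAt.comp (t₀, c q₀) (g := Prod.fst) (f := Φ) hasFDerivAt_fst hd
    exact (DFunLike.congr_fun (h1.unique hasFDerivAt_fst) z)
  have hA2 : ∀ b, (A (0, b)).2 = P t₀ (fderiv ℝ (e ∘ c.symm) (c q₀) b) := by
    intro b
    have h1 : HasFDerivAt (fun y : Vec n => P t₀ ((e ∘ c.symm) y))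
      (((ContinuousLinearMap.snd ℝ ℝ (Vec n)).comp A).comp (ContinuousLinearMap.inr ℝ ℝ (Vec n)))
      (c q₀) :=
      HasFDerivAt.comp (c q₀) (g := fun z => (Φ z).2) (f := fun y => (t₀, y))
        (HasFDerivAt.comp (t₀, c q₀) (g := Prod.snd) (f := Φ) hasFDerivAt_snd hd)
        (hasFDerivAt_prodMk_right t₀ (c q₀))
    have h2 : HasFDerivAt (fun y : Vec n => P t₀ ((e ∘ c.symm) y))
      ((P t₀).comp (fderiv ℝ (e ∘ c.symm) (c q₀))) (c q₀) :=
      (P t₀).hasFDerivAt.comp (c q₀) (he'.differentiableAt (by simp)).hasFDerivAt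
    exact DFunLike.congr_fun (h1.unique h2) b
  -- The differential is block triangular: identity on the time component, and `P(t₀) ∘ D(e ∘ c⁻¹)`
  -- on space, injective by the frame condition.
  have hinj : Function.Injective (A : ℝ × Vec n →ₗ[ℝ] ℝ × Vec n) := by
    refine LinearMap.ker_eq_bot.1 (LinearMap.ker_eq_bot'.2 ?_)
    rintro ⟨s, b⟩ hz
    have hz' : A (s, b) = 0 := hz
    have h1 : s = 0 := (hA1 (s, b)).symm.trans (congrArg Prod.fst hz')
    subst h1
    have h2 := hA2 b
    rw [hz'] at h2
    rw [(frameAt_iff he q₀ hq _).1 h0 b h2.symm]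
    rfl
  let A' : (ℝ × Vec n) ≃L[ℝ] ℝ × Vec n :=
    (LinearEquiv.ofInjectiveEndo (A : ℝ × Vec n →ₗ[ℝ] ℝ × Vec n) hinj).toContinuousLinearEquiv
  have hd' : HasFDerivAt Φ (A' : ℝ × Vec n →L[ℝ] ℝ × Vec n) (t₀, c q₀) := by
    have : (A' : ℝ × Vec n →L[ℝ] ℝ × Vec n) = A := by ext z <;> rfl
    rw [this]; exact hd
  let h := hΦ.toOpenPartialHomeomorph Φ hd' (by simp)
  have hcoe : ∀ z, h z = Φ z := fun z => rfl
  have hΦ0 : Φ (t₀, c q₀) = (t₀, P t₀ (e q₀)) := by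
    simp only [Φ, Function.comp_apply, c.left_inv hq]
  have hmem : (t₀, c q₀) ∈ h.source := hΦ.mem_toOpenPartialHomeomorph_source hd' (by simp)
  have hsymm : h.symm (t₀, P t₀ (e q₀)) = (t₀, c q₀) := by
    rw [← hΦ0, ← hcoe]; exact h.left_inv hmem
  have hsm : ContDiffAt ℝ ∞ h.symm (t₀, P t₀ (e q₀)) := by
    rw [← hΦ0]
    exact hΦ.to_localInverse hd' (by simp)
  refine ⟨fun z => c.symm (h.symm z).2, ?_, ?_, ?_⟩
  · have h1 : ContMDiffAt 𝓘(ℝ, Vec n) (𝓡 n) ∞ c.symm (h.symm (t₀, P t₀ (e q₀))).2 := by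
      rw [hsymm]
      exact ((contMDiffOn_extChartAt_symm (n := ∞) q₀) _ hx).contMDiffAt
        (mem_extChartAt_target_nhds q₀ hx)
    exact ContMDiffAt.comp (t₀, P t₀ (e q₀)) (g := c.symm) (f := fun z => (h.symm z).2) h1
      (contMDiffAt_iff_contDiffAt.2 (contDiffAt_snd.comp _ hsm))
  · have h1 : h.target ∈ 𝓝 (t₀, P t₀ (e q₀)) := by
      refine h.open_target.mem_nhds ?_
      rw [← hΦ0, ← hcoe]
      exact h.map_source hmem
    filter_upwards [h1] with z hz
    have h2 : Φ (h.symm z) = z := h.right_inv hz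
    have h3' := congrArg Prod.fst h2
    have h3 : (h.symm z).1 = z.1 := h3'
    have h4' := congrArg Prod.snd h2
    have h4 : P (h.symm z).1 (e (c.symm (h.symm z).2)) = z.2 := h4'
    rwa [h3] at h4
  · have h1 : ∀ᶠ p : ℝ × M in 𝓝 (t₀, q₀), p.2 ∈ c.source :=
      continuousAt_snd.eventually (extChartAt_source_mem_nhds (I := 𝓡 n) q₀)
    have h2 : ∀ᶠ p : ℝ × M in 𝓝 (t₀, q₀), (p.1, c p.2) ∈ h.source := by
      have h3 : ContinuousAt (fun p : ℝ × M => (p.1, c p.2)) (t₀, q₀) :=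
        continuousAt_fst.prodMk (ContinuousAt.comp (x := (t₀, q₀)) (g := c) (f := Prod.snd)
          (continuousAt_extChartAt q₀) continuousAt_snd)
      exact h3.eventually (h.open_source.mem_nhds hmem)
    filter_upwards [h1, h2] with p hp1 hp2
    have h3 := h.left_inv hp2
    have h4 : h (p.1, c p.2) = (p.1, P p.1 (e p.2)) := by
      rw [hcoe]
      simp only [Φ, Function.comp_apply, c.left_inv hp1]
    rw [h4] at h3
    rw [h3]
    exact c.left_inv hp1

end Frames

/-! ### Coordinate systems around continuous curves -/

section Existence

variable {n : ℕ} {M : Type*} [TopologicalSpace M] [ChartedSpace (Vec n) M]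
  [IsManifold (𝓡 n) ∞ M] [T2Space M] [CompactSpace M]

/-- Every continuous curve is contained in the image of a time dependent coordinate system, whose
inverse is the restriction of a smooth map. -/
theorem exists_pathChart {γ : ℝ → M} (hγ : Continuous γ) :
    ∃ (κ : PathChart n M) (F : ℝ × M → Vec n) (W : Set (ℝ × M)),
      ContMDiff (𝓘(ℝ, ℝ).prod (𝓡 n)) 𝓘(ℝ, Vec n) ∞ F ∧ IsOpen W ∧
      (∀ t ∈ Icc (0 : ℝ) 1, (t, γ t) ∈ W) ∧
      ∀ p ∈ W, p.1 ∈ Icc (0 : ℝ) 1 → F p ∈ κ.U ∧ κ.φ p.1 (F p) = p.2 := by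
  obtain ⟨m, e, he, -, hei⟩ := exists_embedding_euclidean_of_compact (I := 𝓡 n) (M := M)
  obtain ⟨P, hP, hPγ⟩ := exists_moving_frame he hei hγ
  let f : ℝ × M → Vec n := fun p => P p.1 (e p.2)
  have hf : ContMDiff (𝓘(ℝ, ℝ).prod (𝓡 n)) 𝓘(ℝ, Vec n) ∞ f := by
    refine ContMDiff.clm_apply (hP.contMDiff.comp contMDiff_fst) (he.comp contMDiff_snd)
  let Φ : ℝ × M → ℝ × Vec n := fun p => (p.1, f p)
  have hΦ : Continuous Φ := continuous_fst.prodMk hf.continuous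
  let G : Set (ℝ × M) := (fun t => (t, γ t)) '' Icc (0 : ℝ) 1
  have hG : IsCompact G := isCompact_Icc.image (continuous_id.prodMk hγ)
  -- A locally injective map which is injective on a compact set is injective near it. On the graph
  -- of `γ` injectivity is clear because `Φ` preserves time; local injectivity comes from the local
  -- inverses.
  obtain ⟨N, hN, hNinj⟩ := Set.InjOn.exists_mem_nhdsSet (f := Φ) (s := G) (by
      rintro _ ⟨t, ht, rfl⟩ _ ⟨t', ht', rfl⟩ h
      have : t = t' := congrArg Prod.fst h
      rw [this]) hG (fun p _ => hΦ.continuousAt) (by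
      rintro _ ⟨t, ht, rfl⟩
      obtain ⟨σ, -, -, hσ⟩ := exists_local_inverse he hP (hPγ t ht)
      refine ⟨_, hσ, fun p hp p' hp' h => ?_⟩
      have h1 : p.1 = p'.1 := congrArg (fun w : ℝ × Vec n => w.1) h
      have h2 : f p = f p' := congrArg (fun w : ℝ × Vec n => w.2) h
      refine Prod.ext h1 ?_
      have hp1 : σ (p.1, f p) = p.2 := hp
      have hp2 : σ (p'.1, f p') = p'.2 := hp'
      rw [← hp1, ← hp2, h1, h2])
  let N' : Set (ℝ × M) := interior N ∩ {p | FrameAt e p.2 (P p.1)}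
  have hN'o : IsOpen N' := isOpen_interior.inter (isOpen_frameAt he hP.continuous)
  have hN'inj : InjOn Φ N' := hNinj.mono (inter_subset_left.trans interior_subset)
  have hGN' : G ⊆ N' := by
    rintro _ ⟨t, ht, rfl⟩
    exact ⟨subset_interior_iff_mem_nhdsSet.2 hN ⟨t, ht, rfl⟩, hPγ t ht⟩
  have hloc : ∀ p ∈ N', ∃ σ : ℝ × Vec n → M, ContMDiffAt 𝓘(ℝ, ℝ × Vec n) (𝓡 n) ∞ σ (Φ p) ∧
      σ (Φ p) = p.2 ∧ ∀ᶠ z in 𝓝 (Φ p), (z.1, σ z) ∈ N' ∧ Φ (z.1, σ z) = z := by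
    rintro ⟨t, q⟩ hp
    obtain ⟨σ, hσ1, hσ2, hσ3⟩ := exists_local_inverse he hP hp.2
    have h1 : σ (Φ (t, q)) = q := hσ3.self_of_nhds
    refine ⟨σ, hσ1, h1, ?_⟩
    have hc : ContinuousAt (fun z : ℝ × Vec n => (z.1, σ z)) (Φ (t, q)) :=
      continuousAt_fst.prodMk hσ1.continuousAt
    have h2 : ∀ᶠ z in 𝓝 (Φ (t, q)), (z.1, σ z) ∈ N' := by
      refine hc.eventually (hN'o.mem_nhds ?_)
      change (t, σ (Φ (t, q))) ∈ N'
      rw [h1]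
      exact hp
    filter_upwards [h2, hσ2] with z hz1 hz2
    exact ⟨hz1, Prod.ext rfl hz2⟩
  have hopen : IsOpen (Φ '' N') := by
    rw [isOpen_iff_mem_nhds]
    rintro _ ⟨p, hp, rfl⟩
    obtain ⟨σ, -, -, h⟩ := hloc p hp
    filter_upwards [h] with z hz
    exact ⟨_, hz.1, hz.2⟩
  obtain ⟨δ, hδ, hsub⟩ := (hG.image hΦ).exists_thickening_subset_open hopen (image_mono hGN')
  -- The image of `γ` is only continuous in `t`; centring the tube at a smooth approximation `b`
  -- keeps the coordinates smooth. An error below `δ / 2` leaves room for a ball of radius `δ / 2`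
  -- around `b(t)`.
  obtain ⟨b, hb, hbf⟩ := exists_contDiff_approx (f := fun t => f (t, γ t))
    (hf.continuous.comp (continuous_id.prodMk hγ)) (half_pos hδ)
  have hin : ∀ t ∈ Icc (0 : ℝ) 1, ∀ q ∈ Metric.ball (0 : Vec n) (δ / 2), (t, b t + q) ∈ Φ '' N' := by
    intro t ht q hq
    refine hsub (Metric.mem_thickening_iff.2 ⟨Φ (t, γ t), ⟨_, ⟨t, ht, rfl⟩, rfl⟩, ?_⟩)
    rw [Prod.dist_eq]
    refine max_lt (by simpa [Φ] using hδ) ?_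
    rw [dist_eq_norm]
    have h1 : b t + q - f (t, γ t) = (b t - f (t, γ t)) + q := by abel
    change ‖b t + q - f (t, γ t)‖ < δ
    rw [h1]
    have h2 := norm_add_le (b t - f (t, γ t)) q
    have h3 := hbf t
    rw [mem_ball_zero_iff] at hq
    linarith
  by_cases hne : Nonempty (ℝ × M)
  swap
  · exact absurd ⟨((0 : ℝ), γ 0)⟩ hne
  -- The inverse of `Φ` on the tube, recentred at `b(t)`. It agrees locally with the smooth inverses
  -- `σ`, by injectivity of `Φ` on `N'`.
  let φ : ℝ → Vec n → M := fun t q => (Function.invFunOn Φ N' (t, b t + q)).2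
  have hφ : ∀ p ∈ N', ∀ t q, Φ p = (t, b t + q) → φ t q = p.2 := by
    intro p hp t q h
    simp only [φ]
    rw [← h, hN'inj.leftInvOn_invFunOn hp]
  have hφ' : ∀ t ∈ Icc (0 : ℝ) 1, ∀ q ∈ Metric.ball (0 : Vec n) (δ / 2),
      (t, φ t q) ∈ N' ∧ Φ (t, φ t q) = (t, b t + q) := by
    intro t ht q hq
    obtain ⟨⟨t', x⟩, hp, hpΦ⟩ := hin t ht q hq
    have h1 : t' = t := congrArg (fun w : ℝ × Vec n => w.1) hpΦ
    subst h1
    have h2 : φ t' q = x := hφ _ hp _ _ hpΦ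
    rw [h2]
    exact ⟨hp, hpΦ⟩
  have hsmooth : ∀ t ∈ Icc (0 : ℝ) 1, ∀ q ∈ Metric.ball (0 : Vec n) (δ / 2),
      ContMDiffAt (𝓘(ℝ, ℝ).prod 𝓘(ℝ, Vec n)) (𝓡 n) ∞ (fun p : ℝ × Vec n => φ p.1 p.2) (t, q) := by
    intro t ht q hq
    obtain ⟨h1, h2⟩ := hφ' t ht q hq
    obtain ⟨σ, hσ1, hσ2, hσ3⟩ := hloc _ h1
    rw [h2] at hσ1 hσ2 hσ3
    have h3 : ContDiff ℝ ∞ (fun p : ℝ × Vec n => (p.1, b p.1 + p.2)) :=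
      contDiff_fst.prodMk ((hb.comp contDiff_fst).add contDiff_snd)
    rw [← modelWithCornersSelf_prod, chartedSpaceSelf_prod]
    have h4 : ContMDiffAt 𝓘(ℝ, ℝ × Vec n) (𝓡 n) ∞
        (fun p : ℝ × Vec n => σ (p.1, b p.1 + p.2)) (t, q) :=
      ContMDiffAt.comp (t, q) (g := σ) (f := fun p : ℝ × Vec n => (p.1, b p.1 + p.2)) hσ1
        h3.contMDiff.contMDiffAt
    refine h4.congr_of_eventuallyEq ?_
    have h5 : ∀ᶠ p : ℝ × Vec n in 𝓝 (t, q), ((p.1, σ (p.1, b p.1 + p.2)) ∈ N' ∧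
      Φ (p.1, σ (p.1, b p.1 + p.2)) = (p.1, b p.1 + p.2)) :=
      (h3.continuous.continuousAt (x := (t, q))).eventually hσ3
    filter_upwards [h5] with p hp
    exact hφ _ hp.1 _ _ hp.2
  refine ⟨⟨Metric.ball 0 (δ / 2), Metric.isOpen_ball, φ,
    fun p hp => (hsmooth p.1 hp.1 p.2 hp.2).contMDiffWithinAt, ?_, ?_⟩,
    fun p => f p - b p.1, N' ∩ {p | ‖f p - b p.1‖ < δ / 2}, ?_, ?_, ?_, ?_⟩
  · intro t ht q hq q' hq' h
    have h1 := (hφ' t ht q hq).2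
    have h2 := (hφ' t ht q' hq').2
    rw [h, h2] at h1
    exact (add_left_cancel (congrArg (fun w : ℝ × Vec n => w.2) h1)).symm
  · intro t ht q hq
    have hinj : Function.Injective (mfderiv 𝓘(ℝ, Vec n) (𝓡 n) (φ t) q) := by
      have h1 : MDifferentiableAt 𝓘(ℝ, Vec n) (𝓡 n) (φ t) q := by
        have h2 : ContMDiffAt 𝓘(ℝ, Vec n) (𝓘(ℝ, ℝ).prod 𝓘(ℝ, Vec n)) ∞
            (fun q : Vec n => (t, q)) q := contMDiffAt_const.prodMk contMDiffAt_id
        exact (ContMDiffAt.comp q (g := fun p : ℝ × Vec n => φ p.1 p.2) (hsmooth t ht q hq)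
          h2).mdifferentiableAt (by simp)
      have h3 : MDifferentiableAt (𝓡 n) 𝓘(ℝ, Vec n) (fun x => P t (e x)) (φ t q) :=
        (ContMDiff.clm_apply contMDiff_const he).mdifferentiableAt (n := ∞) (by simp)
      have h4 := mfderiv_comp q h3 h1
      -- Composed with `x ↦ P(t) e(x)`, the map `φ(t, ·)` becomes the translation by `b(t)`; hence
      -- its differential has a left inverse, and is bijective since dimensions agree.
      have h5 : (fun x => P t (e x)) ∘ φ t =ᶠ[𝓝 q] fun q => b t + q := by
        filter_upwards [Metric.isOpen_ball.mem_nhds hq] with q' hq'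
        exact congrArg (fun w : ℝ × Vec n => w.2) (hφ' t ht q' hq').2
      rw [mfderiv_eq_fderiv, h5.fderiv_eq, fderiv_const_add, fderiv_fun_id] at h4
      intro v v' hv
      have h6 := DFunLike.congr_fun h4 v
      have h7 := DFunLike.congr_fun h4 v'
      refine h6.trans (Eq.trans ?_ h7.symm)
      exact congrArg (mfderiv (𝓡 n) 𝓘(ℝ, Vec n) (fun x => P t (e x)) (φ t q)) hv
    let A : Vec n →L[ℝ] Vec n := mfderiv 𝓘(ℝ, Vec n) (𝓡 n) (φ t) q
    have hA : Function.Injective (A : Vec n →ₗ[ℝ] Vec n) := hinj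
    have hA' : Function.Surjective (A : Vec n →ₗ[ℝ] Vec n) := LinearMap.injective_iff_surjective.1 hA
    exact ⟨hinj, hA'⟩
  · exact hf.sub (hb.contMDiff.comp contMDiff_fst)
  · exact hN'o.inter (isOpen_lt (hf.continuous.sub
      (hb.continuous.comp continuous_fst)).norm continuous_const)
  · intro t ht
    refine ⟨hGN' ⟨t, ht, rfl⟩, ?_⟩
    have := hbf t
    rw [norm_sub_rev] at this
    exact this
  · rintro ⟨t, x⟩ ⟨hp1, hp2⟩ -
    refine ⟨mem_ball_zero_iff.2 hp2, hφ _ hp1 _ _ ?_⟩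
    refine Prod.ext rfl ?_
    change f (t, x) = b t + (f (t, x) - b t)
    abel

end Existence

/-! ### Curves of class `W^{1,2}` on `M` in coordinates -/

/-- A `C¹` map is locally Lipschitz and extends from a neighbourhood to a globally Lipschitz map;
the increments of the composition are then at most `K' ∫ (1 + |w'|)`, so `W12.exists_of_dist_le`
applies. -/
lemma W12.exists_comp_locally {n m : ℕ} {H : ℝ × Vec n → Vec m} (w : W12 n) {t₀ : ℝ}
    (ht₀ : t₀ ∈ Icc (0 : ℝ) 1) (hH : ContDiffAt ℝ 1 H (t₀, w t₀)) :
    ∃ u : W12 m, ∀ᶠ t in 𝓝[Icc 0 1] t₀, H (t, w t) = u t := by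
  obtain ⟨K, s, hs, hK⟩ := hH.exists_lipschitzOnWith
  obtain ⟨H', hH', heq⟩ := hK.extend_finite_dimension
  set K' := lipschitzExtensionConstant (Vec m) * K
  have hh : MemLp (fun t => (K' : ℝ) * (1 + ‖der w t‖)) 2 mu01 :=
    ((memLp_const (1 : ℝ)).add (Lp.memLp (der w)).norm).const_mul (K' : ℝ)
  obtain ⟨u, hu⟩ := W12.exists_of_dist_le (fun t => H' (t, w t)) _ hh (by
    intro x hx y hy hxy
    have h1 := hH'.dist_le_mul (y, w y) (x, w x)
    rw [dist_eq_norm] at h1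
    have h2 : dist ((y, w y) : ℝ × Vec n) (x, w x) ≤ (y - x) + ‖w y - w x‖ := by
      rw [Prod.dist_eq]
      refine max_le ?_ ?_
      · rw [Real.dist_eq, abs_of_nonneg (by linarith)]
        linarith [norm_nonneg (w y - w x)]
      · rw [dist_eq_norm]; linarith
    have h3 : ‖w y - w x‖ ≤ ∫ r in x..y, ‖der w r‖ := by
      rw [W12.sub_eq w hx hy]
      exact intervalIntegral.norm_integral_le_integral_norm hxy
    rw [intervalIntegral.integral_const_mul, intervalIntegral.integral_add
        intervalIntegrable_const (L2.intervalIntegrable _ hx hy).norm]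
    refine h1.trans (mul_le_mul_of_nonneg_left ?_ K'.2)
    simp only [intervalIntegral.integral_const, smul_eq_mul, mul_one]
    linarith)
  refine ⟨u, ?_⟩
  have h1 : Tendsto (fun t => (t, w t)) (𝓝[Icc 0 1] t₀) (𝓝 (t₀, w t₀)) :=
    (continuousWithinAt_id.prodMk (W12.continuousOn w t₀ ht₀)).tendsto
  filter_upwards [h1 hs, self_mem_nhdsWithin] with t ht htI
  rw [hu t htI]
  exact heq ht

section Lift

variable {n m : ℕ} {M : Type*} [TopologicalSpace M] [ChartedSpace (Vec n) M]

lemma W12Curve.continuous_ext (γ : W12Curve n M) : Continuous γ.ext :=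
  γ.1.continuous.comp continuous_projIcc

lemma W12Curve.ext_coe (γ : W12Curve n M) (t : unitInterval) : γ.ext t = γ.1 t := by
  rw [W12Curve.ext, projIcc_val]

variable [IsManifold (𝓡 n) ∞ M]

/-- The composition of a curve of class `W^{1,2}` with a smooth map. -/
lemma W12Curve.exists_comp {F : ℝ × M → Vec m}
    (hF : ContMDiff (𝓘(ℝ, ℝ).prod (𝓡 n)) 𝓘(ℝ, Vec m) ∞ F) (γ : W12Curve n M) :
    ∃ u : W12 m, ∀ t ∈ Icc (0 : ℝ) 1, u t = F (t, γ.ext t) := by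
  refine W12.exists_of_locally (fun t => F (t, γ.ext t)) fun t₀ ht₀ => ?_
  obtain ⟨w, hw⟩ := γ.2 ⟨t₀, ht₀⟩
  set q₀ := γ.1 ⟨t₀, ht₀⟩ with hq₀
  set c := extChartAt (𝓡 n) q₀ with hc
  have hext : γ.ext t₀ = q₀ := γ.ext_coe ⟨t₀, ht₀⟩
  have hw' : ∀ᶠ t in 𝓝[Icc 0 1] t₀, c (γ.ext t) = w t := by
    refine (eventually_nhds_subtype_iff (Icc (0 : ℝ) 1) ⟨t₀, ht₀⟩
      (fun t => c (γ.ext t) = w t)).1 ?_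
    filter_upwards [hw] with t ht
    rw [γ.ext_coe]
    exact ht
  have hw0 : c q₀ = w t₀ := by
    have := hw'.self_of_nhdsWithin ht₀
    rwa [hext] at this
  have hH : ContDiffAt ℝ ∞ (fun p : ℝ × Vec n => F (p.1, c.symm p.2)) (t₀, w t₀) := by
    have h1 : ContMDiffAt 𝓘(ℝ, Vec n) (𝓡 n) ∞ c.symm (w t₀) := by
      rw [← hw0]
      exact ((contMDiffOn_extChartAt_symm (n := ∞) q₀) _ (mem_extChartAt_target q₀)).contMDiffAt
        (mem_extChartAt_target_nhds q₀ (mem_extChartAt_target q₀))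
    have h2 : ContMDiffAt 𝓘(ℝ, ℝ × Vec n) (𝓘(ℝ, ℝ).prod (𝓡 n)) ∞
        (fun p : ℝ × Vec n => (p.1, c.symm p.2)) (t₀, w t₀) :=
      ContMDiffAt.prodMk (contMDiffAt_iff_contDiffAt.2 contDiffAt_fst)
        (ContMDiffAt.comp (t₀, w t₀) (g := c.symm) (f := Prod.snd) h1
          (contMDiffAt_iff_contDiffAt.2 contDiffAt_snd))
    exact (hF.contMDiffAt.comp (t₀, w t₀) h2).contDiffAt
  obtain ⟨u, hu⟩ := W12.exists_comp_locally w ht₀ (hH.of_le (one_le_two.trans two_le_infty))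
  refine ⟨u, ?_⟩
  have hsrc : ∀ᶠ t in 𝓝[Icc 0 1] t₀, γ.ext t ∈ c.source := by
    refine mem_nhdsWithin_of_mem_nhds (γ.continuous_ext.continuousAt.preimage_mem_nhds ?_)
    rw [hext]
    exact extChartAt_source_mem_nhds q₀
  filter_upwards [hu, hw', hsrc] with t h1 h2 h3
  rw [← h1, ← h2, c.left_inv h3]

/-- A curve of class `W^{1,2}` contained in the image of a coordinate system is in the image of the
corresponding local parametrization. -/
lemma PathChart.exists_push_eq (κ : PathChart n M) {F : ℝ × M → Vec n}
    (hF : ContMDiff (𝓘(ℝ, ℝ).prod (𝓡 n)) 𝓘(ℝ, Vec n) ∞ F) (γ : W12Curve n M)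
    (hγ : ∀ t ∈ Icc (0 : ℝ) 1, F (t, γ.ext t) ∈ κ.U ∧ κ.φ t (F (t, γ.ext t)) = γ.ext t) :
    ∃ u : κ.dom, κ.push u = γ ∧ ∀ t ∈ Icc (0 : ℝ) 1, u.1 t = F (t, γ.ext t) := by
  obtain ⟨u, hu⟩ := γ.exists_comp hF
  refine ⟨⟨u, fun t ht => ?_⟩, ?_, hu⟩
  · rw [hu t ht]; exact (hγ t ht).1
  · refine Subtype.ext (ContinuousMap.ext fun t => ?_)
    change κ.φ t (u t) = γ.1 t
    rw [hu t t.2, (hγ t t.2).2, γ.ext_coe]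

theorem W12Curve.exists_push_eq [T2Space M] [CompactSpace M] (γ : W12Curve n M) :
    ∃ (κ : PathChart n M) (u : κ.dom), κ.push u = γ := by
  obtain ⟨κ, F, W, hF, -, hγW, hW⟩ := exists_pathChart (n := n) γ.continuous_ext
  obtain ⟨u, hu, -⟩ := κ.exists_push_eq hF γ fun t ht => hW _ (hγW t ht) ht
  exact ⟨κ, u, hu⟩

theorem intervalIntegrable_actionIntegrand [T2Space M] [CompactSpace M] {g : RMetric n M}
    {L : ℝ × TangentBundle (𝓡 n) M → ℝ}
    (hL : ContMDiffOn (𝓘(ℝ, ℝ).prod (𝓡 n).tangent) 𝓘(ℝ, ℝ) 2 L (Icc (0 : ℝ) 1 ×ˢ univ))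
    (hL1 : IsUniformlyConvex g L) (hL2 : HasQuadraticBounds g L) (γ : W12Curve n M) :
    IntervalIntegrable (actionIntegrand L γ.ext) volume 0 1 := by
  obtain ⟨κ, u, rfl⟩ := γ.exists_push_eq
  rw [intervalIntegrable_iff_mu01]
  exact (κ.integrable_lagr hL hL1 hL2 u.2).congr (κ.actionIntegrand_push L u).symm

end Lift

/-! ### The Koszul formula and the Christoffel symbols -/

lemma contDiffOn_bilinearComp {X E V : Type*} [NormedAddCommGroup X] [NormedSpace ℝ X]
    [NormedAddCommGroup E] [NormedSpace ℝ E] [FiniteDimensional ℝ E] [NormedAddCommGroup V]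
    [NormedSpace ℝ V] {B : X → V →L[ℝ] V →L[ℝ] ℝ} {D : X → E →L[ℝ] V} {s : Set X}
    {k : WithTop ℕ∞} (hB : ContDiffOn ℝ k B s) (hD : ContDiffOn ℝ k D s) :
    ContDiffOn ℝ k (fun p => (B p).bilinearComp (D p) (D p)) s := by
  rw [contDiffOn_clm_apply]
  intro v
  rw [contDiffOn_clm_apply]
  intro w
  exact (hB.clm_apply (hD.clm_apply contDiffOn_const)).clm_apply (hD.clm_apply contDiffOn_const)

section Koszul

variable {E V : Type*} [NormedAddCommGroup E] [NormedSpace ℝ E] [NormedAddCommGroup V]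
  [NormedSpace ℝ V]

/-- The derivative of the pull-back of a family of bilinear forms. -/
lemma fderiv_bilinearComp_apply {ψ : E → V} {G : V → V →L[ℝ] V →L[ℝ] ℝ} {p : E}
    (hψ : ContDiffAt ℝ 2 ψ p) (hG : DifferentiableAt ℝ G (ψ p))
    (hd : DifferentiableAt ℝ (fun p => (G (ψ p)).bilinearComp (fderiv ℝ ψ p) (fderiv ℝ ψ p)) p)
    (A B Z : E) :
    fderiv ℝ (fun p => (G (ψ p)).bilinearComp (fderiv ℝ ψ p) (fderiv ℝ ψ p)) p A B Z =
      fderiv ℝ G (ψ p) (fderiv ℝ ψ p A) (fderiv ℝ ψ p B) (fderiv ℝ ψ p Z) +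
      G (ψ p) (fderiv ℝ (fderiv ℝ ψ) p A B) (fderiv ℝ ψ p Z) +
      G (ψ p) (fderiv ℝ ψ p B) (fderiv ℝ (fderiv ℝ ψ) p A Z) := by
  have h1 : HasFDerivAt ψ (fderiv ℝ ψ p) p := (hψ.differentiableAt (by simp)).hasFDerivAt
  have h2 : HasFDerivAt (fderiv ℝ ψ) (fderiv ℝ (fderiv ℝ ψ) p) p :=
    ((hψ.fderiv_right (m := 1) (by norm_num)).differentiableAt (by simp)).hasFDerivAt
  have h3 : HasFDerivAt (fun p => G (ψ p)) ((fderiv ℝ G (ψ p)).comp (fderiv ℝ ψ p)) p :=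
    HasFDerivAt.comp p (g := G) hG.hasFDerivAt h1
  have h7 : HasFDerivAt (fun p => (G (ψ p)).bilinearComp (fderiv ℝ ψ p) (fderiv ℝ ψ p) B Z)
      (((fderiv ℝ (fun p => (G (ψ p)).bilinearComp (fderiv ℝ ψ p) (fderiv ℝ ψ p)) p).flip B).flip
        Z) p :=
    ((hd.hasFDerivAt.clm_apply (hasFDerivAt_const B p)).clm_apply
      (hasFDerivAt_const Z p)).congr_fderiv (by ext; simp)
  have h8 := (h3.clm_apply (h2.clm_apply (hasFDerivAt_const B p))).clm_apply
    (h2.clm_apply (hasFDerivAt_const Z p))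
  have h9 := DFunLike.congr_fun (h7.unique h8) A
  simp only [ContinuousLinearMap.flip_apply] at h9
  rw [h9]
  simp
  ring

/-- The Koszul formula for a pull-back. -/
lemma koszul_bilinearComp {ψ : E → V} {G : V → V →L[ℝ] V →L[ℝ] ℝ} {p : E}
    (hψ : ContDiffAt ℝ 2 ψ p) (hG : DifferentiableAt ℝ G (ψ p))
    (hsymm : ∀ v w, G (ψ p) v w = G (ψ p) w v) {Gh : E → E →L[ℝ] E →L[ℝ] ℝ}
    (hGh : Gh =ᶠ[𝓝 p] fun p => (G (ψ p)).bilinearComp (fderiv ℝ ψ p) (fderiv ℝ ψ p))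
    (hd : DifferentiableAt ℝ Gh p) (A B Z : E) :
    fderiv ℝ Gh p A B Z + fderiv ℝ Gh p B A Z - fderiv ℝ Gh p Z A B =
      2 * G (ψ p) (fderiv ℝ (fderiv ℝ ψ) p A B) (fderiv ℝ ψ p Z) +
      (fderiv ℝ G (ψ p) (fderiv ℝ ψ p A) (fderiv ℝ ψ p B) (fderiv ℝ ψ p Z) +
        fderiv ℝ G (ψ p) (fderiv ℝ ψ p B) (fderiv ℝ ψ p A) (fderiv ℝ ψ p Z) -
        fderiv ℝ G (ψ p) (fderiv ℝ ψ p Z) (fderiv ℝ ψ p A) (fderiv ℝ ψ p B)) := by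
  have hs : IsSymmSndFDerivAt ℝ ψ p := hψ.isSymmSndFDerivAt (by simp)
  replace hd := hGh.differentiableAt_iff.1 hd
  -- The six terms with second derivatives of `ψ` cancel in pairs by symmetry, except for the two
  -- equal terms containing `D²ψ(A, B)`.
  rw [hGh.fderiv_eq, fderiv_bilinearComp_apply hψ hG hd, fderiv_bilinearComp_apply hψ hG hd,
    fderiv_bilinearComp_apply hψ hG hd, hs.eq B A, hs.eq Z A, hs.eq Z B,
    hsymm (fderiv ℝ (fderiv ℝ ψ) p A Z), hsymm (fderiv ℝ ψ p A)]
  ring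

end Koszul

section Christoffel

variable {n : ℕ} {M : Type*} [TopologicalSpace M] [ChartedSpace (Vec n) M]
  [IsManifold (𝓡 n) ∞ M]

lemma vec_eq_sum_single (v : Vec n) : v = ∑ i, v i • EuclideanSpace.single i (1 : ℝ) := by
  ext k
  simp [Finset.sum_apply, Pi.single_apply]

lemma metricMatrix_eq (g : RMetric n M) (q₀ : M) (x : Vec n) (i j : Fin n) :
    metricMatrix g q₀ x i j =
      chartMetric g q₀ x (EuclideanSpace.single i 1) (EuclideanSpace.single j 1) := by
  rw [chartMetric_apply]
  rfl

lemma chartMetric_eq_sum (g : RMetric n M) (q₀ : M) (x v w : Vec n) :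
    chartMetric g q₀ x v w = ∑ i, ∑ j, v i * w j * metricMatrix g q₀ x i j := by
  conv_lhs => rw [vec_eq_sum_single v, vec_eq_sum_single w]
  simp only [map_sum, map_smul, FunLike.coe_sum, FunLike.coe_smul, Finset.sum_apply, Pi.smul_apply,
    smul_eq_mul, metricMatrix_eq, Finset.mul_sum]
  rw [Finset.sum_comm]
  refine Finset.sum_congr rfl fun i _ => Finset.sum_congr rfl fun j _ => by ring

/-- A vector in the kernel of the matrix would have length zero. -/
lemma metricMatrix_mul_inv (g : RMetric n M) (q₀ : M) {x : Vec n}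
    (hx : x ∈ (extChartAt (𝓡 n) q₀).target) :
    metricMatrix g q₀ x * (metricMatrix g q₀ x)⁻¹ = 1 := by
  refine Matrix.mul_nonsing_inv _ ?_
  rw [isUnit_iff_ne_zero]
  intro h0
  obtain ⟨v, hv, hv0⟩ := Matrix.exists_mulVec_eq_zero_iff.2 h0
  have h1 : chartMetric g q₀ x (WithLp.toLp 2 v) (WithLp.toLp 2 v) = 0 := by
    rw [chartMetric_eq_sum]
    refine Finset.sum_eq_zero fun i _ => ?_
    have h2 := congrFun hv0 i
    simp only [Matrix.mulVec, dotProduct, Pi.zero_apply] at h2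
    have h3 : ∑ j, v i * v j * metricMatrix g q₀ x i j = v i * ∑ j, metricMatrix g q₀ x i j * v j := by
      rw [Finset.mul_sum]
      exact Finset.sum_congr rfl fun j _ => by ring
    rw [h2, mul_zero] at h3
    exact h3
  refine (chartMetric_pos g q₀ hx (v := WithLp.toLp 2 v) fun h => hv ?_).ne' h1
  exact congrArg WithLp.ofLp h

lemma differentiableAt_chartMetric (g : RMetric n M) (q₀ : M) {x : Vec n}
    (hx : x ∈ (extChartAt (𝓡 n) q₀).target) : DifferentiableAt ℝ (chartMetric g q₀) x :=
  ((contDiffOn_chartMetric g q₀).contDiffAt (mem_extChartAt_target_nhds q₀ hx)).differentiableAt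
    (by simp)

lemma metricPartial_eq (g : RMetric n M) (q₀ : M) {x : Vec n}
    (hx : x ∈ (extChartAt (𝓡 n) q₀).target) (k i j : Fin n) :
    metricPartial g q₀ x k i j = fderiv ℝ (chartMetric g q₀) x (EuclideanSpace.single k 1)
      (EuclideanSpace.single i 1) (EuclideanSpace.single j 1) := by
  have h1 := (differentiableAt_chartMetric g q₀ hx).hasFDerivAt
  have h2 := (h1.clm_apply (hasFDerivAt_const (EuclideanSpace.single i (1 : ℝ)) x)).clm_apply
    (hasFDerivAt_const (EuclideanSpace.single j (1 : ℝ)) x)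
  rw [metricPartial]
  simp only [metricMatrix_eq]
  rw [h2.fderiv]
  simp

lemma fderiv_chartMetric_eq_sum (g : RMetric n M) (q₀ : M) {x : Vec n}
    (hx : x ∈ (extChartAt (𝓡 n) q₀).target) (a b z : Vec n) :
    fderiv ℝ (chartMetric g q₀) x a b z =
      ∑ l, ∑ i, ∑ j, z l * (a i * b j * metricPartial g q₀ x i j l) := by
  conv_lhs => rw [vec_eq_sum_single a, vec_eq_sum_single b, vec_eq_sum_single z]
  simp only [map_sum, map_smul, FunLike.coe_sum, FunLike.coe_smul, Finset.sum_apply, Pi.smul_apply,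
    smul_eq_mul, metricPartial_eq g q₀ hx, Finset.mul_sum]
  refine Finset.sum_congr rfl fun l _ => ?_
  rw [Finset.sum_comm]
  refine Finset.sum_congr rfl fun i _ => Finset.sum_congr rfl fun j _ => by ring

/-- The Christoffel symbols as a bilinear map. -/
def christoffelVec (g : RMetric n M) (q₀ : M) (x a b : Vec n) : Vec n :=
  WithLp.toLp 2 fun k => ∑ i, ∑ j, christoffel g q₀ x k i j * a i * b j

/-- The Christoffel symbols satisfy the Koszul formula. -/
lemma chartMetric_christoffelVec (g : RMetric n M) (q₀ : M) {x : Vec n}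
    (hx : x ∈ (extChartAt (𝓡 n) q₀).target) (a b z : Vec n) :
    2 * chartMetric g q₀ x (christoffelVec g q₀ x a b) z =
      fderiv ℝ (chartMetric g q₀) x a b z + fderiv ℝ (chartMetric g q₀) x b a z -
        fderiv ℝ (chartMetric g q₀) x z a b := by
  have hinv : ∀ l m, ∑ k, metricMatrix g q₀ x l k * (metricMatrix g q₀ x)⁻¹ k m =
      if l = m then 1 else 0 := by
    intro l m
    have := congrFun (congrFun (metricMatrix_mul_inv g q₀ hx) l) m
    rwa [Matrix.mul_apply, Matrix.one_apply] at this
  let T : Fin n → Fin n → Fin n → ℝ := fun i j m =>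
    metricPartial g q₀ x i j m + metricPartial g q₀ x j i m - metricPartial g q₀ x m i j
  have h1 : ∀ l i j, 2 * ∑ k, metricMatrix g q₀ x l k * christoffel g q₀ x k i j = T i j l := by
    intro l i j
    calc 2 * ∑ k, metricMatrix g q₀ x l k * christoffel g q₀ x k i j
        = ∑ k, ∑ m, metricMatrix g q₀ x l k * (metricMatrix g q₀ x)⁻¹ k m * T i j m := by
          rw [Finset.mul_sum]
          refine Finset.sum_congr rfl fun k _ => ?_
          rw [christoffel, Finset.mul_sum, Finset.mul_sum, Finset.mul_sum]
          exact Finset.sum_congr rfl fun m _ => by ring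
      _ = ∑ m, (∑ k, metricMatrix g q₀ x l k * (metricMatrix g q₀ x)⁻¹ k m) * T i j m := by
          rw [Finset.sum_comm]
          exact Finset.sum_congr rfl fun m _ => by rw [Finset.sum_mul]
      _ = T i j l := by simp [hinv]
  have hL : 2 * chartMetric g q₀ x (christoffelVec g q₀ x a b) z =
      ∑ l, ∑ i, ∑ j, z l * (a i * b j * T i j l) := by
    rw [chartMetric_symm, chartMetric_eq_sum, Finset.mul_sum]
    refine Finset.sum_congr rfl fun l _ => ?_
    calc 2 * ∑ k, z l * christoffelVec g q₀ x a b k * metricMatrix g q₀ x l k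
        = ∑ k, ∑ i, ∑ j, z l * (a i * b j *
            (2 * (metricMatrix g q₀ x l k * christoffel g q₀ x k i j))) := by
          rw [Finset.mul_sum]
          refine Finset.sum_congr rfl fun k _ => ?_
          simp only [christoffelVec, Finset.mul_sum, Finset.sum_mul]
          refine Finset.sum_congr rfl fun i _ => Finset.sum_congr rfl fun j _ => by ring
      _ = ∑ i, ∑ j, ∑ k, z l * (a i * b j *
            (2 * (metricMatrix g q₀ x l k * christoffel g q₀ x k i j))) := by
          rw [Finset.sum_comm]
          exact Finset.sum_congr rfl fun i _ => Finset.sum_comm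
      _ = _ := by
          refine Finset.sum_congr rfl fun i _ => Finset.sum_congr rfl fun j _ => ?_
          rw [← h1 l i j, Finset.mul_sum, Finset.mul_sum, Finset.mul_sum]
  rw [hL, fderiv_chartMetric_eq_sum g q₀ hx, fderiv_chartMetric_eq_sum g q₀ hx]
  have h3 : ∑ l, ∑ i, ∑ j, z l * (b i * a j * metricPartial g q₀ x i j l) =
      ∑ l, ∑ i, ∑ j, z l * (a i * b j * metricPartial g q₀ x j i l) := by
    refine Finset.sum_congr rfl fun l _ => ?_
    rw [Finset.sum_comm]
    exact Finset.sum_congr rfl fun i _ => Finset.sum_congr rfl fun j _ => by ring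
  have h4 : fderiv ℝ (chartMetric g q₀) x z a b =
      ∑ l, ∑ i, ∑ j, z l * (a i * b j * metricPartial g q₀ x l i j) := by
    rw [fderiv_chartMetric_eq_sum g q₀ hx]
    calc ∑ j, ∑ l, ∑ i, b j * (z l * a i * metricPartial g q₀ x l i j)
        = ∑ l, ∑ i, ∑ j, b j * (z l * a i * metricPartial g q₀ x l i j) := by
          rw [Finset.sum_comm]
          exact Finset.sum_congr rfl fun l _ => Finset.sum_comm
      _ = _ := by
          refine Finset.sum_congr rfl fun l _ => Finset.sum_congr rfl fun i _ =>
            Finset.sum_congr rfl fun j _ => by ring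
  rw [h3, h4, ← Finset.sum_add_distrib, ← Finset.sum_sub_distrib]
  refine Finset.sum_congr rfl fun l _ => ?_
  rw [← Finset.sum_add_distrib, ← Finset.sum_sub_distrib]
  refine Finset.sum_congr rfl fun i _ => ?_
  rw [← Finset.sum_add_distrib, ← Finset.sum_sub_distrib]
  exact Finset.sum_congr rfl fun j _ => by simp only [T]; ring

end Christoffel

section Inner

variable {n : ℕ} {M : Type*} [TopologicalSpace M] [ChartedSpace (Vec n) M]
  [IsManifold (𝓡 n) ∞ M]

lemma inner_congr (g : RMetric n M) {x y : M} (h : x = y) {v w : TangentSpace (𝓡 n) x}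
    {v' w' : TangentSpace (𝓡 n) y} (hv : (v : Vec n) = (v' : Vec n))
    (hw : (w : Vec n) = (w' : Vec n)) : g.inner x v w = g.inner y v' w' := by
  subst h
  obtain rfl : v = v' := hv
  obtain rfl : w = w' := hw
  rfl

/-- The tangent space at `q₀` is identified with `ℝⁿ` by the preferred chart at `q₀`, so the
differential of its inverse there is the identity. `covDeriv`, defined in the chart at the base
point, can thus be read as a coordinate vector. -/
lemma coordVec_self (q₀ : M) (v : Vec n) :
    (coordVec q₀ (extChartAt (𝓡 n) q₀ q₀) v : Vec n) = v := by
  have h1 := TangentBundle.symmL_trivializationAt (I := 𝓡 n) (x₀ := q₀) (x := q₀)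
    (mem_chart_source (Vec n) q₀)
  have h2 := TangentBundle.symmL_trivializationAt_eq_core (I := 𝓡 n) (b₀ := q₀) (b := q₀) (𝕜 := ℝ)
    (mem_chart_source (Vec n) q₀)
  rw [h2] at h1
  have h3 := tangentCoordChange_self (I := 𝓡 n) (x := q₀) (z := q₀) (v := v)
    (mem_extChartAt_source q₀)
  have h4 : mfderivWithin 𝓘(ℝ, Vec n) (𝓡 n) (extChartAt (𝓡 n) q₀).symm (range (𝓡 n))
      (extChartAt (𝓡 n) q₀ q₀) v = coordVec q₀ (extChartAt (𝓡 n) q₀ q₀) v := by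
    rw [modelWithCornersSelf_coe, range_id, mfderivWithin_univ]
    rfl
  exact (Eq.symm h4).trans ((DFunLike.congr_fun h1 v).symm.trans h3)

end Inner

/-! ### The pull-back of the metric to `[0,1] × U` -/

namespace PathChart

variable {n : ℕ} {M : Type*} [TopologicalSpace M] [ChartedSpace (Vec n) M]
  [IsManifold (𝓡 n) ∞ M]

/-- The pull-back of the metric by `(t, q) ↦ φ(t, q)`. -/
def pullMetric (κ : PathChart n M) (g : RMetric n M) (p : ℝ × Vec n) :
    ℝ × Vec n →L[ℝ] ℝ × Vec n →L[ℝ] ℝ :=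
  let B : Vec n →L[ℝ] Vec n →L[ℝ] ℝ := g.inner (κ.hat p)
  let A : ℝ × Vec n →L[ℝ] Vec n := mfderiv 𝓘(ℝ, ℝ × Vec n) (𝓡 n) κ.hat p
  B.bilinearComp A A

lemma pullMetric_apply (κ : PathChart n M) (g : RMetric n M) (p A B : ℝ × Vec n) :
    κ.pullMetric g p A B = g.inner (κ.hat p) (mfderiv 𝓘(ℝ, ℝ × Vec n) (𝓡 n) κ.hat p A)
      (mfderiv 𝓘(ℝ, ℝ × Vec n) (𝓡 n) κ.hat p B) := rfl

lemma pullMetric_eq (κ : PathChart n M) (g : RMetric n M) {q₁ : M} {t : ℝ}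
    (ht : t ∈ Ioo (0 : ℝ) 1) {q : Vec n} (hq : q ∈ κ.U)
    (hs : κ.hat (t, q) ∈ (extChartAt (𝓡 n) q₁).source) :
    κ.pullMetric g (t, q) = (chartMetric g q₁ (κ.rep q₁ (t, q))).bilinearComp
      (fderiv ℝ (κ.rep q₁) (t, q)) (fderiv ℝ (κ.rep q₁) (t, q)) := by
  refine ContinuousLinearMap.ext fun A => ContinuousLinearMap.ext fun B => ?_
  rw [pullMetric_apply, ContinuousLinearMap.bilinearComp_apply, chartMetric_apply]
  have h := fun X => mk_mfderiv_eq_coordVec (κ.mdifferentiableAt_hat ht hq) q₁ hs X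
  exact inner_congr g ((extChartAt (𝓡 n) q₁).left_inv hs).symm (eq_of_totalSpace_mk_eq (h A))
    (eq_of_totalSpace_mk_eq (h B))

lemma pullMetric_eventuallyEq (κ : PathChart n M) (g : RMetric n M) {q₁ : M} {t : ℝ}
    (ht : t ∈ Ioo (0 : ℝ) 1) {q : Vec n} (hq : q ∈ κ.U)
    (hs : κ.hat (t, q) ∈ (extChartAt (𝓡 n) q₁).source) :
    κ.pullMetric g =ᶠ[𝓝 (t, q)] fun p => (chartMetric g q₁ (κ.rep q₁ p)).bilinearComp
      (fderiv ℝ (κ.rep q₁) p) (fderiv ℝ (κ.rep q₁) p) := by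
  have h1 : ∀ᶠ p : ℝ × Vec n in 𝓝 (t, q), p ∈ Ioo (0 : ℝ) 1 ×ˢ κ.U :=
    prod_mem_nhds (Ioo_mem_nhds ht.1 ht.2) (κ.isOpen_U.mem_nhds hq)
  have h2 : ∀ᶠ p : ℝ × Vec n in 𝓝 (t, q), κ.hat p ∈ (extChartAt (𝓡 n) q₁).source :=
    (κ.contMDiffAt_hat ht hq).continuousAt.eventually
      ((isOpen_extChartAt_source q₁).mem_nhds hs)
  filter_upwards [h1, h2] with p h3 h4 using κ.pullMetric_eq g h3.1 h3.2 h4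

/-- Near a point, the pull-back of the metric is of class `C^∞` up to the boundary. -/
lemma contDiffWithinAt_pullMetric (κ : PathChart n M) (g : RMetric n M) {q₁ : M}
    {p₀ : ℝ × Vec n} (hp₀ : p₀ ∈ Icc (0 : ℝ) 1 ×ˢ κ.U)
    (hs : κ.hat p₀ ∈ (extChartAt (𝓡 n) q₁).source) :
    ContDiffWithinAt ℝ ∞ (fun p => (chartMetric g q₁ (κ.rep q₁ p)).bilinearComp
      (fderivWithin ℝ (κ.rep q₁) (Icc (0 : ℝ) 1 ×ˢ κ.U) p)
      (fderivWithin ℝ (κ.rep q₁) (Icc (0 : ℝ) 1 ×ˢ κ.U) p)) (Icc (0 : ℝ) 1 ×ˢ κ.U) p₀ := by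
  set S := Icc (0 : ℝ) 1 ×ˢ κ.U with hS
  set S' := S ∩ κ.hat ⁻¹' (extChartAt (𝓡 n) q₁).source with hS'
  have hmem : S' ∈ 𝓝[S] p₀ := inter_mem self_mem_nhdsWithin
    ((κ.contMDiffOn_hat p₀ hp₀).continuousWithinAt
      ((isOpen_extChartAt_source q₁).mem_nhds hs))
  have h1 : ContDiffOn ℝ ∞ (κ.rep q₁) S' := fun p hp =>
    (κ.contDiffWithinAt_rep hp.1 hp.2).mono inter_subset_left
  have h2 : ContDiffOn ℝ ∞ (fun p => chartMetric g q₁ (κ.rep q₁ p)) S' :=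
    (contDiffOn_chartMetric g q₁).comp h1 fun p hp => (extChartAt (𝓡 n) q₁).map_source hp.2
  have h3 : ContDiffOn ℝ ∞ (fderivWithin ℝ (κ.rep q₁) S) S' := fun p hp =>
    ((κ.contDiffWithinAt_rep hp.1 hp.2).fderivWithin_right κ.uniqueDiffOn (by simp) hp.1).mono
      inter_subset_left
  exact ((contDiffOn_bilinearComp h2 h3) p₀ ⟨hp₀, hs⟩).mono_of_mem_nhdsWithin hmem

lemma differentiableAt_pullMetric (κ : PathChart n M) (g : RMetric n M) {t : ℝ}
    (ht : t ∈ Ioo (0 : ℝ) 1) {q : Vec n} (hq : q ∈ κ.U) :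
    DifferentiableAt ℝ (κ.pullMetric g) (t, q) := by
  have hs := mem_extChartAt_source (I := 𝓡 n) (κ.hat (t, q))
  have h1 := (κ.contDiffWithinAt_pullMetric g ⟨Ioo_subset_Icc_self ht, hq⟩ hs).contDiffAt
    (κ.domain_mem_nhds ht hq)
  refine (h1.differentiableAt (by simp)).congr_of_eventuallyEq
    ((κ.pullMetric_eventuallyEq g ht hq hs).trans ?_)
  have h2 : (t, q) ∈ interior (Icc (0 : ℝ) 1 ×ˢ κ.U) :=
    mem_interior_iff_mem_nhds.2 (κ.domain_mem_nhds ht hq)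
  filter_upwards [fderivWithin_eventuallyEq_of_mem_interior (f := κ.rep (κ.hat (t, q))) h2]
    with p hp
  rw [hp]

lemma pullMetric_self_nonneg (κ : PathChart n M) (g : RMetric n M) (p A : ℝ × Vec n) :
    0 ≤ κ.pullMetric g p A A := by
  rw [pullMetric_apply]
  by_cases h : mfderiv 𝓘(ℝ, ℝ × Vec n) (𝓡 n) κ.hat p A = 0
  · rw [h]
    exact (map_zero (g.inner (κ.hat p) 0)).ge
  · exact (g.pos _ _ h).le

/-- Bounds for the pull-back of the metric. -/
structure MetricEst (κ : PathChart n M) (g : RMetric n M) (t C : ℝ) (S : Set (Vec n)) : Prop where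
  bound : ∀ q ∈ S, ‖κ.pullMetric g (t, q)‖ ≤ C
  bound_fderiv : ∀ q ∈ S, ‖fderiv ℝ (κ.pullMetric g) (t, q)‖ ≤ C
  coercive : ∀ q ∈ S, ∀ b, ‖b‖ ^ 2 ≤ C * κ.pullMetric g (t, q) (0, b) (0, b)

/-- The pull-back is smooth up to the boundary times, which bounds it and its derivative. It is
degenerate on `ℝ × ℝⁿ`, but coercive on spatial vectors, because the differential of `φ(t, ·)` is
injective with uniform constants. -/
lemma exists_metricEst (κ : PathChart n M) (g : RMetric n M) {t₀ : ℝ}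
    (ht₀ : t₀ ∈ Icc (0 : ℝ) 1) {q₀ : Vec n} (hq₀ : q₀ ∈ κ.U) :
    ∃ C, ∃ r > 0, ∀ t ∈ Ioo (0 : ℝ) 1, |t - t₀| < r →
      MetricEst κ g t C (Metric.ball q₀ r) := by
  set q₁ := κ.hat (t₀, q₀) with hq₁
  set S := Icc (0 : ℝ) 1 ×ˢ κ.U with hS
  have hmem : (t₀, q₀) ∈ S := ⟨ht₀, hq₀⟩
  have hSu : UniqueDiffOn ℝ S := κ.uniqueDiffOn
  have hsrc : κ.hat (t₀, q₀) ∈ (extChartAt (𝓡 n) q₁).source := mem_extChartAt_source q₁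
  set f1 := fderivWithin ℝ (κ.rep q₁) S with hf1
  have c0 := κ.contDiffWithinAt_rep hmem hsrc
  have c1 : ContDiffWithinAt ℝ ∞ f1 S (t₀, q₀) := c0.fderivWithin_right hSu (by simp) hmem
  obtain ⟨C, hC⟩ := exists_bound_fderiv hSu hmem
    ((κ.contDiffWithinAt_pullMetric g hmem hsrc).of_le (one_le_two.trans two_le_infty))
  obtain ⟨R, hR, hinj⟩ := exists_bound_of_injective
    (A := fun p => (f1 p).comp (ContinuousLinearMap.inr ℝ ℝ (Vec n)))
    (c1.continuousWithinAt.clm_comp continuousWithinAt_const)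
    (fun b hb => κ.injective_fderivWithin_rep ht₀ hq₀ hsrc hb)
  obtain ⟨c, hc, C', hC', hG⟩ := exists_chartMetric_bounds g q₁
  have hev : ∀ᶠ p in 𝓝[S] (t₀, q₀), κ.hat p ∈ (extChartAt (𝓡 n) q₁).source ∧
      ∀ v, c * ‖v‖ ^ 2 ≤ chartMetric g q₁ (κ.rep q₁ p) v v ∧
        chartMetric g q₁ (κ.rep q₁ p) v v ≤ C' * ‖v‖ ^ 2 := by
    refine ((κ.contMDiffOn_hat _ hmem).continuousWithinAt.eventually
      (extChartAt_source_mem_nhds (I := 𝓡 n) q₁)).and ?_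
    exact c0.continuousWithinAt.eventually hG
  obtain ⟨r₁, hr₁, hr₁U⟩ := Metric.isOpen_iff.1 κ.isOpen_U q₀ hq₀
  obtain ⟨r₂, hr₂, hall⟩ := Metric.eventually_nhds_iff_ball.1
    (eventually_nhdsWithin_iff.1 (hC.and (hinj.and hev)))
  refine ⟨max C (R ^ 2 / c), min r₁ r₂, by positivity, fun t ht htr => ?_⟩
  have hBU : ∀ q ∈ Metric.ball q₀ (min r₁ r₂), q ∈ κ.U := fun q hq => hr₁U
    (Metric.ball_subset_ball (min_le_left _ _) hq)
  have hint : ∀ q ∈ Metric.ball q₀ (min r₁ r₂), (t, q) ∈ interior S := fun q hq =>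
    mem_interior_iff_mem_nhds.2 (κ.domain_mem_nhds ht (hBU q hq))
  have hin : ∀ q ∈ Metric.ball q₀ (min r₁ r₂), (t, q) ∈ Metric.ball (t₀, q₀) r₂ := by
    intro q hq
    rw [Metric.mem_ball, Prod.dist_eq, Real.dist_eq]
    exact max_lt (htr.trans_le (min_le_right _ _))
      ((Metric.mem_ball.1 hq).trans_le (min_le_right _ _))
  have hfacts := fun q hq => hall (t, q) (hin q hq) (interior_subset (hint q hq))
  have he1 := fun q hq => fderivWithin_eventuallyEq_of_mem_interior (f := κ.rep q₁) (hint q hq)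
  have heq : ∀ q ∈ Metric.ball q₀ (min r₁ r₂), κ.pullMetric g =ᶠ[𝓝 (t, q)]
      fun p => (chartMetric g q₁ (κ.rep q₁ p)).bilinearComp (f1 p) (f1 p) := by
    intro q hq
    refine (κ.pullMetric_eventuallyEq g ht (hBU q hq) (hfacts q hq).2.2.1).trans ?_
    filter_upwards [he1 q hq] with p hp
    rw [← hp]
  refine ⟨fun q hq => ?_, fun q hq => ?_, fun q hq b => ?_⟩
  · rw [(heq q hq).self_of_nhds]
    exact (hfacts q hq).1.1.trans (le_max_left _ _)
  · rw [(heq q hq).fderiv_eq]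
    exact ((hfacts q hq).1.2 (hint q hq)).trans (le_max_left _ _)
  · have h1 := (hfacts q hq).2.1 b
    have h2 := ((hfacts q hq).2.2.2 (f1 (t, q) (0, b))).1
    have h3 : κ.pullMetric g (t, q) (0, b) (0, b) =
        chartMetric g q₁ (κ.rep q₁ (t, q)) (f1 (t, q) (0, b)) (f1 (t, q) (0, b)) := by
      rw [(heq q hq).self_of_nhds]
      rfl
    rw [← h3] at h2
    have h4 := κ.pullMetric_self_nonneg g (t, q) (0, b)
    have h5 : ‖b‖ ≤ R * ‖f1 (t, q) (0, b)‖ := h1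
    calc ‖b‖ ^ 2 ≤ (R * ‖f1 (t, q) (0, b)‖) ^ 2 := by gcongr
      _ = R ^ 2 / c * (c * ‖f1 (t, q) (0, b)‖ ^ 2) := by field_simp
      _ ≤ R ^ 2 / c * κ.pullMetric g (t, q) (0, b) (0, b) := by gcongr
      _ ≤ _ := by gcongr; exact le_max_right _ _

lemma exists_metricEst_along (κ : PathChart n M) (g : RMetric n M) {c : ℝ → Vec n}
    (hc : ContinuousOn c (Icc 0 1)) (hcU : ∀ t ∈ Icc (0 : ℝ) 1, c t ∈ κ.U) :
    ∃ C > 0, ∃ δ > 0, ∀ t ∈ Ioo (0 : ℝ) 1, MetricEst κ g t C (Metric.ball (c t) δ) :=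
  exists_uniform_along (fun t C S => MetricEst κ g t C S)
    (fun _ _ _ _ _ hC hS h => ⟨fun q hq => (h.bound q (hS hq)).trans hC,
      fun q hq => (h.bound_fderiv q (hS hq)).trans hC, fun q hq b => (h.coercive q (hS hq) b).trans
        (mul_le_mul_of_nonneg_right hC (κ.pullMetric_self_nonneg g _ _))⟩)
    (fun _ ht₀ _ hq₀ => κ.exists_metricEst g ht₀ hq₀) hc hcU

end PathChart

/-! ### The covariant derivative and the norm of sections -/

lemma abs_apply_apply_le {E : Type*} [NormedAddCommGroup E] [NormedSpace ℝ E]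
    {P : E →L[ℝ] E →L[ℝ] ℝ} {C : ℝ} (hP : ‖P‖ ≤ C) (X Y : E) : |P X Y| ≤ C * ‖X‖ * ‖Y‖ := by
  have h3 := P.le_opNorm₂ X Y
  rw [Real.norm_eq_abs] at h3
  exact h3.trans (by gcongr)

/-- In the application `N` is the squared length of the covariant derivative and `Z` represents that
vector in coordinates. The Koszul formula gives `N ≤ (3/2) C R ‖Z‖`, coercivity gives `‖Z‖² ≤ C N`;
together they bound `‖Z‖` by `(3/2) C² R`, and then `N`. -/
lemma le_of_koszul {E : Type*} [NormedAddCommGroup E] {P : E → E → ℝ} {D : E → E → E → ℝ}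
    {C N : ℝ} (hC0 : 0 ≤ C) {X Y W Z : E} (hP' : |P W Z| ≤ C * ‖W‖ * ‖Z‖)
    (hD' : ∀ X Y Z, |D X Y Z| ≤ C * ‖X‖ * ‖Y‖ * ‖Z‖) (hZ : ‖Z‖ ^ 2 ≤ C * N)
    (hN : 2 * N = D X Y Z + D Y X Z - D Z X Y + 2 * P W Z) :
    N ≤ 9 / 4 * C ^ 3 * (‖X‖ * ‖Y‖ + ‖W‖) ^ 2 := by
  set R := ‖X‖ * ‖Y‖ + ‖W‖ with hR
  have h5 : N ≤ 3 / 2 * C * R * ‖Z‖ := by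
    have e1 := (abs_le.1 (hD' X Y Z)).2
    have e2 := (abs_le.1 (hD' Y X Z)).2
    have e3 := (abs_le.1 (hD' Z X Y)).1
    have e4 := (abs_le.1 hP').2
    have e6 : 0 ≤ C * ‖W‖ * ‖Z‖ := by positivity
    rw [hR]
    linarith
  have h6 : ‖Z‖ ≤ 3 / 2 * C ^ 2 * R := by
    by_contra hcon
    have hcon := not_le.1 hcon
    have hpos : 0 < ‖Z‖ := lt_of_le_of_lt (by positivity) hcon
    have h7 : ‖Z‖ ^ 2 ≤ 3 / 2 * C ^ 2 * R * ‖Z‖ :=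
      hZ.trans ((mul_le_mul_of_nonneg_left h5 hC0).trans_eq (by ring))
    rw [pow_two] at h7
    exact absurd (le_of_mul_le_mul_right h7 hpos) (not_le.2 hcon)
  calc N ≤ 3 / 2 * C * R * ‖Z‖ := h5
    _ ≤ 3 / 2 * C * R * (3 / 2 * C ^ 2 * R) := by gcongr
    _ = _ := by ring

namespace PathChart

variable {n : ℕ} {M : Type*} [TopologicalSpace M] [ChartedSpace (Vec n) M]
  [IsManifold (𝓡 n) ∞ M]

lemma norm_zero_prodMk (b : Vec n) : ‖((0 : ℝ), b)‖ = ‖b‖ := by simp [Prod.norm_mk]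

lemma mfderiv_extChartAt_pushTangent (κ : PathChart n M) {u η : W12 n} {q₁ : M} {s : ℝ}
    (hs : s ∈ Ioo (0 : ℝ) 1) (hu : u s ∈ κ.U)
    (hsrc : κ.curve u s ∈ (extChartAt (𝓡 n) q₁).source) :
    (mfderiv (𝓡 n) 𝓘(ℝ, Vec n) (extChartAt (𝓡 n) q₁) (κ.curve u s) (κ.pushTangent u η s) : Vec n) =
      fderiv ℝ (κ.rep q₁) (s, u s) (0, η s) := by
  have hc : MDifferentiableAt (𝓡 n) 𝓘(ℝ, Vec n) (extChartAt (𝓡 n) q₁) (κ.φ s (u s)) := by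
    rw [extChartAt_source] at hsrc
    exact (contMDiffAt_extChartAt' (n := ∞) hsrc).mdifferentiableAt (by simp)
  have h1 := mfderiv_comp (u s) hc (κ.mdifferentiableAt_φ (Ioo_subset_Icc_self hs) hu)
  have h2 : HasFDerivAt (fun q => κ.rep q₁ (s, q)) ((fderiv ℝ (κ.rep q₁) (s, u s)).comp
      (ContinuousLinearMap.inr ℝ ℝ (Vec n))) (u s) :=
    HasFDerivAt.comp (u s) (g := κ.rep q₁) (f := fun q => (s, q))
      ((κ.contDiffAt_rep hs hu hsrc).differentiableAt (by simp)).hasFDerivAt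
      (hasFDerivAt_prodMk_right s (u s))
  rw [mfderiv_eq_fderiv] at h1
  change fderiv ℝ (fun q => κ.rep q₁ (s, q)) (u s) = _ at h1
  rw [h2.fderiv] at h1
  exact (DFunLike.congr_fun h1 (η s)).symm

/-- The covariant derivative of a section, in the chart at the base point. -/
lemma covDeriv_pushTangent (κ : PathChart n M) (g : RMetric n M) {u η : W12 n} (hu : u ∈ κ.dom)
    {t : ℝ} (ht : t ∈ Ioo (0 : ℝ) 1) {v w : Vec n} (hv : HasDerivAt u v t) (hw : HasDerivAt η w t) :
    (covDeriv g (κ.curve u) (κ.pushTangent u η) t : Vec n) =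
      fderiv ℝ (fderiv ℝ (κ.rep (κ.curve u t))) (t, u t) (1, v) (0, η t) +
      fderiv ℝ (κ.rep (κ.curve u t)) (t, u t) (0, w) +
      christoffelVec g (κ.curve u t) (extChartAt (𝓡 n) (κ.curve u t) (κ.curve u t))
        (fderiv ℝ (κ.rep (κ.curve u t)) (t, u t) (1, v))
        (fderiv ℝ (κ.rep (κ.curve u t)) (t, u t) (0, η t)) := by
  set q₀ := κ.curve u t with hq₀
  have htI := Ioo_subset_Icc_self ht
  have hsrc : κ.hat (t, u t) ∈ (extChartAt (𝓡 n) q₀).source := mem_extChartAt_source q₀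
  have hcd := κ.contDiffAt_rep ht (hu t htI) hsrc
  have hcd1 : ContDiffAt ℝ ∞ (fderiv ℝ (κ.rep q₀)) (t, u t) := hcd.fderiv_right (by simp)
  have hcont : ContinuousAt (κ.curve u) t :=
    (κ.velocity_curve hu ht hv).1.continuousAt
  have hcoord : (fun s => (mfderiv (𝓡 n) 𝓘(ℝ, Vec n) (extChartAt (𝓡 n) q₀) (κ.curve u s)
      (κ.pushTangent u η s) : Vec n)) =ᶠ[𝓝 t] fun s => fderiv ℝ (κ.rep q₀) (s, u s) (0, η s) := by
    filter_upwards [Ioo_mem_nhds ht.1 ht.2,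
      hcont.eventually (extChartAt_source_mem_nhds (I := 𝓡 n) q₀)] with s hs hs'
    exact κ.mfderiv_extChartAt_pushTangent hs (hu s (Ioo_subset_Icc_self hs)) hs'
  have hder : HasDerivAt (fun s => fderiv ℝ (κ.rep q₀) (s, u s) (0, η s))
      (fderiv ℝ (fderiv ℝ (κ.rep q₀)) (t, u t) (1, v) (0, η t) +
        fderiv ℝ (κ.rep q₀) (t, u t) (0, w)) t := by
    have h1 : HasDerivAt (fun s => fderiv ℝ (κ.rep q₀) (s, u s))
        (fderiv ℝ (fderiv ℝ (κ.rep q₀)) (t, u t) (1, v)) t :=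
      HasFDerivAt.comp_hasDerivAt (l := fderiv ℝ (κ.rep q₀)) (f := fun s => (s, u s)) t
        (hcd1.differentiableAt (by simp)).hasFDerivAt ((hasDerivAt_id t).prodMk hv)
    exact h1.clm_apply ((hasDerivAt_const t (0 : ℝ)).prodMk hw)
  have hvel : (velocity (κ.curve u) t : Vec n) = fderiv ℝ (κ.rep q₀) (t, u t) (1, v) := by
    rw [(κ.velocity_curve hu ht hv).2]
    have h1 := eq_of_totalSpace_mk_eq
      (mk_mfderiv_eq_coordVec (κ.mdifferentiableAt_hat ht (hu t htI)) q₀ hsrc (1, v))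
    exact h1.trans (coordVec_self q₀ _)
  rw [covDeriv]
  refine (PiLp.ext : ∀ {a b : Vec n}, (∀ k, a k = b k) → a = b) fun k => ?_
  change deriv (fun s => (mfderiv (𝓡 n) 𝓘(ℝ, Vec n) (extChartAt (𝓡 n) q₀) (κ.curve u s)
      (κ.pushTangent u η s) : Vec n)) t k + ∑ i, ∑ j, christoffel g q₀ (extChartAt (𝓡 n) q₀ q₀) k i j *
      (show Vec n from velocity (κ.curve u) t) i * (show Vec n from mfderiv (𝓡 n) 𝓘(ℝ, Vec n)
        (extChartAt (𝓡 n) q₀) (κ.curve u t) (κ.pushTangent u η t)) j = _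
  rw [hcoord.deriv_eq, hder.deriv, hvel,
    κ.mfderiv_extChartAt_pushTangent ht (hu t htI) hsrc]
  rfl

/-- The norm of the covariant derivative, in terms of the pull-back of the metric. -/
lemma inner_covDeriv_le (κ : PathChart n M) (g : RMetric n M) {u η : W12 n} (hu : u ∈ κ.dom)
    {t : ℝ} (ht : t ∈ Ioo (0 : ℝ) 1) {v w : Vec n} (hv : HasDerivAt u v t) (hw : HasDerivAt η w t)
    {C : ℝ} {S : Set (Vec n)} (hC : MetricEst κ g t C S) (huS : u t ∈ S) :
    g.inner (κ.curve u t) (covDeriv g (κ.curve u) (κ.pushTangent u η) t)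
      (covDeriv g (κ.curve u) (κ.pushTangent u η) t) ≤
      9 / 4 * C ^ 3 * ((1 + ‖v‖) * ‖η t‖ + ‖w‖) ^ 2 := by
  set q₀ := κ.curve u t with hq₀
  have htI := Ioo_subset_Icc_self ht
  have hsrc : κ.hat (t, u t) ∈ (extChartAt (𝓡 n) q₀).source := mem_extChartAt_source q₀
  set x₀ := extChartAt (𝓡 n) q₀ q₀ with hx₀
  have hx₀t : x₀ ∈ (extChartAt (𝓡 n) q₀).target := mem_extChartAt_target q₀
  set p : ℝ × Vec n := (t, u t) with hp
  set ψ := κ.rep q₀ with hψ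
  have hcd := κ.contDiffAt_rep ht (hu t htI) hsrc
  set res : Vec n := covDeriv g (κ.curve u) (κ.pushTangent u η) t with hres
  have hformula : res = fderiv ℝ (fderiv ℝ ψ) p (1, v) (0, η t) + fderiv ℝ ψ p (0, w) +
      christoffelVec g q₀ x₀ (fderiv ℝ ψ p (1, v)) (fderiv ℝ ψ p (0, η t)) :=
    κ.covDeriv_pushTangent g hu ht hv hw
  have hinner : g.inner (κ.curve u t) (covDeriv g (κ.curve u) (κ.pushTangent u η) t)
      (covDeriv g (κ.curve u) (κ.pushTangent u η) t) = chartMetric g q₀ x₀ res res := by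
    rw [chartMetric_apply]
    exact inner_congr g ((extChartAt (𝓡 n) q₀).left_inv (mem_extChartAt_source q₀)).symm
      (coordVec_self q₀ res).symm (coordVec_self q₀ res).symm
  have hpull : ∀ A B, κ.pullMetric g p A B =
      chartMetric g q₀ x₀ (fderiv ℝ ψ p A) (fderiv ℝ ψ p B) := by
    intro A B
    rw [hp, κ.pullMetric_eq g ht (hu t htI) hsrc]
    rfl
  -- Tested on vectors `Dψ(Z)`, the covariant derivative is given by the Koszul expression of the
  -- pull-back metric plus the term with `w`. The second derivatives of `ψ` and the Christoffel
  -- symbols of the chart disappear, so bounds on the pull-back suffice.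
  have hkos : ∀ Z, 2 * chartMetric g q₀ x₀ res (fderiv ℝ ψ p Z) =
      fderiv ℝ (κ.pullMetric g) p (1, v) (0, η t) Z + fderiv ℝ (κ.pullMetric g) p (0, η t) (1, v) Z -
        fderiv ℝ (κ.pullMetric g) p Z (1, v) (0, η t) + 2 * κ.pullMetric g p (0, w) Z := by
    intro Z
    have hK := koszul_bilinearComp (ψ := ψ) (p := p) (G := chartMetric g q₀) (hcd.of_le two_le_infty)
      (differentiableAt_chartMetric g q₀ hx₀t) (fun v w => chartMetric_symm g q₀ _ v w)
      (κ.pullMetric_eventuallyEq g ht (hu t htI) hsrc)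
      (κ.differentiableAt_pullMetric g ht (hu t htI)) (1, v) (0, η t) Z
    have hψp : ψ p = x₀ := rfl
    rw [hψp, ← chartMetric_christoffelVec g q₀ hx₀t] at hK
    rw [hK, hpull, hformula, map_add, map_add, add_apply, add_apply]
    ring
  -- The spatial differential is bijective, so the covariant derivative itself can be used as the
  -- test vector, with a purely spatial preimage on which the pull-back is coercive.
  have hsurj : ∃ ζ : Vec n, fderiv ℝ ψ p (0, ζ) = res := by
    let A : Vec n →L[ℝ] Vec n := (fderiv ℝ ψ p).comp (ContinuousLinearMap.inr ℝ ℝ (Vec n))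
    have hinj : Function.Injective (A : Vec n →ₗ[ℝ] Vec n) := by
      refine LinearMap.ker_eq_bot.1 (LinearMap.ker_eq_bot'.2 fun b hb => ?_)
      refine κ.injective_fderivWithin_rep htI (hu t htI) hsrc ?_
      rw [fderivWithin_of_mem_nhds (κ.domain_mem_nhds ht (hu t htI))]
      exact hb
    exact LinearMap.injective_iff_surjective.1 hinj res
  obtain ⟨ζ, hζ⟩ := hsurj
  have h1 := hkos (0, ζ)
  rw [hζ] at h1
  have hN : κ.pullMetric g p (0, ζ) (0, ζ) = chartMetric g q₀ x₀ res res := by rw [hpull, hζ]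
  have h2 : ‖((0 : ℝ), ζ)‖ ^ 2 ≤ C * chartMetric g q₀ x₀ res res := by
    rw [← hN, norm_zero_prodMk]
    exact hC.coercive _ huS ζ
  rw [hinner]
  have hC0 : 0 ≤ C := (norm_nonneg _).trans (hC.bound _ huS)
  have hD : ∀ X Y Z : ℝ × Vec n, |fderiv ℝ (κ.pullMetric g) p X Y Z| ≤ C * ‖X‖ * ‖Y‖ * ‖Z‖ :=
    fun X Y Z => abs_apply_apply_le
      (ContinuousLinearMap.le_of_opNorm_le _ (hC.bound_fderiv _ huS) X) Y Z
  refine (le_of_koszul (P := fun A B => κ.pullMetric g p A B)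
    (D := fun A B Z => fderiv ℝ (κ.pullMetric g) p A B Z) hC0
    (abs_apply_apply_le (hC.bound _ huS) _ _) hD h2 h1).trans ?_
  have hA : ‖((1 : ℝ), v)‖ ≤ 1 + ‖v‖ := by
    rw [Prod.norm_mk, norm_one]
    exact max_le (by linarith [norm_nonneg v]) (by linarith)
  rw [norm_zero_prodMk, norm_zero_prodMk]
  gcongr

lemma inner_pushTangent_le (κ : PathChart n M) (g : RMetric n M) {u η : W12 n} (hu : u ∈ κ.dom)
    {t : ℝ} (ht : t ∈ Ioo (0 : ℝ) 1) {C : ℝ} {S : Set (Vec n)} (hC : MetricEst κ g t C S)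
    (huS : u t ∈ S) :
    g.inner (κ.curve u t) (κ.pushTangent u η t) (κ.pushTangent u η t) ≤ C * ‖η t‖ ^ 2 := by
  have htI := Ioo_subset_Icc_self ht
  have h1 : (κ.pushTangent u η t : Vec n) =
      mfderiv 𝓘(ℝ, ℝ × Vec n) (𝓡 n) κ.hat (t, u t) (0, η t) := by
    have h2 : HasMFDerivAt 𝓘(ℝ, Vec n) 𝓘(ℝ, ℝ × Vec n) (fun q : Vec n => (t, q)) (u t)
        (ContinuousLinearMap.inr ℝ ℝ (Vec n)) :=
      (hasFDerivAt_prodMk_right t (u t)).hasMFDerivAt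
    have h3 := (HasMFDerivAt.comp (u t) (g := κ.hat) (f := fun q => (t, q))
      (κ.mdifferentiableAt_hat ht (hu t htI)).hasMFDerivAt h2).mfderiv
    exact congrArg (fun A : Vec n →L[ℝ] Vec n => A (η t)) h3
  have h4 : g.inner (κ.curve u t) (κ.pushTangent u η t) (κ.pushTangent u η t) =
      κ.pullMetric g (t, u t) (0, η t) (0, η t) := by
    rw [pullMetric_apply]
    exact inner_congr g rfl h1 h1
  have hB := norm_zero_prodMk (η t)
  rw [h4]
  refine (le_abs_self _).trans (((κ.pullMetric g (t, u t)).le_opNorm₂ _ _).trans ?_)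
  rw [hB, pow_two, ← mul_assoc]
  gcongr
  exact hC.bound _ huS

/-- The norm of a section is bounded by the `W^{1,2}`-norm of its coordinates, uniformly for curves
with bounded energy close to a given one. -/
theorem exists_sectionNorm_le (κ : PathChart n M) (g : RMetric n M) {c : ℝ → Vec n}
    (hc : ContinuousOn c (Icc 0 1)) (hcU : ∀ t ∈ Icc (0 : ℝ) 1, c t ∈ κ.U) :
    ∃ δ > 0, ∀ R : ℝ, ∃ C : ℝ, ∀ u' ∈ κ.dom, (∀ t ∈ Icc (0 : ℝ) 1, ‖u' t - c t‖ < δ) →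
      ‖W12.der u'‖ ≤ R → ∀ η : W12 n,
        sectionNorm g (κ.curve u') (κ.pushTangent u' η) ≤ C * ‖η‖ := by
  obtain ⟨C, hC, δ, hδ, hest⟩ := κ.exists_metricEst_along g hc hcU
  -- The first factor adds the constants of the two pointwise bounds; the second is that of
  -- `integral_wnorm_sq_le` for the weight `1 + |u'|`, the integral of whose square is at most `2 +
  -- 2R²`.
  refine ⟨δ, hδ, fun R => ⟨Real.sqrt ((9 / 4 * C ^ 3 + C) * (8 * (2 + 2 * R ^ 2) + 2)),
    fun u' hu' hclose hR η => ?_⟩⟩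
  set K := 9 / 4 * C ^ 3 + C with hK
  have hK0 : 0 ≤ K := by positivity
  let ρ : ℝ → ℝ := fun t => 1 + ‖W12.der u' t‖
  have hρ : MemLp ρ 2 mu01 := (memLp_const (1 : ℝ)).add (Lp.memLp (W12.der u')).norm
  have hρ2 : ∫ t, ρ t ^ 2 ∂mu01 ≤ 2 + 2 * R ^ 2 := by
    calc ∫ t, ρ t ^ 2 ∂mu01 ≤ ∫ t, (2 + 2 * ‖W12.der u' t‖ ^ 2) ∂mu01 := by
          refine integral_mono hρ.integrable_sq
            ((integrable_const _).add ((L2.integrable_norm_sq _).const_mul 2)) fun t => ?_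
          change (1 + ‖W12.der u' t‖) ^ 2 ≤ _
          nlinarith [sq_nonneg (1 - ‖W12.der u' t‖)]
      _ = 2 + 2 * ‖W12.der u'‖ ^ 2 := by
          rw [integral_add (integrable_const _) ((L2.integrable_norm_sq _).const_mul 2),
            integral_const_mul, ← L2.norm_sq_eq]
          simp
      _ ≤ _ := by gcongr
  have hint : ∫ t in (0 : ℝ)..1, (g.inner (κ.curve u' t)
      (covDeriv g (κ.curve u') (κ.pushTangent u' η) t)
      (covDeriv g (κ.curve u') (κ.pushTangent u' η) t) +
      g.inner (κ.curve u' t) (κ.pushTangent u' η t) (κ.pushTangent u' η t)) ≤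
      K * ((8 * (2 + 2 * R ^ 2) + 2) * ‖η‖ ^ 2) := by
    rw [intervalIntegral_eq_mu01]
    have hnn : ∀ (x : M) (v : TangentSpace (𝓡 n) x), 0 ≤ g.inner x v v := by
      intro x v
      by_cases h : v = 0
      · rw [h, map_zero]
      · exact (g.pos x v h).le
    refine (integral_mono_of_nonneg (g := fun t => K * W12.wnorm ρ η t ^ 2)
      (Eventually.of_forall fun t => add_nonneg (hnn _ _) (hnn _ _))
      ((W12.memLp_wnorm hρ η).integrable_sq.const_mul K) ?_).trans ?_
    · filter_upwards [ae_mu01_Ioo, W12.ae_hasDerivAt u', W12.ae_hasDerivAt η] with t ht h1 h2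
      have h3 : u' t ∈ Metric.ball (c t) δ :=
        mem_ball_iff_norm.2 (hclose t (Ioo_subset_Icc_self ht))
      have h4 := κ.inner_covDeriv_le g hu' ht h1 h2 (hest t ht) h3
      have h5 := κ.inner_pushTangent_le g hu' ht (hest t ht) h3 (η := η)
      have h6 : ‖η t‖ ≤ W12.wnorm ρ η t := by
        simp only [W12.wnorm, ρ]
        nlinarith [norm_nonneg (η t), norm_nonneg (W12.der u' t), norm_nonneg (W12.der η t),
          mul_nonneg (norm_nonneg (W12.der u' t)) (norm_nonneg (η t))]
      have h7 : ‖η t‖ ^ 2 ≤ W12.wnorm ρ η t ^ 2 := by gcongr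
      have h8 := mul_le_mul_of_nonneg_left h7 hC.le
      change _ ≤ K * W12.wnorm ρ η t ^ 2
      rw [hK, add_mul]
      exact add_le_add h4 (h5.trans h8)
    · rw [integral_const_mul]
      have := W12.integral_wnorm_sq_le hρ η
      gcongr
      refine this.trans ?_
      gcongr
  rw [sectionNorm]
  refine (Real.sqrt_le_sqrt hint).trans_eq ?_
  rw [← mul_assoc, Real.sqrt_mul (by positivity), Real.sqrt_sq (norm_nonneg _)]

end PathChart

/-! ### Energy bounds from bounds on the action -/

variable {n m : ℕ} {M : Type*} [TopologicalSpace M] [ChartedSpace (Vec n) M]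
  [IsManifold (𝓡 n) ∞ M]

/-- By convexity and compactness, the Lagrangian grows quadratically in the velocities. -/
theorem exists_norm_mfderiv_sq_le [CompactSpace M] {g : RMetric n M}
    {L : ℝ × TangentBundle (𝓡 n) M → ℝ}
    (hL : ContMDiffOn (𝓘(ℝ, ℝ).prod (𝓡 n).tangent) 𝓘(ℝ, ℝ) 2 L (Icc (0 : ℝ) 1 ×ˢ univ))
    (hL1 : IsUniformlyConvex g L) (hL2 : HasQuadraticBounds g L) {e : M → Vec m}
    (he : ContMDiff (𝓡 n) 𝓘(ℝ, Vec m) ∞ e) :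
    ∃ C > 0, ∀ t ∈ Ioo (0 : ℝ) 1, ∀ (q : M) (v : TangentSpace (𝓡 n) q),
      ‖(show Vec m from mfderiv (𝓡 n) 𝓘(ℝ, Vec m) e q v)‖ ^ 2 ≤ C * (L (t, ⟨q, v⟩) + C) := by
  have key : ∃ C > 0, ∀ z ∈ Icc (0 : ℝ) 1 ×ˢ (univ : Set M), z.1 ∈ Ioo (0 : ℝ) 1 →
      ∀ v : TangentSpace (𝓡 n) z.2,
      ‖(show Vec m from mfderiv (𝓡 n) 𝓘(ℝ, Vec m) e z.2 v)‖ ^ 2 ≤ C * (L (z.1, ⟨z.2, v⟩) + C) := by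
    -- The bound `C (x + C)` may be enlarged in `C` because `x + C` is nonnegative, being forced to
    -- be so by the left-hand side.
    have hmono : ∀ {a C C' x : ℝ}, 0 < C → C ≤ C' → 0 ≤ a → a ≤ C * (x + C) →
        a ≤ C' * (x + C') := by
      intro a C C' x hC hCC ha h
      have h1 : 0 ≤ x + C := nonneg_of_mul_nonneg_right (ha.trans h) hC
      exact h.trans (mul_le_mul hCC (by linarith) h1 (by linarith))
    refine (isCompact_Icc.prod isCompact_univ).induction_on (p := fun s : Set (ℝ × M) =>
      ∃ C > 0, ∀ z ∈ s, z.1 ∈ Ioo (0 : ℝ) 1 → ∀ v : TangentSpace (𝓡 n) z.2,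
      ‖(show Vec m from mfderiv (𝓡 n) 𝓘(ℝ, Vec m) e z.2 v)‖ ^ 2 ≤ C * (L (z.1, ⟨z.2, v⟩) + C))
      ⟨1, one_pos, by simp⟩ ?_ ?_ ?_
    · rintro s s' hss ⟨C, hC, h⟩
      exact ⟨C, hC, fun z hz => h z (hss hz)⟩
    · rintro s s' ⟨C, hC, h⟩ ⟨C', hC', h'⟩
      refine ⟨max C C', by positivity, fun z hz ht v => ?_⟩
      rcases hz with hz | hz
      · exact hmono hC (le_max_left _ _) (sq_nonneg _) (h z hz ht v)
      · exact hmono hC' (le_max_right _ _) (sq_nonneg _) (h' z hz ht v)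
    · rintro ⟨t₀, q₀⟩ ⟨ht₀, -⟩
      set c := extChartAt (𝓡 n) q₀ with hc
      obtain ⟨K, -, r, hr, hrt, hest⟩ := exists_convexQuadEst_localLagrangian hL hL1 hL2 q₀ ht₀
      obtain ⟨C', hC', hco⟩ := ConvexQuadEst.exists_coercive (n := n) K
      set A : Vec n → Vec n →L[ℝ] Vec m := fderiv ℝ (e ∘ c.symm) with hA
      set B : ℝ := ‖A (c q₀)‖ + 1 with hB
      have hAc : ContinuousAt (fun q => A (c q)) q₀ :=
        continuousAt_fderiv_comp_symm he q₀ (mem_extChartAt_source q₀)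
      have h1 : ∀ᶠ q in 𝓝 q₀, ‖A (c q)‖ < B :=
        hAc.norm.eventually (gt_mem_nhds (lt_add_one _))
      have h2 : ∀ᶠ q in 𝓝 q₀, c q ∈ Metric.ball (c q₀) r :=
        (continuousAt_extChartAt q₀).eventually (Metric.ball_mem_nhds _ hr)
      have h3 : ∀ᶠ q in 𝓝 q₀, q ∈ c.source := extChartAt_source_mem_nhds q₀
      have h4 : ∀ᶠ t : ℝ in 𝓝 t₀, |t - t₀| < r := by
        filter_upwards [Metric.ball_mem_nhds t₀ hr] with t ht
        rwa [Metric.mem_ball, Real.dist_eq] at ht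
      have hmem := prod_mem_nhds h4 (h1.and (h2.and h3))
      -- The constant has to dominate both the factor `B² C'` and the additive term `C'`.
      refine ⟨_, mem_nhdsWithin_of_mem_nhds hmem, (B ^ 2 + 1) * C', by positivity, ?_⟩
      rintro ⟨t, q⟩ ⟨ht', hq1, hq2, hq3⟩ ht v
      have hx : c q ∈ c.target := c.map_source hq3
      have hinv : c.symm (c q) = q := c.left_inv hq3
      -- The base point is generalised so that it can be replaced by its expression in the chart,
      -- where every tangent vector is a coordinate vector.
      have claim : ∀ (q' : M) (_ : c.symm (c q) = q') (v : TangentSpace (𝓡 n) q'),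
          ‖(show Vec m from mfderiv (𝓡 n) 𝓘(ℝ, Vec m) e q' v)‖ ^ 2 ≤
            B ^ 2 * (C' * (L (t, ⟨q', v⟩) + C')) := by
        rintro q' rfl v
        obtain ⟨w, rfl⟩ := surjective_coordVec q₀ hx v
        have h5 : A (c q) w = mfderiv (𝓡 n) 𝓘(ℝ, Vec m) e (c.symm (c q)) (coordVec q₀ (c q) w) :=
          fderiv_comp_extChartAt_symm he q₀ hx w
        have h6 := hco _ _ (hest t ht ht') (c q) hq2 w
        have h7 : ‖A (c q) w‖ ≤ B * ‖w‖ := ContinuousLinearMap.le_of_opNorm_le _ (le_of_lt hq1) w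
        change ‖(show Vec m from mfderiv (𝓡 n) 𝓘(ℝ, Vec m) e (c.symm (c q))
          (coordVec q₀ (c q) w))‖ ^ 2 ≤ B ^ 2 * (C' * (localLagrangian L q₀ t (c q) w + C'))
        rw [← h5]
        calc ‖A (c q) w‖ ^ 2 ≤ (B * ‖w‖) ^ 2 := by gcongr
          _ = B ^ 2 * ‖w‖ ^ 2 := by ring
          _ ≤ _ := by gcongr
      have h8 := claim q hinv v
      have hB0 : 0 < B := by positivity
      have h9 : 0 ≤ C' * (L (t, ⟨q, v⟩) + C') :=
        nonneg_of_mul_nonneg_right ((sq_nonneg _).trans h8) (by positivity)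
      have h10 : 0 ≤ L (t, ⟨q, v⟩) + C' := nonneg_of_mul_nonneg_right h9 hC'
      refine h8.trans ?_
      rw [← mul_assoc]
      have h11 : C' ≤ (B ^ 2 + 1) * C' := by nlinarith [sq_nonneg B]
      exact mul_le_mul (by nlinarith) (by linarith) h10 (by positivity)
  obtain ⟨C, hC, h⟩ := key
  exact ⟨C, hC, fun t ht q v => h (t, q) ⟨Ioo_subset_Icc_self ht, mem_univ _⟩ ht v⟩

/-- The energy of the image of a curve under a smooth map is bounded by the action. -/
theorem exists_energy_le [T2Space M] [CompactSpace M] {g : RMetric n M}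
    {L : ℝ × TangentBundle (𝓡 n) M → ℝ}
    (hL : ContMDiffOn (𝓘(ℝ, ℝ).prod (𝓡 n).tangent) 𝓘(ℝ, ℝ) 2 L (Icc (0 : ℝ) 1 ×ˢ univ))
    (hL1 : IsUniformlyConvex g L) (hL2 : HasQuadraticBounds g L) {e : M → Vec m}
    (he : ContMDiff (𝓡 n) 𝓘(ℝ, Vec m) ∞ e) :
    ∃ C > 0, ∀ γ : W12Curve n M, ∃ w : W12 m, (∀ t ∈ Icc (0 : ℝ) 1, w t = e (γ.ext t)) ∧
      ‖W12.der w‖ ^ 2 ≤ C * (action L γ.ext + C) := by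
  obtain ⟨C, hC, hest⟩ := exists_norm_mfderiv_sq_le hL hL1 hL2 he
  refine ⟨C, hC, fun γ => ?_⟩
  obtain ⟨w, hw⟩ := γ.exists_comp (F := fun p : ℝ × M => e p.2) (he.comp contMDiff_snd)
  refine ⟨w, hw, ?_⟩
  obtain ⟨κ, u, rfl⟩ := γ.exists_push_eq
  have hint := (κ.integrable_lagr hL hL1 hL2 u.2).congr (κ.actionIntegrand_curve L u.2).symm
  rw [κ.action_push, localAction, action, intervalIntegral_eq_mu01, L2.norm_sq_eq]
  have e1 : C * ((∫ t, actionIntegrand L (κ.curve u.1) t ∂mu01) + C) =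
      ∫ t, C * (actionIntegrand L (κ.curve u.1) t + C) ∂mu01 := by
    rw [integral_const_mul, integral_add hint (integrable_const _)]
    simp
  rw [e1]
  refine integral_mono_ae (L2.integrable_norm_sq _)
    ((hint.add (integrable_const _)).const_mul C) ?_
  filter_upwards [ae_mu01_Ioo, W12.ae_hasDerivAt u.1, W12.ae_hasDerivAt w] with t ht h1 h2
  have h3 := (κ.velocity_curve u.2 ht h1).1
  have h4 := mfderiv_comp t (I' := 𝓡 n) (g := e) (f := κ.curve u.1)
    (he.mdifferentiableAt (by simp)) h3
  have h5 : (W12.rep w) =ᶠ[𝓝 t] e ∘ κ.curve u.1 := by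
    filter_upwards [Icc_mem_nhds ht.1 ht.2] with s hs
    rw [hw s hs, κ.ext_push u hs]
    rfl
  rw [mfderiv_eq_fderiv, ← h5.fderiv_eq, h2.hasFDerivAt.fderiv] at h4
  have h6 : W12.der w t = mfderiv (𝓡 n) 𝓘(ℝ, Vec m) e (κ.curve u.1 t) (velocity (κ.curve u.1) t) := by
    have := congrArg (fun A : ℝ →L[ℝ] Vec m => A 1) h4
    exact Eq.trans (by simp) this
  have h7 := hest t ht (κ.curve u.1 t) (velocity (κ.curve u.1) t)
  rw [← h6] at h7
  exact h7

/-- Cauchy-Schwarz against the indicator of the interval. The resulting Hölder estimate provides the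
equicontinuity in the Arzelà-Ascoli theorem. -/
lemma W12.norm_sub_le_sqrt (u : W12 n) {s t : ℝ} (hs : s ∈ Icc (0 : ℝ) 1) (ht : t ∈ Icc (0 : ℝ) 1) :
    ‖u t - u s‖ ≤ ‖W12.der u‖ * Real.sqrt |t - s| := by
  wlog hst : s ≤ t generalizing s t
  · rw [norm_sub_rev, abs_sub_comm]
    exact this ht hs (le_of_not_ge hst)
  rw [W12.sub_eq u hs ht, abs_of_nonneg (sub_nonneg.2 hst)]
  refine (intervalIntegral.norm_integral_le_integral_norm hst).trans ?_
  have hsub : Ioc s t ⊆ Icc (0 : ℝ) 1 := fun x hx => ⟨hs.1.trans hx.1.le, hx.2.trans ht.2⟩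
  have hind : MemLp ((Ioc s t).indicator fun _ => (1 : ℝ)) 2 mu01 :=
    (memLp_const (1 : ℝ)).indicator measurableSet_Ioc
  have h1 := integral_mul_le_sqrt (Lp.memLp (W12.der u)).norm hind
    (Eventually.of_forall fun t => norm_nonneg _)
    (Eventually.of_forall fun t => indicator_nonneg (fun _ _ => zero_le_one) t)
  have hmeas : mu01.restrict (Ioc s t) = volume.restrict (Ioc s t) := by
    rw [Measure.restrict_restrict measurableSet_Ioc, inter_eq_left.2 hsub]
  have h2 : ∫ x, ‖W12.der u x‖ * (Ioc s t).indicator (fun _ => (1 : ℝ)) x ∂mu01 =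
      ∫ x in s..t, ‖W12.der u x‖ := by
    rw [intervalIntegral.integral_of_le hst, ← hmeas, ← integral_indicator measurableSet_Ioc]
    refine integral_congr_ae (Eventually.of_forall fun x => ?_)
    by_cases hx : x ∈ Ioc s t <;> simp [hx]
  have h3 : ∫ x, (Ioc s t).indicator (fun _ => (1 : ℝ)) x ^ 2 ∂mu01 = t - s := by
    have : (fun x => (Ioc s t).indicator (fun _ => (1 : ℝ)) x ^ 2) =
        (Ioc s t).indicator fun _ => (1 : ℝ) := by
      funext x
      by_cases hx : x ∈ Ioc s t <;> simp [hx]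
    rw [this, integral_indicator measurableSet_Ioc, hmeas]
    simp [hst]
  rwa [h2, h3, ← L2.norm_sq_eq, Real.sqrt_sq (norm_nonneg _)] at h1

/-! ### Uniformly convergent subsequences -/

section Compactness

variable {n : ℕ} {M : Type*} [TopologicalSpace M] [T2Space M] [CompactSpace M]
  [ChartedSpace (Vec n) M] [IsManifold (𝓡 n) ∞ M]

/-- A sequence of curves with bounded action has a uniformly convergent subsequence. -/
theorem exists_subseq_tendsto_of_action_le {g : RMetric n M}
    {L : ℝ × TangentBundle (𝓡 n) M → ℝ}
    (hL : ContMDiffOn (𝓘(ℝ, ℝ).prod (𝓡 n).tangent) 𝓘(ℝ, ℝ) 2 L (Icc (0 : ℝ) 1 ×ˢ univ))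
    (hL1 : IsUniformlyConvex g L) (hL2 : HasQuadraticBounds g L) {γ : ℕ → W12Curve n M} {A : ℝ}
    (hA : ∀ h, action L (γ h).ext ≤ A) :
    ∃ (γ₀ : C(unitInterval, M)) (k : ℕ → ℕ), StrictMono k ∧
      Tendsto (fun h => (γ (k h)).1) atTop (𝓝 γ₀) := by
  obtain ⟨m, e, he, hemb, -⟩ := exists_embedding_euclidean_of_compact (I := 𝓡 n) (M := M)
  obtain ⟨C, hC, hest⟩ := exists_energy_le hL hL1 hL2 he
  let E : C(M, Vec m) := ⟨e, hemb.continuous⟩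
  set R : ℝ := Real.sqrt (C * (A + C)) with hR
  let S : Set (BoundedContinuousFunction unitInterval (Vec m)) :=
    -- Curves in the compact set `e(M)` with a common Hölder modulus, where `R` is the energy bound
    -- obtained from the bound `A` on the action.
    {f | (∀ t, f t ∈ range e) ∧ ∀ s t, dist (f s) (f t) ≤ R * Real.sqrt (dist s t)}
  have hS : IsCompact (closure S) := by
    refine BoundedContinuousFunction.arzela_ascoli (range e) (isCompact_range hemb.continuous) S
      (fun f x hf => hf.1 x) ?_
    refine Metric.equicontinuous_of_continuity_modulus (fun d => R * Real.sqrt d) ?_ _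
      fun s t f => f.2.2 s t
    have : Continuous fun d => R * Real.sqrt d := by fun_prop
    simpa using this.tendsto 0
  let f : ℕ → BoundedContinuousFunction unitInterval (Vec m) := fun h =>
    BoundedContinuousFunction.mkOfCompact (E.comp (γ h).1)
  have hf : ∀ h, f h ∈ closure S := by
    refine fun h => subset_closure ⟨fun t => ⟨(γ h).1 t, rfl⟩, fun s t => ?_⟩
    obtain ⟨w, hw, hle⟩ := hest (γ h)
    have h1 : ‖W12.der w‖ ≤ R := by
      refine Real.le_sqrt_of_sq_le (hle.trans ?_)
      have := hA h
      gcongr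
    have h2 : ∀ t : unitInterval, f h t = w t := by
      intro t
      rw [hw t t.2, (γ h).ext_coe]
      rfl
    rw [h2, h2, dist_eq_norm, Subtype.dist_eq, Real.dist_eq]
    refine (W12.norm_sub_le_sqrt w t.2 s.2).trans ?_
    gcongr
  obtain ⟨f₀, -, k, hk, hlim⟩ := hS.tendsto_subseq hf
  have hpt : ∀ t, Tendsto (fun h => f (k h) t) atTop (𝓝 (f₀ t)) := fun t =>
    ((BoundedContinuousFunction.lipschitz_eval_const t).continuous.tendsto f₀).comp hlim
  have hrange : ∀ t, ∃ q, e q = f₀ t := fun t => hemb.isClosed_range.mem_of_tendsto (hpt t)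
    (Eventually.of_forall fun h => ⟨(γ (k h)).1 t, rfl⟩)
  choose γ₀ hγ₀ using hrange
  have hcont : Continuous γ₀ := by
    rw [hemb.isEmbedding.continuous_iff]
    exact f₀.continuous.congr fun t => (hγ₀ t).symm
  refine ⟨⟨γ₀, hcont⟩, k, hk, ?_⟩
  rw [(ContinuousMap.isInducing_postcomp E hemb.isInducing).tendsto_nhds_iff]
  have h3 := ((ContinuousMap.isometryEquivBoundedOfCompact unitInterval (Vec m)).symm.continuous.tendsto
    f₀).comp hlim
  have h4 : E.comp ⟨γ₀, hcont⟩ =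
      (ContinuousMap.isometryEquivBoundedOfCompact unitInterval (Vec m)).symm f₀ :=
    ContinuousMap.ext fun t => hγ₀ t
  rw [h4]
  exact h3

/-- The curves close to a given continuous curve are in the image of one of the local
parametrizations of the atlas. -/
theorem exists_pathChart_of_tendsto {γ : ℕ → W12Curve n M} {γ₀ : C(unitInterval, M)}
    (hγ : Tendsto (fun h => (γ h).1) atTop (𝓝 γ₀)) :
    ∃ (κ : PathChart n M) (c : ℝ → Vec n), ContinuousOn c (Icc 0 1) ∧
      (∀ t ∈ Icc (0 : ℝ) 1, c t ∈ κ.U) ∧ (∀ t : unitInterval, κ.φ t (c t) = γ₀ t) ∧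
      ∃ (N : ℕ) (u : ℕ → κ.dom), (∀ h, κ.push (u h) = γ (h + N)) ∧
        ∀ ε > 0, ∃ N', ∀ h ≥ N', ∀ t ∈ Icc (0 : ℝ) 1, ‖(u h).1 t - c t‖ < ε := by
  have hγ₀c : Continuous fun t : ℝ => γ₀ (projIcc 0 1 zero_le_one t) :=
    γ₀.continuous.comp continuous_projIcc
  obtain ⟨κ, F, W, hF, hWo, hγW, hW⟩ := exists_pathChart (n := n) hγ₀c
  let ι : C(unitInterval, ℝ) := ⟨Subtype.val, continuous_subtype_val⟩
  let F' : C(ℝ × M, Vec n) := ⟨F, hF.continuous⟩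
  -- Uniform convergence is expressed for the graphs, so that eventually they lie in the open set
  -- `W` around the graph of the limit and the smooth map `F` gives their coordinates.
  have hg : Tendsto (fun h => ι.prodMk (γ h).1) atTop (𝓝 (ι.prodMk γ₀)) :=
    (ContinuousMap.continuous_of_continuous_uncurry (fun f : C(unitInterval, M) => ι.prodMk f)
      ((continuous_subtype_val.comp continuous_snd).prodMk
        (continuous_eval : Continuous fun p : C(unitInterval, M) × unitInterval => p.1 p.2))).tendsto
      γ₀ |>.comp hγ
  have hproj : ∀ t : unitInterval, projIcc (0 : ℝ) 1 zero_le_one (t : ℝ) = t := fun t =>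
    projIcc_val zero_le_one t
  have hev : ∀ᶠ h in atTop, MapsTo (ι.prodMk (γ h).1) univ W := by
    refine hg.eventually (ContinuousMap.eventually_mapsTo isCompact_univ hWo fun t _ => ?_)
    have := hγW t t.2
    rwa [hproj] at this
  obtain ⟨N, hN⟩ := eventually_atTop.1 hev
  have hmem : ∀ h, ∀ t ∈ Icc (0 : ℝ) 1, (t, (γ (h + N)).ext t) ∈ W := by
    intro h t ht
    have := hN (h + N) (Nat.le_add_left N h) (mem_univ (⟨t, ht⟩ : unitInterval))
    rw [W12Curve.ext, projIcc_of_mem zero_le_one ht]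
    exact this
  have hex := fun h => κ.exists_push_eq hF (γ (h + N)) fun t ht => hW _ (hmem h t ht) ht
  choose u hu hut using hex
  refine ⟨κ, fun t => F (t, γ₀ (projIcc 0 1 zero_le_one t)),
    (hF.continuous.comp (continuous_id.prodMk hγ₀c)).continuousOn,
    fun t ht => (hW _ (hγW t ht) ht).1, fun t => ?_, N, u, hu, fun ε hε => ?_⟩
  · refine ((hW _ (hγW t t.2) t.2).2).trans ?_
    change γ₀ _ = _
    rw [hproj]
  · have h1 : Tendsto (fun h => F'.comp (ι.prodMk (γ h).1)) atTop (𝓝 (F'.comp (ι.prodMk γ₀))) :=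
      (ContinuousMap.continuous_postcomp F').tendsto _ |>.comp hg
    obtain ⟨N', hN'⟩ := Metric.tendsto_atTop.1 h1 ε hε
    refine ⟨N', fun h hh t ht => ?_⟩
    have h2 := (ContinuousMap.dist_lt_iff hε).1 (hN' (h + N) (hh.trans (Nat.le_add_right h N)))
      ⟨t, ht⟩
    rw [dist_eq_norm] at h2
    have h3 : projIcc (0 : ℝ) 1 zero_le_one t = ⟨t, ht⟩ := projIcc_of_mem zero_le_one ht
    rw [hut h t ht, W12Curve.ext]
    simp only [h3]
    exact h2

end Compactness

/-! ### Strong monotonicity and almost critical curves -/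

section CauchyEstimate

variable {n : ℕ}

/-- Strong monotonicity is used at the single position `q'` in the direction `(0, v - v')`.
Replacing this direction by `(a, b)` and moving the position from `q'` to `q` in the first
differential produce errors of order `s`, each contributing `4` to the constant `8`. -/
lemma ConvexQuadEst.norm_sub_sq_le {C : ℝ} {S : Set (Vec n)} {ℓ : Vec n × Vec n → ℝ}
    (h : ConvexQuadEst C S ℓ) (hC : 0 ≤ C) {q q' : Vec n} (hq : q ∈ S) (hq' : q' ∈ S)
    {v v' a b : Vec n} {s : ℝ} (hs : ‖q - q'‖ ≤ s) (ha : ‖a‖ ≤ 2 * s)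
    (hb : ‖v - v' - b‖ ≤ 2 * s) :
    ‖v - v'‖ ^ 2 ≤ C * (fderiv ℝ ℓ (q, v) (a, b) - fderiv ℝ ℓ (q', v') (a, b) +
      8 * C * s * ((1 + ‖v‖) ^ 2 + (1 + ‖v'‖) ^ 2)) := by
  have hs0 : 0 ≤ s := (norm_nonneg _).trans hs
  refine (h.strict q' hq' v v').trans (mul_le_mul_of_nonneg_left ?_ hC)
  set b' := v - v' - b with hb'
  have e1 : ((0 : Vec n), v - v') = (a, b) + (-a, b') := by
    rw [hb', Prod.mk_add_mk]
    simp
  have h1 : ∀ p ∈ S, ∀ w, |fderiv ℝ ℓ (p, w) (-a, b')| ≤ 4 * C * s * (1 + ‖w‖) ^ 2 := by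
    intro p hp w
    refine (h.bound_fderiv p hp w (-a) b').trans ?_
    have h2 : (1 + ‖w‖) * ‖-a‖ + ‖b'‖ ≤ 4 * s * (1 + ‖w‖) := by
      rw [norm_neg]
      nlinarith [norm_nonneg w, mul_le_mul_of_nonneg_left ha (norm_nonneg w),
        mul_nonneg hs0 (norm_nonneg w)]
    calc C * (1 + ‖w‖) * ((1 + ‖w‖) * ‖-a‖ + ‖b'‖) ≤ C * (1 + ‖w‖) * (4 * s * (1 + ‖w‖)) := by
          gcongr
      _ = _ := by ring
  have h3 : |(fderiv ℝ ℓ (q, v) - fderiv ℝ ℓ (q', v)) (0, v - v')| ≤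
      4 * C * s * ((1 + ‖v‖) ^ 2 + (1 + ‖v'‖) ^ 2) := by
    refine (h.lip_fderiv q' hq' q hq v v 0 (v - v')).trans ?_
    rw [sub_self, norm_zero, add_zero, mul_zero, zero_add]
    have h4 : ‖v - v'‖ ≤ (1 + ‖v‖) + (1 + ‖v'‖) := by
      linarith [_root_.norm_sub_le v v']
    have h5 : (1 + ‖v‖ + ‖v‖) * ‖q - q'‖ ≤ 2 * (1 + ‖v‖) * s :=
      mul_le_mul (by linarith [norm_nonneg v]) hs (norm_nonneg _) (by positivity)
    calc C * ((1 + ‖v‖ + ‖v‖) * ‖q - q'‖) * ‖v - v'‖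
        ≤ C * (2 * (1 + ‖v‖) * s) * ((1 + ‖v‖) + (1 + ‖v'‖)) := by gcongr
      _ = C * s * (2 * (1 + ‖v‖) ^ 2 + 2 * ((1 + ‖v‖) * (1 + ‖v'‖))) := by ring
      _ ≤ C * s * (4 * ((1 + ‖v‖) ^ 2 + (1 + ‖v'‖) ^ 2)) := by
          gcongr
          nlinarith [sq_nonneg ((1 + ‖v‖) - (1 + ‖v'‖)), sq_nonneg (1 + ‖v'‖)]
      _ = _ := by ring
  have h6 := abs_le.1 (h1 q hq v)
  have h7 := abs_le.1 (h1 q' hq' v')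
  have h8 := abs_le.1 h3
  have e2 : (fderiv ℝ ℓ (q', v) - fderiv ℝ ℓ (q', v')) (0, v - v') =
      fderiv ℝ ℓ (q, v) (a, b) - fderiv ℝ ℓ (q', v') (a, b) +
        (fderiv ℝ ℓ (q, v) (-a, b') - fderiv ℝ ℓ (q', v') (-a, b')) -
        (fderiv ℝ ℓ (q, v) - fderiv ℝ ℓ (q', v)) (0, v - v') := by
    rw [sub_apply, sub_apply, e1, map_add, map_add, map_add]
    ring
  rw [e2]
  linarith [h6.1, h6.2, h7.1, h7.2, h8.1, h8.2]

namespace W12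

lemma integral_one_add_norm_sq_le (u : W12 n) :
    ∫ t, (1 + ‖der u t‖) ^ 2 ∂mu01 ≤ 2 + 2 * ‖der u‖ ^ 2 := by
  calc ∫ t, (1 + ‖der u t‖) ^ 2 ∂mu01 ≤ ∫ t, (2 + 2 * ‖der u t‖ ^ 2) ∂mu01 := by
        refine integral_mono ((memLp_const (1 : ℝ)).add (Lp.memLp (der u)).norm).integrable_sq
          ((integrable_const _).add ((L2.integrable_norm_sq _).const_mul 2)) fun t => ?_
        change (1 + ‖der u t‖) ^ 2 ≤ 2 + 2 * ‖der u t‖ ^ 2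
        nlinarith [sq_nonneg (1 - ‖der u t‖)]
    _ = 2 + 2 * ‖der u‖ ^ 2 := by
        rw [integral_add (integrable_const _) ((L2.integrable_norm_sq _).const_mul 2),
          integral_const_mul, ← L2.norm_sq_eq]
        simp

/-- The difference of two curves corrected by an affine function so that it vanishes at the end
points. -/
lemma exists_sub_sub_affine (u u' : W12 n) {s : ℝ}
    (hs : ∀ t ∈ Icc (0 : ℝ) 1, ‖u t - u' t‖ ≤ s) :
    ∃ η : W12 n, η 0 = 0 ∧ η 1 = 0 ∧ (∀ t ∈ Icc (0 : ℝ) 1, ‖η t‖ ≤ 2 * s) ∧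
      (∀ᵐ t ∂mu01, ‖der u t - der u' t - der η t‖ ≤ 2 * s) ∧
      ‖η‖ ≤ 4 * s + ‖der u‖ + ‖der u'‖ := by
  -- The affine interpolation of the end values of `u - u'` is at most `s` in sup norm and has slope
  -- at most `2s`, so subtracting it is a small correction in the derivative as well.
  obtain ⟨a, ha, hda⟩ := exists_affine (u 0 - u' 0) (u 1 - u' 1)
  have h0 : (0 : ℝ) ∈ Icc (0 : ℝ) 1 := left_mem_Icc.2 zero_le_one
  have h1 : (1 : ℝ) ∈ Icc (0 : ℝ) 1 := right_mem_Icc.2 zero_le_one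
  have hη : ∀ t ∈ Icc (0 : ℝ) 1, (u - u' - a) t = u t - u' t - a t := fun t ht => by
    rw [rep_sub _ _ ht, rep_sub _ _ ht]
  have hs0 : 0 ≤ s := (norm_nonneg _).trans (hs 0 h0)
  have hslope : ‖u 1 - u' 1 - (u 0 - u' 0)‖ ≤ 2 * s := by
    linarith [_root_.norm_sub_le (u 1 - u' 1) (u 0 - u' 0), hs 0 h0, hs 1 h1]
  have hna : ∀ t ∈ Icc (0 : ℝ) 1, ‖a t‖ ≤ s := by
    intro t ht
    have e : a t = (1 - t) • (u 0 - u' 0) + t • (u 1 - u' 1) := by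
      rw [ha t ht]
      module
    rw [e]
    refine (norm_add_le _ _).trans ?_
    rw [norm_smul, norm_smul, Real.norm_eq_abs, Real.norm_eq_abs, abs_of_nonneg ht.1,
      abs_of_nonneg (sub_nonneg.2 ht.2)]
    nlinarith [mul_le_mul_of_nonneg_left (hs 0 h0) (sub_nonneg.2 ht.2),
      mul_le_mul_of_nonneg_left (hs 1 h1) ht.1]
  have hsup : ∀ t ∈ Icc (0 : ℝ) 1, ‖(u - u' - a) t‖ ≤ 2 * s := by
    intro t ht
    rw [hη t ht]
    linarith [_root_.norm_sub_le (u t - u' t) (a t), hs t ht, hna t ht]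
  have hda' : ‖der a‖ ≤ 2 * s := by
    rw [← sq_le_sq₀ (norm_nonneg _) (by positivity), L2.norm_sq_eq]
    calc ∫ t, ‖der a t‖ ^ 2 ∂mu01 ≤ ∫ t, (2 * s) ^ 2 ∂mu01 := by
          refine integral_mono_ae (L2.integrable_norm_sq _) (integrable_const _) ?_
          filter_upwards [hda] with t ht
          rw [ht]
          gcongr
      _ = (2 * s) ^ 2 := by simp
  refine ⟨u - u' - a, ?_, ?_, hsup, ?_, ?_⟩
  · rw [hη 0 h0, ha 0 h0]
    simp
  · rw [hη 1 h1, ha 1 h1]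
    simp
  · rw [der_sub, der_sub]
    filter_upwards [hda, Lp.coeFn_sub (der u - der u') (der a), Lp.coeFn_sub (der u) (der u')]
      with t e1 e2 e3
    rw [e2, Pi.sub_apply, e3, Pi.sub_apply, sub_sub_cancel, e1]
    exact hslope
  · refine (norm_le_of_bound _ (by positivity) hsup).trans ?_
    rw [der_sub, der_sub]
    linarith [_root_.norm_sub_le (der u - der u') (der a), _root_.norm_sub_le (der u) (der u')]

/-- Two curves which are uniformly close and almost critical with respect to the variations with
fixed end points are close in `W^{1,2}`. -/
theorem exists_norm_der_sub_sq_le {ℓ : ℝ → Vec n × Vec n → ℝ} {C : ℝ} (hC : 0 ≤ C)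
    {S : ℝ → Set (Vec n)} (hest : ∀ t ∈ Ioo (0 : ℝ) 1, ConvexQuadEst C (S t) (ℓ t)) {u u' : W12 n}
    (hu : ∀ t ∈ Ioo (0 : ℝ) 1, u t ∈ S t) (hu' : ∀ t ∈ Ioo (0 : ℝ) 1, u' t ∈ S t)
    (hi : ∀ η : W12 n, Integrable (fun t => fderiv ℝ (ℓ t) (u t, der u t) (η t, der η t)) mu01)
    (hi' : ∀ η : W12 n, Integrable (fun t => fderiv ℝ (ℓ t) (u' t, der u' t) (η t, der η t)) mu01)
    {s : ℝ} (hs : ∀ t ∈ Icc (0 : ℝ) 1, ‖u t - u' t‖ ≤ s) :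
    ∃ η : W12 n, η 0 = 0 ∧ η 1 = 0 ∧ ‖η‖ ≤ 4 * s + ‖der u‖ + ‖der u'‖ ∧
      ‖der u - der u'‖ ^ 2 ≤ C * ((∫ t, fderiv ℝ (ℓ t) (u t, der u t) (η t, der η t) ∂mu01) -
        (∫ t, fderiv ℝ (ℓ t) (u' t, der u' t) (η t, der η t) ∂mu01) +
        8 * C * s * ((2 + 2 * ‖der u‖ ^ 2) + (2 + 2 * ‖der u'‖ ^ 2))) := by
  obtain ⟨η, h0, h1, hsup, hder, hn⟩ := exists_sub_sub_affine u u' hs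
  refine ⟨η, h0, h1, hn, ?_⟩
  have hs0 : 0 ≤ s := (norm_nonneg _).trans (hs 0 (left_mem_Icc.2 zero_le_one))
  have hw : ∀ u : W12 n, Integrable (fun t => (1 + ‖der u t‖) ^ 2) mu01 := fun u =>
    ((memLp_const (1 : ℝ)).add (Lp.memLp (der u)).norm).integrable_sq
  rw [L2.norm_sq_eq]
  have hint := (((hi η).sub (hi' η)).add (((hw u).add (hw u')).const_mul (8 * C * s))).const_mul C
  refine (integral_mono_ae (L2.integrable_norm_sq _) hint ?_).trans ?_
  · filter_upwards [ae_mu01_Ioo, hder, Lp.coeFn_sub (der u) (der u')] with t ht h2 h3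
    rw [h3]
    have htI := Ioo_subset_Icc_self ht
    exact (hest t ht).norm_sub_sq_le hC (hu t ht) (hu' t ht) (hs t htI) (hsup t htI) h2
  · rw [integral_const_mul, integral_add' ((hi η).sub (hi' η))
      (((hw u).add (hw u')).const_mul _), integral_sub' (hi η) (hi' η), integral_const_mul,
      integral_add' (hw u) (hw u')]
    gcongr
    · exact integral_one_add_norm_sq_le u
    · exact integral_one_add_norm_sq_le u'

end W12
end CauchyEstimate

/-! ### The Palais-Smale condition -/

section PalaisSmale

variable {n : ℕ} {M : Type*} [TopologicalSpace M] [ChartedSpace (Vec n) M]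
  [IsManifold (𝓡 n) ∞ M]

/-- The constant curve has zero velocity; variations with fixed end points are therefore always
admissible. -/
lemma isTangentTo_zero {Q : Set (M × M)} {q₀ q₁ : M} (h : (q₀, q₁) ∈ Q) :
    IsTangentTo (n := n) Q q₀ q₁ 0 0 := by
  refine ⟨fun _ => (q₀, q₁), contMDiff_const, fun _ => h, rfl, ?_⟩
  have h1 : mfderiv 𝓘(ℝ, ℝ) ((𝓡 n).prod (𝓡 n)) (fun _ : ℝ => (q₀, q₁)) 0 = 0 := mfderiv_const
  rw [h1]
  rfl

lemma le_diffActionNorm (κ : PathChart n M) {g : RMetric n M}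
    {L : ℝ × TangentBundle (𝓡 n) M → ℝ} {Q : Set (M × M)} (u : κ.dom) (η : W12 n)
    (htan : IsTangentTo Q (κ.curve u.1 0) (κ.curve u.1 1) (κ.pushTangent u.1 η 0)
      (κ.pushTangent u.1 η 1))
    (hle : sectionNorm g (κ.curve u.1) (κ.pushTangent u.1 η) ≤ 1) :
    ENNReal.ofReal |fderiv ℝ (localAction L κ) u.1 η| ≤ diffActionNorm g L Q (κ.push u) := by
  rw [diffActionNorm]
  exact le_iSup_of_le κ (le_iSup_of_le u (le_iSup_of_le η (le_iSup_of_le rfl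
    (le_iSup_of_le htan (le_iSup_of_le hle le_rfl)))))

namespace PathChart

lemma exists_convexQuadEst_along (κ : PathChart n M) {g : RMetric n M}
    {L : ℝ × TangentBundle (𝓡 n) M → ℝ}
    (hL : ContMDiffOn (𝓘(ℝ, ℝ).prod (𝓡 n).tangent) 𝓘(ℝ, ℝ) 2 L (Icc (0 : ℝ) 1 ×ˢ univ))
    (hL1 : IsUniformlyConvex g L) (hL2 : HasQuadraticBounds g L) {c : ℝ → Vec n}
    (hc : ContinuousOn c (Icc 0 1)) (hcU : ∀ t ∈ Icc (0 : ℝ) 1, c t ∈ κ.U) :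
    ∃ C > 0, ∃ δ > 0, ∀ t ∈ Ioo (0 : ℝ) 1,
      ConvexQuadEst C (Metric.ball (c t) δ) (κ.lagr L t) :=
  exists_uniform_along (fun t C S => ConvexQuadEst C S (κ.lagr L t))
    (fun _ _ _ _ _ hC hS h => h.mono hC hS)
    (fun _ ht₀ _ hq₀ => κ.exists_convexQuadEst_lagr hL hL1 hL2 ht₀ hq₀) hc hcU

/-- The energy of a curve is bounded by its action. -/
lemma norm_der_sq_le (κ : PathChart n M) {g : RMetric n M}
    {L : ℝ × TangentBundle (𝓡 n) M → ℝ}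
    (hL : ContMDiffOn (𝓘(ℝ, ℝ).prod (𝓡 n).tangent) 𝓘(ℝ, ℝ) 2 L (Icc (0 : ℝ) 1 ×ˢ univ))
    (hL1 : IsUniformlyConvex g L) (hL2 : HasQuadraticBounds g L) {u : W12 n} (hu : u ∈ κ.dom)
    {C' : ℝ} (h : ∀ t ∈ Ioo (0 : ℝ) 1, ∀ v, ‖v‖ ^ 2 ≤ C' * (κ.lagr L t (u t, v) + C')) :
    ‖W12.der u‖ ^ 2 ≤ C' * (localAction L κ u + C') := by
  have hint := κ.integrable_lagr hL hL1 hL2 hu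
  have e1 : C' * ((∫ t, κ.lagr L t (u t, W12.der u t) ∂mu01) + C') =
      ∫ t, C' * (κ.lagr L t (u t, W12.der u t) + C') ∂mu01 := by
    rw [integral_const_mul, integral_add hint (integrable_const _)]
    simp
  rw [κ.localAction_eq L hu, e1, L2.norm_sq_eq]
  refine integral_mono_ae (L2.integrable_norm_sq _)
    ((hint.add (integrable_const _)).const_mul C') ?_
  filter_upwards [ae_mu01_Ioo] with t ht
  exact h t ht _

/-- The differential of the action on the variations with fixed end points is bounded by its dual
norm. -/
lemma abs_fderiv_localAction_le (κ : PathChart n M) {g : RMetric n M}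
    {L : ℝ × TangentBundle (𝓡 n) M → ℝ} {Q : Set (M × M)} {u : κ.dom}
    (hQ : (κ.curve u.1 0, κ.curve u.1 1) ∈ Q) {C d : ℝ} (hC : 0 < C) (hd : 0 ≤ d)
    (hsec : ∀ η : W12 n, sectionNorm g (κ.curve u.1) (κ.pushTangent u.1 η) ≤ C * ‖η‖)
    (hnorm : diffActionNorm g L Q (κ.push u) ≤ ENNReal.ofReal d) {η : W12 n} (h0 : η 0 = 0)
    (h1 : η 1 = 0) :
    |fderiv ℝ (localAction L κ) u.1 η| ≤ C * ‖η‖ * d := by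
  rcases eq_or_ne η 0 with rfl | hη
  · rw [map_zero, abs_zero, norm_zero, mul_zero, zero_mul]
  have hpos : 0 < C * ‖η‖ := mul_pos hC (norm_pos_iff.2 hη)
  -- The normalisation making the section of norm at most `1`; linearity of the differential then
  -- restores the factor `C ‖η‖`.
  set r := (C * ‖η‖)⁻¹ with hr
  have hr0 : 0 < r := inv_pos.2 hpos
  have hpt : ∀ t ∈ Icc (0 : ℝ) 1, η t = 0 → κ.pushTangent u.1 (r • η) t = 0 := by
    intro t ht h
    have h2 : (r • η) t = 0 := by rw [W12.rep_smul _ _ ht, h, smul_zero]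
    rw [pushTangent, h2]
    exact map_zero _
  have htan : IsTangentTo Q (κ.curve u.1 0) (κ.curve u.1 1) (κ.pushTangent u.1 (r • η) 0)
      (κ.pushTangent u.1 (r • η) 1) := by
    rw [hpt 0 (by simp) h0, hpt 1 (by simp) h1]
    exact isTangentTo_zero hQ
  have hle : sectionNorm g (κ.curve u.1) (κ.pushTangent u.1 (r • η)) ≤ 1 := by
    refine (hsec _).trans_eq ?_
    rw [norm_smul, Real.norm_eq_abs, abs_of_pos hr0, mul_left_comm, hr, inv_mul_cancel₀ hpos.ne']
  have h2 : ENNReal.ofReal |fderiv ℝ (localAction L κ) u.1 (r • η)| ≤ ENNReal.ofReal d :=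
    (le_diffActionNorm κ u (r • η) htan hle).trans hnorm
  rw [ENNReal.ofReal_le_ofReal_iff hd, map_smul, smul_eq_mul, abs_mul, abs_of_pos hr0, hr,
    inv_mul_le_iff₀ hpos] at h2
  exact h2

/-- A uniformly convergent Palais-Smale sequence with bounded action has converging derivatives. -/
theorem cauchySeq_der (κ : PathChart n M) {g : RMetric n M}
    {L : ℝ × TangentBundle (𝓡 n) M → ℝ}
    (hL : ContMDiffOn (𝓘(ℝ, ℝ).prod (𝓡 n).tangent) 𝓘(ℝ, ℝ) 2 L (Icc (0 : ℝ) 1 ×ˢ univ))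
    (hL1 : IsUniformlyConvex g L) (hL2 : HasQuadraticBounds g L) {Q : Set (M × M)} {c : ℝ → Vec n}
    (hc : ContinuousOn c (Icc 0 1)) (hcU : ∀ t ∈ Icc (0 : ℝ) 1, c t ∈ κ.U) {u : ℕ → κ.dom}
    (huc : ∀ ε > 0, ∃ N, ∀ h ≥ N, ∀ t ∈ Icc (0 : ℝ) 1, ‖(u h).1 t - c t‖ < ε)
    (huQ : ∀ h, (κ.curve (u h).1 0, κ.curve (u h).1 1) ∈ Q) {A : ℝ}
    (hA : ∀ h, localAction L κ (u h).1 ≤ A)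
    (hd : ∀ ε > 0, ∃ N, ∀ h ≥ N, diffActionNorm g L Q (κ.push (u h)) ≤ ENNReal.ofReal ε) :
    CauchySeq fun h => W12.der (u h).1 := by
  obtain ⟨C, hC, δ, hδ, hest⟩ := κ.exists_convexQuadEst_along hL hL1 hL2 hc hcU
  obtain ⟨C₁, hC₁, hco⟩ := ConvexQuadEst.exists_coercive (n := n) C
  obtain ⟨δ₂, hδ₂, hsec⟩ := κ.exists_sectionNorm_le g hc hcU
  set R := Real.sqrt (C₁ * (A + C₁)) with hR
  obtain ⟨C₂, hC₂⟩ := hsec R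
  set K := max C₂ 1 with hK
  have hK0 : 0 < K := lt_of_lt_of_le one_pos (le_max_right _ _)
  -- This collects, per unit of `s`, the two values of the differential on `η`, where `‖η‖ ≤ 4 + 2R`
  -- for `s ≤ 1`, and the error term of the monotonicity estimate for derivatives of norm at most
  -- `R`.
  set B := C * (2 * (K * (4 + 2 * R)) + 16 * C * (2 + 2 * R ^ 2)) with hB
  have hR0 : 0 ≤ R := Real.sqrt_nonneg _
  have hB0 : 0 < B := by positivity
  obtain ⟨N₁, hN₁⟩ := huc (min δ δ₂) (lt_min hδ hδ₂)
  have hball : ∀ h ≥ N₁, ∀ t ∈ Ioo (0 : ℝ) 1, (u h).1 t ∈ Metric.ball (c t) δ := fun h hh t ht =>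
    mem_ball_iff_norm.2 ((hN₁ h hh t (Ioo_subset_Icc_self ht)).trans_le (min_le_left _ _))
  have hder : ∀ h ≥ N₁, ‖W12.der (u h).1‖ ≤ R := by
    intro h hh
    refine Real.le_sqrt_of_sq_le ((κ.norm_der_sq_le hL hL1 hL2 (u h).2 (C' := C₁)
      fun t ht v => hco _ _ (hest t ht) _ (hball h hh t ht) v).trans ?_)
    have := hA h
    gcongr
  have key : ∀ s : ℝ, 0 < s → s ≤ 1 → ∃ N, ∀ i ≥ N, ∀ j ≥ N,
      ‖W12.der (u i).1 - W12.der (u j).1‖ ^ 2 ≤ B * s := by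
    intro s hs hs1
    obtain ⟨N₂, hN₂⟩ := huc (s / 2) (by positivity)
    obtain ⟨N₃, hN₃⟩ := hd s hs
    refine ⟨max N₁ (max N₂ N₃), fun i hi j hj => ?_⟩
    have hi1 := (le_max_left _ _).trans hi
    have hj1 := (le_max_left _ _).trans hj
    have hi2 := (le_max_left _ _).trans ((le_max_right _ _).trans hi)
    have hj2 := (le_max_left _ _).trans ((le_max_right _ _).trans hj)
    have hi3 := (le_max_right _ _).trans ((le_max_right _ _).trans hi)
    have hj3 := (le_max_right _ _).trans ((le_max_right _ _).trans hj)
    have hclose : ∀ t ∈ Icc (0 : ℝ) 1, ‖(u i).1 t - (u j).1 t‖ ≤ s := by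
      intro t ht
      have h1 := hN₂ i hi2 t ht
      have h2 := hN₂ j hj2 t ht
      have h3 := norm_sub_le_norm_sub_add_norm_sub ((u i).1 t) (c t) ((u j).1 t)
      rw [norm_sub_rev (c t)] at h3
      linarith
    -- A single variation `η` tests both differentials; each is small on it because both curves are
    -- almost critical.
    obtain ⟨η, h0, h1, hη, hle⟩ := W12.exists_norm_der_sub_sq_le hC.le hest (hball i hi1)
      (hball j hj1) (κ.integrable_fderiv_lagr hL hL1 hL2 (u i).2)
      (κ.integrable_fderiv_lagr hL hL1 hL2 (u j).2) hclose
    rw [← κ.fderiv_localAction hL hL1 hL2 (u i).2, ← κ.fderiv_localAction hL hL1 hL2 (u j).2] at hle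
    have hsecK : ∀ h ≥ N₁, ∀ η : W12 n,
        sectionNorm g (κ.curve (u h).1) (κ.pushTangent (u h).1 η) ≤ K * ‖η‖ := fun h hh η =>
      (hC₂ (u h).1 (u h).2 (fun t ht => (hN₁ h hh t ht).trans_le (min_le_right _ _)) (hder h hh)
        η).trans (mul_le_mul_of_nonneg_right (le_max_left _ _) (norm_nonneg _))
    have hη' : ‖η‖ ≤ 4 + 2 * R := by linarith [hder i hi1, hder j hj1]
    have e1 := κ.abs_fderiv_localAction_le (huQ i) hK0 hs.le (hsecK i hi1) (hN₃ i hi3) h0 h1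
    have e2 := κ.abs_fderiv_localAction_le (huQ j) hK0 hs.le (hsecK j hj1) (hN₃ j hj3) h0 h1
    have e3 : K * ‖η‖ * s ≤ K * (4 + 2 * R) * s := by gcongr
    have e4 := pow_le_pow_left₀ (norm_nonneg _) (hder i hi1) 2
    have e5 := pow_le_pow_left₀ (norm_nonneg _) (hder j hj1) 2
    have e6 : 8 * C * s * ((2 + 2 * ‖W12.der (u i).1‖ ^ 2) + (2 + 2 * ‖W12.der (u j).1‖ ^ 2)) ≤
        8 * C * s * ((2 + 2 * R ^ 2) + (2 + 2 * R ^ 2)) := by gcongr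
    have e7 : B * s = C * (2 * (K * (4 + 2 * R) * s) +
        8 * C * s * ((2 + 2 * R ^ 2) + (2 + 2 * R ^ 2))) := by rw [hB]; ring
    rw [e7]
    refine hle.trans (mul_le_mul_of_nonneg_left ?_ hC.le)
    linarith [(abs_le.1 e1).2, (abs_le.1 e2).1]
  refine Metric.cauchySeq_iff.2 fun ε hε => ?_
  obtain ⟨N, hN⟩ := key (min 1 (ε ^ 2 / (2 * B))) (by positivity) (min_le_left _ _)
  refine ⟨N, fun i hi j hj => ?_⟩
  rw [dist_eq_norm]
  refine lt_of_pow_lt_pow_left₀ 2 hε.le ((hN i hi j hj).trans_lt ?_)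
  calc B * min 1 (ε ^ 2 / (2 * B)) ≤ B * (ε ^ 2 / (2 * B)) := by
        gcongr
        exact min_le_right _ _
    _ = ε ^ 2 / 2 := by field_simp
    _ < ε ^ 2 := half_lt_self (by positivity)

/-- The topology of the space of curves is the final one for the parametrizations. Convergence in
coordinates therefore gives convergence of the curves. -/
lemma continuous_push (κ : PathChart n M) : Continuous κ.push :=
  continuous_iSup_rng (i := κ) continuous_coinduced_rng

end PathChart

/-- Convergence at time `0` and of the derivatives gives a limit in `W^{1,2}`. Convergence there
implies pointwise convergence, so the limit is the given continuous function. -/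
lemma W12.exists_tendsto_of_tendsto_uniformly {u : ℕ → W12 n} {c : ℝ → Vec n}
    (huc : ∀ ε > 0, ∃ N, ∀ h ≥ N, ∀ t ∈ Icc (0 : ℝ) 1, ‖u h t - c t‖ < ε)
    (hder : CauchySeq fun h => W12.der (u h)) :
    ∃ v : W12 n, Tendsto u atTop (𝓝 v) ∧ ∀ t ∈ Icc (0 : ℝ) 1, v t = c t := by
  have hlim : ∀ t ∈ Icc (0 : ℝ) 1, Tendsto (fun h => u h t) atTop (𝓝 (c t)) := by
    intro t ht
    refine Metric.tendsto_atTop.2 fun ε hε => ?_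
    obtain ⟨N, hN⟩ := huc ε hε
    exact ⟨N, fun h hh => by rw [dist_eq_norm]; exact hN h hh t ht⟩
  obtain ⟨v, hv⟩ := W12.exists_tendsto u (hlim 0 (by simp)).cauchySeq hder
  refine ⟨v, hv, fun t ht => tendsto_nhds_unique ?_ (hlim t ht)⟩
  have h1 := tendsto_iff_norm_sub_tendsto_zero.1 hv
  refine tendsto_iff_norm_sub_tendsto_zero.2 (squeeze_zero (fun _ => norm_nonneg _) (fun h => ?_)
    (by simpa using h1.const_mul 2))
  rw [← W12.rep_sub _ _ ht]
  exact W12.norm_rep_le _ ht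

variable [T2Space M] [CompactSpace M]

/-- The Palais-Smale condition for the action on `W^{1,2}_Q([0,1], M)`. -/
theorem palaisSmale_action {g : RMetric n M} {L : ℝ × TangentBundle (𝓡 n) M → ℝ}
    (hL : ContMDiffOn (𝓘(ℝ, ℝ).prod (𝓡 n).tangent) 𝓘(ℝ, ℝ) 2 L (Icc (0 : ℝ) 1 ×ˢ univ))
    (hL1 : IsUniformlyConvex g L) (hL2 : HasQuadraticBounds g L) {Q : Set (M × M)}
    (hQ : IsClosed Q) :
    PalaisSmale (fun γ : W12CurveIn n Q => action L γ.1.ext)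
      (fun γ : W12CurveIn n Q => diffActionNorm g L Q γ.1) := by
  rintro γ ⟨A, hA⟩ hlim
  obtain ⟨γ₀, k, hk, hγ₀⟩ := exists_subseq_tendsto_of_action_le hL hL1 hL2
    (γ := fun h => (γ h).1) fun h => (le_abs_self _).trans (hA h)
  obtain ⟨κ, c, hc, hcU, hcγ, N, u, hu, huc⟩ :=
    exists_pathChart_of_tendsto (γ := fun h => (γ (k h)).1) hγ₀
  have hQu : ∀ h, (κ.curve (u h).1 0, κ.curve (u h).1 1) ∈ Q := by
    intro h
    have h1 := (γ (k (h + N))).2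
    rw [← hu h] at h1
    exact h1
  -- The coordinates `u` start at the index `N`, beyond which the curves lie in the image of `κ`.
  have hkN : StrictMono fun h => k (h + N) := hk.comp fun i j hij => Nat.add_lt_add_right hij N
  have hcauchy := κ.cauchySeq_der (g := g) hL hL1 hL2 hc hcU huc hQu (A := A)
    (fun h => by
      rw [← κ.action_push, hu h]
      exact (le_abs_self _).trans (hA _))
    (fun ε hε => by
      have h1 := (hlim.comp hkN.tendsto_atTop).eventually
        (gt_mem_nhds (ENNReal.ofReal_pos.2 hε))
      obtain ⟨N', hN'⟩ := eventually_atTop.1 h1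
      refine ⟨N', fun h hh => ?_⟩
      rw [hu h]
      exact (hN' h hh).le)
  obtain ⟨v, hv, hvc⟩ := W12.exists_tendsto_of_tendsto_uniformly huc hcauchy
  have hvU : v ∈ κ.dom := fun t ht => by rw [hvc t ht]; exact hcU t ht
  have hpush : Tendsto (fun h => κ.push (u h)) atTop (𝓝 (κ.push ⟨v, hvU⟩)) :=
    (κ.continuous_push.tendsto _).comp (tendsto_subtype_rng.2 hv)
  have hγ₀v : (κ.push ⟨v, hvU⟩).1 = γ₀ := ContinuousMap.ext fun t => by
    rw [← hcγ t, ← hvc t t.2]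
    rfl
  have hmem : ((κ.push ⟨v, hvU⟩).1 0, (κ.push ⟨v, hvU⟩).1 1) ∈ Q := by
    rw [hγ₀v]
    -- The end points depend continuously on the curve, so the limit inherits the boundary condition
    -- from the closed set `Q`.
    have h0 := fun t : unitInterval => ((continuous_eval_const t : Continuous fun f : C(unitInterval, M) => f t).tendsto γ₀).comp hγ₀
    exact hQ.mem_of_tendsto ((h0 0).prodMk_nhds (h0 1))
      (Eventually.of_forall fun h => (γ (k h)).2)
  refine ⟨⟨κ.push ⟨v, hvU⟩, hmem⟩, fun h => k (h + N), hkN, tendsto_subtype_rng.2 ?_⟩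
  exact hpush.congr hu

end PalaisSmale

end ActionPS

end

theorem mainTheorem8 (n : ℕ) (M : Type*) [TopologicalSpace M] [T2Space M] [CompactSpace M]
    [ConnectedSpace M] [ChartedSpace (Vec n) M] [IsManifold (𝓡 n) ∞ M]
    (g : RMetric n M) (Q : Set (M × M)) (hQ : IsClosedSubmanifold (n := n) Q)
    (L : ℝ × TangentBundle (𝓡 n) M → ℝ)
    (hL : ContMDiffOn (𝓘(ℝ, ℝ).prod (𝓡 n).tangent) 𝓘(ℝ, ℝ) 2 L (Icc (0 : ℝ) 1 ×ˢ univ))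
    (hL1 : IsUniformlyConvex g L) (hL2 : HasQuadraticBounds g L) :
    -- the action is finite and of class `C¹` on `W^{1,2}([0,1], M)`
    (∀ γ : W12Curve n M, IntervalIntegrable (actionIntegrand L γ.ext) volume 0 1) ∧
    (∀ κ : PathChart n M, ContDiffOn ℝ 1 (localAction L κ) κ.dom) ∧
    -- its restriction to `W^{1,2}_Q([0,1], M)` satisfies the Palais-Smale condition
    PalaisSmale (fun γ : W12CurveIn n Q => action L γ.1.ext)
      (fun γ : W12CurveIn n Q => diffActionNorm g L Q γ.1) := by
  exact ⟨fun γ => intervalIntegrable_actionIntegrand hL hL1 hL2 γ,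
    fun κ => κ.contDiffOn_localAction hL hL1 hL2, palaisSmale_action hL hL1 hL2 hQ.1⟩
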